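/- Let $m,n,N\ge 0$, and let $e_{i,j}$ be the elementary matrices of size $2m+2n+1$. Put $C=\operatorname{diag}(\alpha_m,\beta_n)$, $\alpha_m=\sum_{i=1}^{2m}e_{i,2m+1-i}$, $\beta_n=\sum_{i=1}^{2n+1}(-1)^{n+i-1}e_{i,2n+2-i}$, and $$J=\operatorname{diag}(0_{2m},J_0(\lambda)),\quad J_0(\lambda)=e_{1,2n+1}\lambda+b,\quad b=\sum_{i=1}^{2n}e_{i+1,i}.$$ All objects below are formal: their coefficients are formal power series in the times $t_1=x,t_3,\dots,t_{2N+1}$, and loops are formal Laurent series in $\lambda^{-1}$ in each order in $t$. For a loop $\xi=\sum_i\xi_i\lambda^i$ write $\xi_+=\sum_{i\ge0}\xi_i\lambda^i$, $\xi_-=\xi-\xi_+$, and $\langle\xi,\eta\rangle_{k}=\sum_i\operatorname{tr}(\xi_i\eta_{k-i})$. Let $G$ be the group of invertible loops $g$ with $g(\lambda)\,C\,g(-\lambda)^{t}\,C^{-1}=I$; let $G_+\subset G$ consist of the $g$ with only nonnegative powers of $\lambda$, and $G_-\subset G$ of the $g=I+\sum_{i<0}g_i\lambda^i$ with $\det g=1$.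 Let $f\in G_-$ be independent of $t$, let $W(t)=\exp\bigl(-\sum_{i=1}^{N+1}t_{2i-1}J^{2i-1}\bigr)$, and factor $W(t)f^{-1}=M(t)^{-1}E(t)$ with $M\in G_-$, $E\in G_+$. The tau function $\tau_f(t)$ is defined by $$S(W(t))\,S(f^{-1})=\tau_f(t)\,S(M(t)^{-1})\,S(E(t))$$ in the central extension of the loop group with Lie algebra cocycle $w(\xi,\eta)=\langle\partial_\lambda\xi,\eta\rangle_{-1}$, where $S$ (of a group element) denotes the natural lift of $G_\pm$. Concretely, the extension is the determinant extension on the negative half $H_-$ of the space of vector-valued loops: $S(g)=(g,P_-gP_-)$, and $(g,rq)=\det(r)\cdot(g,q)$. Let $V_{m,n}$ be the span of $$\mu_i=e_{i,2m+2n+1}+(-1)^{n+1}e_{2m+1,2m+1-i},\qquad \nu_i=(-1)^ne_{m+i,2m+2n+1}-e_{2m+1,m+1-i}\qquad(1\le i\le m),$$ $$\omega_i=-e_{2m+n+1-i,2m+n+i}-e_{2m+n+2-i,2m+n+1+i}\qquad(1\le i\le n),$$ and let $N^+$ be the group of matrices $\operatorname{diag}(I_{2m},D)$ with $D$ unipotent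 upper triangular. Let $u$ be the solution of the matrix constrained CKP hierarchy determined by $f$: define $q$ by $J+q=(MJM^{-1})_+$, and let $u$ be $V_{m,n}$-valued with $$\Delta\,(\partial_x+\operatorname{diag}(0_{2m},b)+q)\,\Delta^{-1}=\partial_x+\operatorname{diag}(0_{2m},b)+u$$ for some $N^+$-valued $\Delta$. Then $\tau_f(0)=1$; there is a unique $S=S(u,\lambda)$ that satisfies $[\partial_x+J+u,S]=0$ and is conjugate to $J$ by an element of $N^+G_-$; $u$ solves the matrix constrained CKP hierarchy, i.e. for $1\le j\le N+1$ there is $\eta$ with values in the Lie algebra of $N^+$ such that $$u_{t_{2j-1}}=\bigl[\partial_x+\operatorname{diag}(0_{2m},b)+u,\;S_{2j-1,0}(u)+\eta\bigr],$$ where $S_{2j-1,0}(u)$ is the coefficient of $\lambda^0$ in $S^{2j-1}(u,\lambda)$; and for all $1\le j,k\le N+1$ $$(\ln\tau_f)_{t_1t_{2j-1}}=\bigl\langle S^{2j-1}(u,\lambda),\,e_{2m+1,2m+2n+1}\bigr\rangle_{-1},$$ $$(\ln\tau_f)_{t_{2j-1}t_{2k-1}}=\bigl\langle S^{2j-1}(u,\lambda),\,\partial_\lambda\bigl(S^{2k-1}(u,\lambda)\bigr)_+\bigr\rangle_{-1}.$$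 -/

import Mathlib

open Matrix Filter

noncomputable section

namespace CKP

/-- Matrix indices `1, …, 2m+2n+1`, split into a block of size `2m` and a block of size `2n+1`. -/
abbrev Idx (m n : ℕ) := Fin (2 * m) ⊕ Fin (2 * n + 1)

/-- Formal power series in the times `t_1, t_3, …, t_{2N+1}`: the variable with index `i` is
`t_{2i+1}`. The variable with index `0` is `x = t_1`. -/
abbrev TSeries (N : ℕ) := MvPowerSeries (Fin (N + 1)) ℂ

/-- Formal power series in the times whose coefficients are formal Laurent series
`∑_{i ≤ i₀} ξ_i λ^i`, i.e. Laurent series in the variable `λ⁻¹`. -/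
abbrev Loop (N : ℕ) := MvPowerSeries (Fin (N + 1)) (LaurentSeries ℂ)

variable {m n N : ℕ}

/-! ### Operations on loops -/

/-- The coefficient of `λ^k`. (The Hahn series variable is `λ⁻¹`.) -/
def lamCoeff (k : ℤ) (a : Loop N) : TSeries N :=
  fun d => (MvPowerSeries.coeff d a).coeff (-k)

/-- The monomial `λ^k`. -/
def lamPow (k : ℤ) : Loop N := MvPowerSeries.C (HahnSeries.single (-k) 1)

/-- `a_+ = ∑_{i ≥ 0} a_i λ^i`. -/
def plusPart (a : Loop N) : Loop N :=
  fun d => HahnSeries.truncLT 1 (MvPowerSeries.coeff d a)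

/-- `a_- = ∑_{i < 0} a_i λ^i`. -/
def minusPart (a : Loop N) : Loop N := a - plusPart a

/-- The substitution `λ ↦ -λ`. -/
def lamNeg (a : Loop N) : Loop N := fun d =>
  { coeff := fun i => (-1 : ℂ) ^ i * (MvPowerSeries.coeff d a).coeff i
    isPWO_support' := (MvPowerSeries.coeff d a).isPWO_support.mono fun i hi => by
      simp only [Function.mem_support, HahnSeries.mem_support] at hi ⊢
      exact right_ne_zero_of_mul hi }

/-- `∂_λ`. With `z = λ⁻¹` this is `-z² ∂_z`. -/
def lamDeriv (a : Loop N) : Loop N := fun d =>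
  -(HahnSeries.single 2 1 * LaurentSeries.derivative ℂ (MvPowerSeries.coeff d a))

/-- Series in the times alone, regarded as loops that are constant in `λ`. -/
def constLoop : TSeries N →+* Loop N := MvPowerSeries.map HahnSeries.C

/-- The bilinear form `⟨ξ, η⟩_k = ∑_j tr(ξ_j η_{k-j})`, which is the coefficient of `λ^k`
in `tr(ξ η)`. -/
def pairing (k : ℤ) (ξ η : Matrix (Idx m n) (Idx m n) (Loop N)) : TSeries N :=
  lamCoeff k (ξ * η).trace

/-! ### The groups `G_±` -/

/-- `C_{m,n} = diag(α_m, β_n)`, where `α_m = ∑ e_{i,2m+1-i}` and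
`β_n = ∑ (-1)^{n+i-1} e_{i,2n+2-i}`. -/
def Cmat (m n N : ℕ) : Matrix (Idx m n) (Idx m n) (Loop N) :=
  fromBlocks (of fun i j => if j = i.rev then 1 else 0) 0 0
    (of fun i j => if j = i.rev then (-1) ^ (n + (i : ℕ)) else 0)

/-- The reality condition `σ(g(-λ)) = g(λ)` with `σ(Y) = (C Yᵗ C⁻¹)⁻¹`,
written as `g(λ) C g(-λ)ᵗ = C`. -/
def IsTwisted (g : Matrix (Idx m n) (Idx m n) (Loop N)) : Prop :=
  g * Cmat m n N * (g.map lamNeg)ᵀ = Cmat m n N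

/-- `g ∈ (G_{m,n})_-` (with parameters `t`): `g = I + ∑_{i<0} g_i λ^i`, `det g = 1`,
and `σ(g(-λ)) = g(λ)`. -/
def IsMinus (g : GL (Idx m n) (Loop N)) : Prop :=
  (∀ k : ℤ, 0 ≤ k → ∀ a b,
    lamCoeff k (g.val a b) = if k = 0 then (1 : Matrix (Idx m n) (Idx m n) (TSeries N)) a b else 0) ∧
  g.val.det = 1 ∧ IsTwisted g.val

/-- `g ∈ (G_{m,n})_+` (with parameters `t`): `g = ∑_{i≥0} g_i λ^i` and `σ(g(-λ)) = g(λ)`.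
No determinant condition is imposed: the vacuum sequence contains `J^{2n+1} = λ diag(0, I)`,
which is not traceless. -/
def IsPlus (g : GL (Idx m n) (Loop N)) : Prop :=
  (∀ k : ℤ, k < 0 → ∀ a b, lamCoeff k (g.val a b) = 0) ∧ IsTwisted g.val

/-- A loop that does not depend on the times. -/
def constTime : GL (Idx m n) (LaurentSeries ℂ) →* GL (Idx m n) (Loop N) :=
  Units.map (MvPowerSeries.C : LaurentSeries ℂ →+* Loop N).mapMatrix.toMonoidHom

/-! ### The vacuum sequence -/

/-- `diag(0_{2m}, b)` with `b = ∑ e_{i+1,i}`. -/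
def bMat (m n : ℕ) (A : Type*) [Zero A] [One A] : Matrix (Idx m n) (Idx m n) A :=
  fromBlocks 0 0 0 (of fun i j => if (i : ℕ) = (j : ℕ) + 1 then 1 else 0)

/-- `e_{2m+1,2m+2n+1}`. -/
def eMat (m n : ℕ) (A : Type*) [Zero A] [One A] : Matrix (Idx m n) (Idx m n) A :=
  Matrix.single (Sum.inr 0) (Sum.inr (Fin.last (2 * n))) 1

/-- `J = diag(0_{2m}, J_0)` with `J_0 = e_{1,2n+1} λ + b`. -/
def Jmat (m n N : ℕ) : Matrix (Idx m n) (Idx m n) (Loop N) :=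
  (lamPow 1 : Loop N) • eMat m n (Loop N) + bMat m n (Loop N)

/-- The exponential `∑_k X^k / k!` of a matrix all of whose entries have no constant term in `t`;
in each order in `t` only finitely many powers contribute. -/
def expT (X : Matrix (Idx m n) (Idx m n) (Loop N)) : Matrix (Idx m n) (Idx m n) (Loop N) :=
  of fun a b d => ∑ k ∈ Finset.range (d.degree + 1),
    ((k.factorial : ℂ)⁻¹) • MvPowerSeries.coeff d ((X ^ k) a b)

/-- The vacuum wave `W(t) = exp(-∑ t_{2i-1} J^{2i-1})`. -/
def vacuum (m n N : ℕ) : Matrix (Idx m n) (Idx m n) (Loop N) :=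
  expT (-∑ i : Fin (N + 1), (MvPowerSeries.X i : Loop N) • Jmat m n N ^ (2 * (i : ℕ) + 1))

/-- The factorization `W(t) f⁻¹ = M(t)⁻¹ E(t)` with `M ∈ (G_{m,n})_-`, `E ∈ (G_{m,n})_+`. -/
def IsFactorization (f : GL (Idx m n) (LaurentSeries ℂ)) (M E : GL (Idx m n) (Loop N)) : Prop :=
  IsMinus M ∧ IsPlus E ∧
    vacuum m n N * (constTime f⁻¹ : GL (Idx m n) (Loop N)).val = (M⁻¹).val * E.val

/-! ### The central extension

The central extension with Lie algebra cocycle `w(ξ, η) = ⟨ξ_λ, η⟩_{-1}` is realized in the usual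
way on the negative half `H_-` of the space of vector valued loops: an element over a loop `g` is
given by an operator `q` on `H_-` that differs from the compression `d(g) = P_- g P_-` by an operator
of finite rank (in each order in `t`), and `(g, q)`, `(g, r q)` differ by the central element
`det r`. For `X = ξ λ^k`, `Y = η λ^{-k}` one has
`tr([d(X), d(Y)] - d([X, Y])) = k tr(ξ η) = w(X, Y)`. -/

/-- A vector valued loop in `H_-`. -/
def IsNeg (v : Idx m n → Loop N) : Prop := ∀ a, plusPart (v a) = 0

/-- The compression `d(g) = P_- g P_-` of the multiplication operator `g`, as an operator
on `H_-`. -/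
def compress (g : Matrix (Idx m n) (Idx m n) (Loop N)) (v : Idx m n → Loop N) : Idx m n → Loop N :=
  fun a => minusPart ((g *ᵥ v) a)

/-- The basis vector `λ^{-(k+1)} e_b` of `H_-`. -/
def negBasis (p : ℕ × Idx m n) : Idx m n → Loop N := Pi.single p.2 (lamPow (-((p.1 : ℤ) + 1)))

/-- The matrix entries of an operator on `H_-` in the basis `negBasis`. -/
def opEntry (r : (Idx m n → Loop N) → (Idx m n → Loop N)) (p p' : ℕ × Idx m n) : TSeries N :=
  lamCoeff (-((p.1 : ℤ) + 1)) (r (negBasis p') p.2)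

/-- The operator `r` on `H_-` is, in each order in `t`, the identity plus an operator of finite
rank (only finitely many columns of `r - 1` are nonzero), and its determinant is `c`, the limit of
the determinants of the finite sections. -/
def HasDet (r : (Idx m n → Loop N) → (Idx m n → Loop N)) (c : TSeries N) : Prop :=
  (∀ d : Fin (N + 1) →₀ ℕ, ∃ K : ℕ, ∀ p : ℕ × Idx m n, K ≤ p.1 →
    ∀ a, MvPowerSeries.coeff d (r (negBasis p) a) = MvPowerSeries.coeff d (negBasis p a)) ∧
  ∀ d : Fin (N + 1) →₀ ℕ, ∀ᶠ K : ℕ in atTop,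
    MvPowerSeries.coeff d
      (Matrix.det (of fun p p' : Fin K × Idx m n =>
        opEntry r ((p.1 : ℕ), p.2) ((p'.1 : ℕ), p'.2))) = MvPowerSeries.coeff d c

/-- Representatives of elements of the centrally extended loop group: a loop together with an
operator on `H_-`. -/
@[ext] structure ExtLoop (m n N : ℕ) where
  loop : Matrix (Idx m n) (Idx m n) (Loop N)
  op : (Idx m n → Loop N) → (Idx m n → Loop N)

/-- The product in the central extension. -/
instance : Mul (ExtLoop m n N) := ⟨fun x y => ⟨x.loop * y.loop, x.op ∘ y.op⟩⟩

/-- The natural lift of elements of `G_+` and of `G_-`. On each of these two subgroups `d` is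
multiplicative. -/
def lift (g : Matrix (Idx m n) (Idx m n) (Loop N)) : ExtLoop m n N := ⟨g, compress g⟩

/-- `x = c · y` in the central extension, with `c` a central element: the two loops agree, and the
operators on `H_-` satisfy `x.op = r ∘ y.op` with `det r = c`. -/
def EqScalar (c : TSeries N) (x y : ExtLoop m n N) : Prop :=
  x.loop = y.loop ∧ ∃ r : (Idx m n → Loop N) → (Idx m n → Loop N),
    HasDet r c ∧ ∀ v, IsNeg v → x.op v = r (y.op v)

/-- `τ = τ_f` is the tau function of `f ∈ (G_{m,n})_-`: with `W(t) f⁻¹ = M(t)⁻¹ E(t)`,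
`S(W(t)) S(f⁻¹) = τ_f(t) S(M(t)⁻¹) S(E(t))`. -/
def IsTau (f : GL (Idx m n) (LaurentSeries ℂ)) (τ : TSeries N) : Prop :=
  ∃ M E : GL (Idx m n) (Loop N), IsFactorization f M E ∧
    EqScalar τ (lift (vacuum m n N) * lift (constTime f⁻¹ : GL (Idx m n) (Loop N)).val)
      (lift (M⁻¹).val * lift E.val)

/-- `(ln τ)_{t_{2i+1} t_{2j+1}}`, for a series `τ` with nonzero constant term. -/
def logDeriv₂ (i j : Fin (N + 1)) (τ : TSeries N) : TSeries N :=
  MvPowerSeries.pderiv ℂ i (τ⁻¹ * MvPowerSeries.pderiv ℂ j τ)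

/-! ### The phase space `V_{m,n}` and the hierarchy -/

/-- `μ_i = e_{i,2m+2n+1} + (-1)^{n+1} e_{2m+1,2m+1-i}`. -/
def muMat (m n N : ℕ) (i : Fin m) : Matrix (Idx m n) (Idx m n) (TSeries N) :=
  Matrix.single (Sum.inl ⟨i, by omega⟩) (Sum.inr (Fin.last (2 * n))) 1 +
    (-1) ^ (n + 1) • Matrix.single (Sum.inr 0) (Sum.inl ⟨2 * m - 1 - i, by omega⟩) 1

/-- `ν_i = (-1)^n e_{m+i,2m+2n+1} - e_{2m+1,m+1-i}`. -/
def nuMat (m n N : ℕ) (i : Fin m) : Matrix (Idx m n) (Idx m n) (TSeries N) :=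
  (-1) ^ n • Matrix.single (Sum.inl ⟨m + i, by omega⟩) (Sum.inr (Fin.last (2 * n))) 1 -
    Matrix.single (Sum.inr 0) (Sum.inl ⟨m - 1 - i, by omega⟩) 1

/-- `ω_i = -e_{2m+n+1-i,2m+n+i} - e_{2m+n+2-i,2m+n+1+i}`. -/
def omegaMat (m n N : ℕ) (i : Fin n) : Matrix (Idx m n) (Idx m n) (TSeries N) :=
  -Matrix.single (Sum.inr ⟨n - 1 - i, by omega⟩) (Sum.inr ⟨n + i, by omega⟩) 1 -
    Matrix.single (Sum.inr ⟨n - i, by omega⟩) (Sum.inr ⟨n + i + 1, by omega⟩) 1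

/-- `u` takes values in `V_{m,n}`: `u = ∑ q_i μ_i + ∑ r_{m+1-i} ν_i + ∑ u_i ω_i`. -/
def InV (u : Matrix (Idx m n) (Idx m n) (TSeries N)) : Prop :=
  ∃ (q r : Fin m → TSeries N) (v : Fin n → TSeries N),
    u = ∑ i, q i • muMat m n N i + ∑ i, r i.rev • nuMat m n N i + ∑ i, v i • omegaMat m n N i

/-- `Δ` takes values in `N^+`: `Δ = diag(I_{2m}, Δ_{22})` with `Δ_{22}` upper triangular with
`1` on the diagonal. -/
def InNplus (Δ : Matrix (Idx m n) (Idx m n) (TSeries N)) : Prop :=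
  ∃ D : Matrix (Fin (2 * n + 1)) (Fin (2 * n + 1)) (TSeries N),
    (∀ i, D i i = 1) ∧ (∀ i j, j < i → D i j = 0) ∧ Δ = fromBlocks 1 0 0 D

/-- `η` takes values in the Lie algebra of `N^+`: `η = diag(0_{2m}, η_{22})` with `η_{22}` strictly
upper triangular. -/
def InLieNplus (η : Matrix (Idx m n) (Idx m n) (TSeries N)) : Prop :=
  ∃ D : Matrix (Fin (2 * n + 1)) (Fin (2 * n + 1)) (TSeries N),
    (∀ i j, j ≤ i → D i j = 0) ∧ η = fromBlocks 0 0 0 D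

/-- `u = Δ ∗ q`: `Δ (∂_x + diag(0, b) + q) Δ⁻¹ = ∂_x + diag(0, b) + u`. -/
def IsGauge (Δ q u : Matrix (Idx m n) (Idx m n) (TSeries N)) : Prop :=
  Δ * (bMat m n _ + q) = Δ.map (MvPowerSeries.pderiv ℂ 0) + (bMat m n _ + u) * Δ

/-- `u` is the solution determined by `f ∈ (G_{m,n})_-`: with `W(t) f⁻¹ = M(t)⁻¹ E(t)` and
`J + q = (M J M⁻¹)_+`, it is the representative `u = Δ ∗ q` of `q` in `V_{m,n}`, `Δ ∈ N^+`. -/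
def IsSolutionOf (f : GL (Idx m n) (LaurentSeries ℂ))
    (u : Matrix (Idx m n) (Idx m n) (TSeries N)) : Prop :=
  ∃ (M E : GL (Idx m n) (Loop N)) (q Δ : Matrix (Idx m n) (Idx m n) (TSeries N)),
    IsFactorization f M E ∧
    Jmat m n N + q.map constLoop = (M.val * Jmat m n N * (M⁻¹).val).map plusPart ∧
    InNplus Δ ∧ InV u ∧ IsGauge Δ q u

/-- `S = S(u, λ)`: `[∂_x + J + u, S] = 0`, and `S` is conjugate to `J` by an element of
`N^+ (G_{m,n})_-`. -/
def IsS (u : Matrix (Idx m n) (Idx m n) (TSeries N))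
    (S : Matrix (Idx m n) (Idx m n) (Loop N)) : Prop :=
  S.map (MvPowerSeries.pderiv (LaurentSeries ℂ) 0) +
      ((Jmat m n N + u.map constLoop) * S - S * (Jmat m n N + u.map constLoop)) = 0 ∧
  ∃ (Δ : Matrix (Idx m n) (Idx m n) (TSeries N)) (M : GL (Idx m n) (Loop N)),
    InNplus Δ ∧ IsMinus M ∧
    S * (Δ.map constLoop * M.val) = Δ.map constLoop * M.val * Jmat m n N

/-- `u` solves the hierarchy, where `S = S(u, λ)`: for each time `t = t_{2j+1}` there is `η` with
values in the Lie algebra of `N^+` such that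
`u_t = [∂_x + diag(0, b) + u, S_{2j+1,0}(u) + η]`, with `S_{2j+1,0}(u)` the coefficient of `λ^0` in
`S^{2j+1}`. (As `u`, hence `u_t`, takes values in `V_{m,n}`, so does the commutator.) -/
def SolvesHierarchy (u : Matrix (Idx m n) (Idx m n) (TSeries N))
    (S : Matrix (Idx m n) (Idx m n) (Loop N)) : Prop :=
  InV u ∧ ∀ j : Fin (N + 1), ∃ η : Matrix (Idx m n) (Idx m n) (TSeries N), InLieNplus η ∧
    ∃ B : Matrix (Idx m n) (Idx m n) (TSeries N),
      B = (S ^ (2 * (j : ℕ) + 1)).map (lamCoeff 0) + η ∧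
      u.map (MvPowerSeries.pderiv ℂ j) =
        B.map (MvPowerSeries.pderiv ℂ 0) + ((bMat m n _ + u) * B - B * (bMat m n _ + u))

end CKP

end

noncomputable section

open Matrix Filter

namespace CKP

/-! ### Coefficient calculus for loops: powers of `λ`, supports, derivations. -/

section

variable {m n N : ℕ}

/-! Write `a = W f⁻¹ = M⁻¹ E`, `L = M J M⁻¹` and `d(g) = P₋ g P₋`. One has `d(g h) = d(g) d(h)` if
`g` has no negative powers of `λ` or `h` has no positive ones. Hence the operator `r` in the
definition of the tau function is forced on `H₋` to be `T = d(a) d(a⁻¹)`, and `τ = det T`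
(`exists_hasDet`).

For an odd exponent `k` the relation `a_{t_k} = -J^k a` gives `T_{t_k} = -d(J^k) T + T d(M⁻¹) d(M
J^k)` (`tDer_tauOp`). So `(ln τ)_{t_k}` is the trace of `d(M⁻¹) d(M J^k) - d(J^k)`, an operator of
finite rank, and this trace equals `-⟨M⁻¹, ∂_λ(M J^k)⟩_{-1}` (`sDer_tau`, `trace_sec_shifted`). The
determinant is only a limit of finite sections, order by order in `t`; the truncation error has zero
trace against the adjugate (`trace_adjugate_mul`, `sDer_det_sec`).

Differentiating once more with `M_{t_i} = (L^i)_- M` (`map_tDer_split`), and using `⟨∂_λ L^i,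
L^k⟩_{-1} = 0` (`pairing_lamDer_conj`), gives `⟨L^k, ∂_λ (L^i)_+⟩_{-1}`. The matrix `S = Δ L Δ⁻¹`
has the same pairings, because `Δ` does not depend on `λ`. Since `S_+` is `J` plus a matrix free of
`λ`, `∂_λ S_+ = e_{2m+1,2m+2n+1}`, which is the formula for `t_1`.

The wave `Ψ = Δ E` satisfies `Ψ_x = -(J + u) Ψ` and `Ψ_t = -B Ψ` with `B = (S^k)_+ - Δ_t Δ⁻¹`.
Equality of mixed derivatives is the zero curvature equation, and its `λ^0` coefficient is the
hierarchy, with `η = -Δ_t Δ⁻¹`.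

For the uniqueness of `S`, dress by `Q = Δ M`, for which `∂_x + J + u = Q (∂_x + J) Q⁻¹`. A second
solution becomes `T = K J K⁻¹` with `[∂_x + J, T] = 0` and `K` equal to `1` plus terms of negative
principal degree. A descent in the principal degree shows that `T` commutes with `J`
(`commute_of_lax`); another, based on `T^{2n+2} = λ T`, shows `T = J` (`eq_Jmat_of_commute`). -/

instance (priority := 2000) instCommRingLoop : CommRing (Loop N) := inferInstance

instance (priority := 2000) instCommRingTSeries : CommRing (TSeries N) := inferInstance

/-! ### Coefficients of powers of `λ` -/

theorem coeff_lamCoeff (k : ℤ) (a : Loop N) (d : Fin (N + 1) →₀ ℕ) :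
    MvPowerSeries.coeff d (lamCoeff k a) = (MvPowerSeries.coeff d a).coeff (-k) := rfl

theorem ext_lamCoeff {a b : Loop N} (h : ∀ k, lamCoeff k a = lamCoeff k b) : a = b := by
  ext d i
  have := congrArg (MvPowerSeries.coeff d) (h (-i))
  simpa [coeff_lamCoeff] using this

@[simp] theorem lamCoeff_add (k : ℤ) (a b : Loop N) :
    lamCoeff k (a + b) = lamCoeff k a + lamCoeff k b := by
  ext d; simp [coeff_lamCoeff]

@[simp] theorem lamCoeff_zero (k : ℤ) : lamCoeff k (0 : Loop N) = 0 := by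
  ext d; simp [coeff_lamCoeff]

/-- `lamCoeff` as an additive map. -/
def lamCoeffHom (k : ℤ) : Loop N →+ TSeries N where
  toFun := lamCoeff k
  map_zero' := lamCoeff_zero k
  map_add' := lamCoeff_add k

@[simp] theorem lamCoeff_neg (k : ℤ) (a : Loop N) : lamCoeff k (-a) = -lamCoeff k a :=
  map_neg (lamCoeffHom k) a

@[simp] theorem lamCoeff_sub (k : ℤ) (a b : Loop N) :
    lamCoeff k (a - b) = lamCoeff k a - lamCoeff k b :=
  map_sub (lamCoeffHom k) a b

theorem lamCoeff_sum {ι : Type*} (k : ℤ) (s : Finset ι) (f : ι → Loop N) :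
    lamCoeff k (∑ i ∈ s, f i) = ∑ i ∈ s, lamCoeff k (f i) :=
  map_sum (lamCoeffHom k) f s

theorem lamCoeff_plusPart (k : ℤ) (a : Loop N) :
    lamCoeff k (plusPart a) = if 0 ≤ k then lamCoeff k a else 0 := by
  ext d
  have : MvPowerSeries.coeff d (plusPart a) = HahnSeries.truncLT 1 (MvPowerSeries.coeff d a) := rfl
  rw [coeff_lamCoeff, this, HahnSeries.coeff_truncLT]
  by_cases h : 0 ≤ k
  · rw [if_pos h, if_pos (by omega), coeff_lamCoeff]
  · rw [if_neg h, if_neg (by omega), map_zero]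

theorem lamCoeff_minusPart (k : ℤ) (a : Loop N) :
    lamCoeff k (minusPart a) = if k < 0 then lamCoeff k a else 0 := by
  rw [minusPart, lamCoeff_sub, lamCoeff_plusPart]
  split_ifs <;> first | omega | simp

theorem lamCoeff_lamNeg (k : ℤ) (a : Loop N) :
    lamCoeff k (lamNeg a) = (-1 : ℂ) ^ k • lamCoeff k a := by
  ext d
  have : (MvPowerSeries.coeff d (lamNeg a)).coeff (-k) =
    (-1 : ℂ) ^ (-k) * (MvPowerSeries.coeff d a).coeff (-k) := rfl
  rw [coeff_lamCoeff, this, MvPowerSeries.coeff_smul, coeff_lamCoeff, _root_.zpow_neg,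
    ← _root_.inv_zpow, inv_neg, inv_one]

theorem lamCoeff_lamDeriv (k : ℤ) (a : Loop N) :
    lamCoeff k (lamDeriv a) = ((k + 1 : ℤ) : TSeries N) * lamCoeff (k + 1) a := by
  ext d
  have : MvPowerSeries.coeff d (lamDeriv a) =
    -(HahnSeries.single 2 1 * LaurentSeries.derivative ℂ (MvPowerSeries.coeff d a)) := rfl
  rw [coeff_lamCoeff, this, HahnSeries.coeff_neg, HahnSeries.coeff_single_mul,
    LaurentSeries.derivative_apply, LaurentSeries.hasseDeriv_coeff]
  rw [← zsmul_eq_mul, map_zsmul, coeff_lamCoeff]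
  simp only [Nat.cast_one, Ring.choose_one_right, one_mul]
  rw [show -k - 2 + 1 = -(k + 1) by ring, neg_zsmul, neg_neg]

theorem lamCoeff_pderiv (k : ℤ) (j : Fin (N + 1)) (a : Loop N) :
    lamCoeff k (MvPowerSeries.pderiv (LaurentSeries ℂ) j a) =
      MvPowerSeries.pderiv ℂ j (lamCoeff k a) := by
  ext d
  rw [coeff_lamCoeff, MvPowerSeries.coeff_pderiv, MvPowerSeries.coeff_pderiv, coeff_lamCoeff]
  have : ((d j : LaurentSeries ℂ) + 1) = HahnSeries.C ((d j : ℂ) + 1) := by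
    rw [map_add, map_one, map_natCast]
  rw [this, HahnSeries.C_apply, HahnSeries.coeff_mul_single_zero]

/-- Lower bounds on the supports turn the convolution into a sum over an explicit interval, which
can be reindexed; this is what the Leibniz rule for `∂_λ` needs. -/
theorem laurent_coeff_mul {x y : LaurentSeries ℂ} {a b : ℤ} (hx : ∀ i < a, x.coeff i = 0)
    (hy : ∀ i < b, y.coeff i = 0) (k : ℤ) :
    (x * y).coeff k = ∑ i ∈ Finset.Icc a (k - b), x.coeff i * y.coeff (k - i) := by
  rw [HahnSeries.coeff_mul]
  refine Finset.sum_bij_ne_zero (fun p _ _ => p.1) ?_ ?_ ?_ ?_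
  · rintro ⟨i, j⟩ hp h
    rw [Finset.mem_antidiagonal] at hp
    simp only [HahnSeries.mem_support] at hp
    rw [Finset.mem_Icc]
    have h1 : ¬ i < a := fun h => hp.1 (hx i h)
    have h2 : ¬ j < b := fun h => hp.2.1 (hy j h)
    have := hp.2.2
    simp only at this ⊢
    omega
  · rintro ⟨i, j⟩ hp h ⟨i', j'⟩ hp' h' he
    rw [Finset.mem_antidiagonal] at hp hp'
    have := hp.2.2
    have := hp'.2.2
    simp only at *
    ext <;> simp <;> omega
  · intro i hi h
    refine ⟨(i, k - i), ?_, h, rfl⟩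
    rw [Finset.mem_antidiagonal]
    exact ⟨left_ne_zero_of_mul h, right_ne_zero_of_mul h, by simp⟩
  · rintro ⟨i, j⟩ hp h
    rw [Finset.mem_antidiagonal] at hp
    have := hp.2.2
    simp only at *
    rw [← this, add_sub_cancel_left]

theorem exists_coeff_eq_zero (x : LaurentSeries ℂ) : ∃ a, ∀ i < a, x.coeff i = 0 :=
  ⟨x.order, fun _ hi => HahnSeries.coeff_eq_zero_of_lt_order hi⟩

theorem coeff_lamCoeff_mul (k : ℤ) (a b : Loop N) (d : Fin (N + 1) →₀ ℕ) :
    MvPowerSeries.coeff d (lamCoeff k (a * b)) = ∑ p ∈ Finset.HasAntidiagonal.antidiagonal d,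
      (MvPowerSeries.coeff p.1 a * MvPowerSeries.coeff p.2 b).coeff (-k) := by
  classical
  rw [coeff_lamCoeff, MvPowerSeries.coeff_mul]
  exact map_sum (HahnSeries.coeff.addMonoidHom (-k)) _ _

/-- The source of all support estimates for products: it is applied without any bound on the powers
of `λ` that is uniform in `t`. -/
theorem lamCoeff_mul_eq_zero {k : ℤ} {a b : Loop N}
    (h : ∀ i j, i + j = k → lamCoeff i a = 0 ∨ lamCoeff j b = 0) : lamCoeff k (a * b) = 0 := by
  ext d
  rw [coeff_lamCoeff_mul, map_zero]
  refine Finset.sum_eq_zero fun p _ => ?_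
  rw [HahnSeries.coeff_mul]
  refine Finset.sum_eq_zero fun q hq => ?_
  rw [Finset.mem_antidiagonal] at hq
  have h3 := hq.2.2
  rcases h (-q.1) (-q.2) (by omega) with h | h
  · have := congrArg (MvPowerSeries.coeff p.1) h
    rw [coeff_lamCoeff, neg_neg] at this
    rw [this, map_zero, zero_mul]
  · have := congrArg (MvPowerSeries.coeff p.2) h
    rw [coeff_lamCoeff, neg_neg] at this
    rw [this, map_zero, mul_zero]

theorem lamCoeff_constLoop_mul (k : ℤ) (c : TSeries N) (a : Loop N) :
    lamCoeff k (constLoop c * a) = c * lamCoeff k a := by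
  classical
  ext d
  rw [coeff_lamCoeff_mul, MvPowerSeries.coeff_mul]
  refine Finset.sum_congr rfl fun p _ => ?_
  rw [constLoop, MvPowerSeries.coeff_map, HahnSeries.C_apply, HahnSeries.coeff_single_zero_mul,
    coeff_lamCoeff]

theorem lamCoeff_lamPow_mul (k i : ℤ) (a : Loop N) :
    lamCoeff k (lamPow i * a) = lamCoeff (k - i) a := by
  ext d
  rw [lamPow, coeff_lamCoeff, MvPowerSeries.coeff_C_mul, HahnSeries.coeff_single_mul, one_mul,
    coeff_lamCoeff]
  congr 1; ring

theorem lamPow_add (i j : ℤ) : (lamPow (i + j) : Loop N) = lamPow i * lamPow j := by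
  rw [lamPow, lamPow, lamPow, ← map_mul, HahnSeries.single_mul_single, mul_one, neg_add]

@[simp] theorem lamPow_zero : (lamPow 0 : Loop N) = 1 := by
  rw [lamPow, neg_zero, HahnSeries.single_zero_one, map_one]

theorem lamCoeff_one (k : ℤ) : lamCoeff k (1 : Loop N) = if k = 0 then 1 else 0 := by
  classical
  ext d
  rw [coeff_lamCoeff, MvPowerSeries.coeff_one]
  split_ifs <;> simp_all [MvPowerSeries.coeff_one, HahnSeries.coeff_one]

theorem lamCoeff_constLoop (k : ℤ) (c : TSeries N) :
    lamCoeff k (constLoop c) = if k = 0 then c else 0 := by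
  rw [← mul_one (constLoop c), lamCoeff_constLoop_mul, lamCoeff_one]
  split_ifs <;> simp

theorem lamCoeff_lamPow (k i : ℤ) :
    lamCoeff k (lamPow i : Loop N) = if k = i then 1 else 0 := by
  rw [← mul_one (lamPow i), lamCoeff_lamPow_mul, lamCoeff_one]
  simp [sub_eq_zero]

theorem lamDeriv_mul (a b : Loop N) :
    lamDeriv (a * b) = lamDeriv a * b + a * lamDeriv b := by
  apply ext_lamCoeff
  intro k
  ext d
  rw [lamCoeff_lamDeriv, ← zsmul_eq_mul, map_zsmul, coeff_lamCoeff_mul, lamCoeff_add, map_add,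
    coeff_lamCoeff_mul, coeff_lamCoeff_mul, ← Finset.sum_add_distrib, Finset.smul_sum]
  refine Finset.sum_congr rfl fun p _ => ?_
  generalize hx : MvPowerSeries.coeff p.1 a = x
  generalize hy : MvPowerSeries.coeff p.2 b = y
  have ha : ∀ i, (MvPowerSeries.coeff p.1 (lamDeriv a)).coeff i =
      ((1 - i : ℤ) : ℂ) * x.coeff (i - 1) := by
    intro i
    have := congrArg (MvPowerSeries.coeff p.1) (lamCoeff_lamDeriv (-i) a)
    rw [← zsmul_eq_mul, map_zsmul, coeff_lamCoeff, coeff_lamCoeff, neg_neg, hx, zsmul_eq_mul] at this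
    rw [this]; congr 2 <;> ring
  have hb : ∀ i, (MvPowerSeries.coeff p.2 (lamDeriv b)).coeff i =
      ((1 - i : ℤ) : ℂ) * y.coeff (i - 1) := by
    intro i
    have := congrArg (MvPowerSeries.coeff p.2) (lamCoeff_lamDeriv (-i) b)
    rw [← zsmul_eq_mul, map_zsmul, coeff_lamCoeff, coeff_lamCoeff, neg_neg, hy, zsmul_eq_mul] at this
    rw [this]; congr 2 <;> ring
  obtain ⟨u, hu⟩ := exists_coeff_eq_zero x
  obtain ⟨v, hv⟩ := exists_coeff_eq_zero y
  rw [laurent_coeff_mul hu hv,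
    laurent_coeff_mul (a := u + 1) (b := v) (fun i hi => by rw [ha, hu _ (by omega), mul_zero]) hv,
    laurent_coeff_mul (a := u) (b := v + 1) hu (fun i hi => by rw [hb, hv _ (by omega), mul_zero])]
  -- Differentiating the first factor shifts its index by one; after undoing the shift both sums run
  -- over the same interval and the factors `-i` and `i + k + 1` add up to `k + 1`.
  have e1 : Finset.Icc (u + 1) (-k - v) =
      (Finset.Icc u (-k - (v + 1))).map (addRightEmbedding 1) := by
    rw [Finset.map_add_right_Icc]; congr 1; ring
  rw [e1, Finset.sum_map, ← Finset.sum_add_distrib, show -(k + 1) - v = -k - (v + 1) by ring,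
    Finset.smul_sum]
  refine Finset.sum_congr rfl fun i _ => ?_
  rw [addRightEmbedding_apply, ha, hb, add_sub_cancel_right, zsmul_eq_mul,
    show -k - (i + 1) = -(k + 1) - i by ring, show -k - i - 1 = -(k + 1) - i by ring]
  push_cast; ring

/-- The Leibniz rule for an additive map. -/
def IsLeibniz {R : Type*} [CommRing R] (D : R →+ R) : Prop :=
  ∀ a b, D (a * b) = D a * b + a * D b

theorem IsLeibniz.map_one {R : Type*} [CommRing R] {D : R →+ R} (hD : IsLeibniz D) : D 1 = 0 := by
  have := hD 1 1
  rw [mul_one, mul_one, one_mul] at this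
  exact left_eq_add.mp this

/-- `∂_λ` as an additive map. -/
def lamDer : Loop N →+ Loop N where
  toFun := lamDeriv
  map_zero' := ext_lamCoeff fun k => by simp [lamCoeff_lamDeriv]
  map_add' := fun a b => ext_lamCoeff fun k => by simp [lamCoeff_lamDeriv, mul_add]

theorem isLeibniz_lamDer : IsLeibniz (lamDer (N := N)) := lamDeriv_mul

/-- `∂_{t_{2j+1}}` on loops, as an additive map. -/
def tDer (j : Fin (N + 1)) : Loop N →+ Loop N where
  toFun := MvPowerSeries.pderiv (LaurentSeries ℂ) j
  map_zero' := map_zero _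
  map_add' := map_add _

theorem isLeibniz_tDer (j : Fin (N + 1)) : IsLeibniz (tDer j) := fun a b =>
  ((MvPowerSeries.pderiv (LaurentSeries ℂ) j).leibniz a b).trans
    ((add_comm _ _).trans (congrArg₂ _ (mul_comm _ _) rfl))

/-- `∂_{t_{2j+1}}` on series in the times, as an additive map. -/
def sDer (j : Fin (N + 1)) : TSeries N →+ TSeries N where
  toFun := MvPowerSeries.pderiv ℂ j
  map_zero' := map_zero _
  map_add' := map_add _

theorem isLeibniz_sDer (j : Fin (N + 1)) : IsLeibniz (sDer j) := fun a b =>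
  ((MvPowerSeries.pderiv ℂ j).leibniz a b).trans
    ((add_comm _ _).trans (congrArg₂ _ (mul_comm _ _) rfl))

theorem lamCoeff_tDer (k : ℤ) (j : Fin (N + 1)) (a : Loop N) :
    lamCoeff k (tDer j a) = sDer j (lamCoeff k a) := lamCoeff_pderiv k j a

theorem lamCoeff_lamDer (k : ℤ) (a : Loop N) :
    lamCoeff k (lamDer a) = ((k + 1 : ℤ) : TSeries N) * lamCoeff (k + 1) a := lamCoeff_lamDeriv k a

theorem tDer_lamDer (j : Fin (N + 1)) (a : Loop N) : tDer j (lamDer a) = lamDer (tDer j a) := by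
  apply ext_lamCoeff; intro k
  rw [lamCoeff_tDer, lamCoeff_lamDer, lamCoeff_lamDer, lamCoeff_tDer, ← zsmul_eq_mul,
    ← zsmul_eq_mul, map_zsmul]

theorem tDer_constLoop (j : Fin (N + 1)) (c : TSeries N) :
    tDer j (constLoop c) = constLoop (sDer j c) := by
  apply ext_lamCoeff; intro k
  rw [lamCoeff_tDer, lamCoeff_constLoop, lamCoeff_constLoop]
  split_ifs <;> simp

theorem lamDer_constLoop (c : TSeries N) : lamDer (constLoop c) = 0 := by
  apply ext_lamCoeff; intro k
  rw [lamCoeff_lamDer, lamCoeff_constLoop]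
  split_ifs with h <;> simp [h]

theorem tDer_C (j : Fin (N + 1)) (c : LaurentSeries ℂ) :
    tDer j (MvPowerSeries.C c : Loop N) = 0 := MvPowerSeries.pderiv_C

theorem tDer_lamPow (j : Fin (N + 1)) (k : ℤ) : tDer j (lamPow k : Loop N) = 0 := tDer_C j _

/-- `minusPart` as an additive map. -/
def minusHom : Loop N →+ Loop N where
  toFun := minusPart
  map_zero' := ext_lamCoeff fun k => by simp [lamCoeff_minusPart]
  map_add' := fun a b => ext_lamCoeff fun k => by
    simp only [lamCoeff_minusPart, lamCoeff_add]; split_ifs <;> simp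

theorem plusPart_add_minusPart (a : Loop N) : plusPart a + minusPart a = a := by
  rw [minusPart]; ring

/-! ### Loops with prescribed powers of `λ` -/

/-- The loops in which only powers `λ^k` with `k ∈ s` occur. -/
def lamSupp (s : Set ℤ) : AddSubgroup (Loop N) where
  carrier := {a | ∀ k ∉ s, lamCoeff k a = 0}
  add_mem' ha hb k hk := by rw [lamCoeff_add, ha k hk, hb k hk, add_zero]
  zero_mem' k _ := lamCoeff_zero k
  neg_mem' ha k hk := by rw [lamCoeff_neg, ha k hk, neg_zero]

theorem lamSupp_mono {s t : Set ℤ} (h : s ⊆ t) {a : Loop N} (ha : a ∈ lamSupp s) :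
    a ∈ lamSupp t := fun k hk => ha k fun hs => hk (h hs)

theorem mul_mem_lamSupp {s t u : Set ℤ} (h : ∀ i ∈ s, ∀ j ∈ t, i + j ∈ u) {a b : Loop N}
    (ha : a ∈ lamSupp s) (hb : b ∈ lamSupp t) : a * b ∈ lamSupp u := by
  intro k hk
  refine lamCoeff_mul_eq_zero fun i j hij => ?_
  by_cases hi : i ∈ s
  · exact Or.inr (hb j fun hj => hk (hij ▸ h i hi j hj))
  · exact Or.inl (ha i hi)

theorem eq_zero_of_mem_lamSupp {s t : Set ℤ} (h : Disjoint s t) {a : Loop N}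
    (ha : a ∈ lamSupp s) (hb : a ∈ lamSupp t) : a = 0 := by
  apply ext_lamCoeff; intro k
  rw [lamCoeff_zero]
  by_cases hk : k ∈ s
  · exact hb k (Set.disjoint_left.mp h hk)
  · exact ha k hk

theorem plusPart_mem (a : Loop N) : plusPart a ∈ lamSupp (N := N) (Set.Ici 0) := by
  intro k hk
  exact (lamCoeff_plusPart k a).trans (if_neg hk)

theorem minusPart_mem (a : Loop N) : minusPart a ∈ lamSupp (N := N) (Set.Iio 0) := by
  intro k hk
  exact (lamCoeff_minusPart k a).trans (if_neg hk)

theorem plusPart_eq_self {a : Loop N} (h : a ∈ lamSupp (Set.Ici 0)) : plusPart a = a := by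
  apply ext_lamCoeff; intro k
  rw [lamCoeff_plusPart]
  split_ifs with hk
  · rfl
  · exact (h k hk).symm

theorem plusPart_eq_zero {a : Loop N} (h : a ∈ lamSupp (Set.Iio 0)) : plusPart a = 0 := by
  apply ext_lamCoeff; intro k
  rw [lamCoeff_plusPart]
  split_ifs with hk
  · rw [h k (by simpa using hk), lamCoeff_zero]
  · rw [lamCoeff_zero]

theorem minusPart_eq_self {a : Loop N} (h : a ∈ lamSupp (Set.Iio 0)) : minusPart a = a := by
  rw [minusPart, plusPart_eq_zero h, sub_zero]

theorem minusPart_eq_zero {a : Loop N} (h : a ∈ lamSupp (Set.Ici 0)) : minusPart a = 0 := by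
  rw [minusPart, plusPart_eq_self h, sub_self]

theorem tDer_mem {s : Set ℤ} (j : Fin (N + 1)) {a : Loop N} (h : a ∈ lamSupp s) :
    tDer j a ∈ lamSupp s := by
  intro k hk
  rw [lamCoeff_tDer, h k hk, map_zero]

theorem lamNeg_mem {s : Set ℤ} {a : Loop N} (h : a ∈ lamSupp s) : lamNeg a ∈ lamSupp s := by
  intro k hk
  rw [lamCoeff_lamNeg, h k hk, smul_zero]

theorem constLoop_mem (c : TSeries N) : constLoop c ∈ lamSupp (N := N) {0} := by
  intro k hk
  exact (lamCoeff_constLoop k c).trans (if_neg hk)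

theorem lamPow_mem (i : ℤ) : lamPow i ∈ lamSupp (N := N) {i} := by
  intro k hk
  exact (lamCoeff_lamPow k i).trans (if_neg hk)

theorem one_mem_lamSupp : (1 : Loop N) ∈ lamSupp (N := N) {0} := by
  rw [← lamPow_zero]; exact lamPow_mem 0

/-! ### Matrices with prescribed powers of `λ` in each entry -/

variable {ι κ : Type*} 

/-- Matrices whose `(a, b)` entry contains only powers `λ^k` with `k ∈ s a b`. -/
def matSupp (s : ι → κ → Set ℤ) : AddSubgroup (Matrix ι κ (Loop N)) where
  carrier := {X | ∀ a b, X a b ∈ lamSupp (s a b)}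
  add_mem' hX hY a b := add_mem (hX a b) (hY a b)
  zero_mem' _ _ := zero_mem _
  neg_mem' hX a b := neg_mem (hX a b)

theorem matSupp_mono {s t : ι → κ → Set ℤ} (h : ∀ a b, s a b ⊆ t a b)
    {X : Matrix ι κ (Loop N)} (hX : X ∈ matSupp s) : X ∈ matSupp t :=
  fun a b => lamSupp_mono (h a b) (hX a b)

theorem mul_mem_matSupp {ρ : Type*} [Fintype κ] {s : ι → κ → Set ℤ} {t : κ → ρ → Set ℤ}
    {u : ι → ρ → Set ℤ}
    (h : ∀ a b c, ∀ i ∈ s a b, ∀ j ∈ t b c, i + j ∈ u a c)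
    {X : Matrix ι κ (Loop N)} {Y : Matrix κ ρ (Loop N)} (hX : X ∈ matSupp s)
    (hY : Y ∈ matSupp t) : X * Y ∈ matSupp u := by
  intro a c
  rw [Matrix.mul_apply]
  exact sum_mem fun b _ => mul_mem_lamSupp (h a b c) (hX a b) (hY b c)

theorem smul_mem_matSupp {s : Set ℤ} {t u : ι → κ → Set ℤ}
    (h : ∀ a b, ∀ i ∈ s, ∀ j ∈ t a b, i + j ∈ u a b)
    {c : Loop N} {X : Matrix ι κ (Loop N)} (hc : c ∈ lamSupp s)
    (hX : X ∈ matSupp t) : c • X ∈ matSupp u :=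
  fun a b => mul_mem_lamSupp (h a b) hc (hX a b)

theorem map_tDer_mem {s : ι → κ → Set ℤ} (j : Fin (N + 1)) {X : Matrix ι κ (Loop N)}
    (h : X ∈ matSupp s) : X.map (tDer j) ∈ matSupp s :=
  fun a b => tDer_mem j (h a b)

theorem map_constLoop_mem (X : Matrix ι κ (TSeries N)) :
    X.map constLoop ∈ matSupp (N := N) (fun (_ : ι) (_ : κ) => {0}) :=
  fun _ _ => constLoop_mem _

theorem eq_zero_of_mem_matSupp {s t : ι → κ → Set ℤ} (h : ∀ a b, Disjoint (s a b) (t a b))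
    {X : Matrix ι κ (Loop N)} (hX : X ∈ matSupp s) (hY : X ∈ matSupp t) : X = 0 := by
  ext1 a b
  exact eq_zero_of_mem_lamSupp (h a b) (hX a b) (hY a b)

/-- Matrix loops with only powers `λ^k`, `k ∈ s`. -/
abbrev unifSupp (s : Set ℤ) : AddSubgroup (Matrix ι κ (Loop N)) := matSupp fun _ _ => s

theorem disjoint_Ici_Iio : Disjoint (Set.Ici (0 : ℤ)) (Set.Iio 0) := by
  rw [Set.disjoint_left]
  intro k h1 h2
  simp only [Set.mem_Ici, Set.mem_Iio] at *
  omega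

/-- The loops are the direct sum of their parts with nonnegative and with negative powers. Every
identity between `±`-parts below is proved by exhibiting a splitting. -/
theorem splitting_unique {X Y X' Y' : Matrix ι κ (Loop N)} (hX : X ∈ unifSupp (N := N) (Set.Ici 0))
    (hX' : X' ∈ unifSupp (N := N) (Set.Ici 0)) (hY : Y ∈ unifSupp (N := N) (Set.Iio 0))
    (hY' : Y' ∈ unifSupp (N := N) (Set.Iio 0)) (h : X + Y = X' + Y') : X = X' ∧ Y = Y' := by
  have h1 : X - X' = Y' - Y := by
    rw [sub_eq_sub_iff_add_eq_add, h, add_comm]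
  have h2 : X - X' = 0 := eq_zero_of_mem_matSupp (fun _ _ => disjoint_Ici_Iio)
    (sub_mem hX hX') (h1 ▸ sub_mem hY' hY)
  rw [h2] at h1
  exact ⟨sub_eq_zero.mp h2, (sub_eq_zero.mp h1.symm).symm⟩

theorem map_plusPart_mem (X : Matrix ι κ (Loop N)) :
    X.map plusPart ∈ unifSupp (N := N) (Set.Ici 0) := fun _ _ => plusPart_mem _

theorem map_minusPart_mem (X : Matrix ι κ (Loop N)) :
    X.map minusPart ∈ unifSupp (N := N) (Set.Iio 0) := fun _ _ => minusPart_mem _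

theorem map_plus_add_map_minus (X : Matrix ι κ (Loop N)) :
    X.map plusPart + X.map minusPart = X := by
  ext1 a b; exact plusPart_add_minusPart _

/-! ### Derivations on matrices -/

/-- Formulated for any additive map with the Leibniz rule, so that `∂_λ`, the time derivatives of
loops and those of series in the times are covered at once. -/
theorem map_der_mul {R ι κ ρ : Type*} [CommRing R] [Fintype κ] {D : R →+ R} (hD : IsLeibniz D)
    (X : Matrix ι κ R) (Y : Matrix κ ρ R) :
    (X * Y).map D = X.map D * Y + X * Y.map D := by
  ext1 a c
  simp only [Matrix.map_apply, Matrix.mul_apply, Matrix.add_apply, map_sum, hD _ _,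
    ← Finset.sum_add_distrib]

theorem map_der_add {R ι κ : Type*} [CommRing R] (D : R →+ R) (X Y : Matrix ι κ R) :
    (X + Y).map D = X.map D + Y.map D := by
  ext1 a b; exact map_add D _ _

theorem map_der_sub {R ι κ : Type*} [CommRing R] (D : R →+ R) (X Y : Matrix ι κ R) :
    (X - Y).map D = X.map D - Y.map D := by
  ext1 a b; exact map_sub D _ _

theorem map_der_one {R ι : Type*} [CommRing R] [DecidableEq ι] {D : R →+ R} (hD : IsLeibniz D) :
    (1 : Matrix ι ι R).map D = 0 := by
  ext1 a b
  rw [Matrix.map_apply, Matrix.one_apply]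
  split_ifs <;> simp [hD.map_one]

theorem map_der_pow {R ι : Type*} [CommRing R] [Fintype ι] [DecidableEq ι] {D : R →+ R} (hD : IsLeibniz D)
    {X : Matrix ι ι R} (hX : X.map D = 0) (k : ℕ) : (X ^ k).map D = 0 := by
  induction k with
  | zero => rw [pow_zero, map_der_one hD]
  | succ k ih => rw [pow_succ, map_der_mul hD, ih, hX, zero_mul, mul_zero, add_zero]

/-- Jacobi's formula: differentiate the Leibniz expansion factor by factor, collect the terms in
which column `i` is differentiated, and recognize Cramer's rule. -/
theorem der_det {R ι : Type*} [CommRing R] [Fintype ι] [DecidableEq ι] {D : R →+ R} (hD : IsLeibniz D)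
    (X : Matrix ι ι R) : D X.det = (X.adjugate * X.map D).trace := by
  have h1 : (X.adjugate * X.map D).trace = ∑ i, (X.updateCol i fun j => D (X j i)).det := by
    rw [Matrix.trace]
    refine Finset.sum_congr rfl fun i _ => ?_
    rw [← Matrix.cramer_apply, Matrix.cramer_eq_adjugate_mulVec]
    rfl
  have h2 : ∀ (s : Finset ι) (f : ι → R),
      D (∏ i ∈ s, f i) = ∑ i ∈ s, (∏ j ∈ s.erase i, f j) * D (f i) := by
    intro s f
    induction s using Finset.induction_on with
    | empty => simp [hD.map_one]
    | insert a s ha ih =>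
      rw [Finset.prod_insert ha, hD, ih, Finset.sum_insert ha,
        Finset.erase_insert ha, Finset.mul_sum, mul_comm (D _)]
      congr 1
      refine Finset.sum_congr rfl fun i hi => ?_
      have : a ≠ i := fun h => ha (h ▸ hi)
      rw [Finset.erase_insert_of_ne this, Finset.prod_insert (by simp [ha]), mul_assoc]
  rw [h1, Matrix.det_apply, map_sum]
  simp_rw [Matrix.det_apply]
  rw [Finset.sum_comm]
  refine Finset.sum_congr rfl fun σ _ => ?_
  rw [← Finset.smul_sum, Units.smul_def, map_zsmul, Units.smul_def, h2]
  congr 1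
  refine Finset.sum_congr rfl fun i _ => ?_
  rw [← Finset.prod_erase_mul _ _ (Finset.mem_univ i)]
  congr 1
  · refine Finset.prod_congr rfl fun j hj => ?_
    rw [Matrix.updateCol_ne (Finset.ne_of_mem_erase hj)]
  · rw [Matrix.updateCol_self]

end

/-! ### The groups `G_±`, the vacuum wave and the evolution of the factors `M` and `E`. -/

section

variable {m n N : ℕ}

/-! ### Inverses in `G_±` and uniqueness of the factorization -/

theorem Cmat_mul_self : Cmat m n N * Cmat m n N = 1 := by
  have h1 : (of fun i j : Fin (2 * m) => if j = i.rev then (1 : Loop N) else 0) *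
      (of fun i j : Fin (2 * m) => if j = i.rev then (1 : Loop N) else 0) = 1 := by
    ext1 i j
    rw [Matrix.mul_apply, Finset.sum_eq_single i.rev]
    · simp [Matrix.one_apply, eq_comm]
    · intro b _ hb; simp [hb]
    · simp
  have h2 : (of fun i j : Fin (2 * n + 1) =>
        if j = i.rev then (-1 : Loop N) ^ (n + (i : ℕ)) else 0) *
      (of fun i j : Fin (2 * n + 1) =>
        if j = i.rev then (-1 : Loop N) ^ (n + (i : ℕ)) else 0) = 1 := by
    ext1 i j
    rw [Matrix.mul_apply, Finset.sum_eq_single i.rev]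
    · simp only [of_apply, if_true, Fin.rev_rev, Matrix.one_apply, eq_comm (a := j)]
      split_ifs
      · rw [← pow_add, Fin.val_rev]
        exact Even.neg_one_pow ⟨2 * n, by have := i.2; simp only [Nat.reduceSubDiff]; omega⟩
      · rw [mul_zero]
    · intro b _ hb; simp [hb]
    · simp
  rw [Cmat, fromBlocks_multiply, h1, h2]
  simp

theorem Cmat_mem : Cmat m n N ∈ unifSupp (N := N) ({0} : Set ℤ) := by
  have h : ∀ k : ℕ, (-1 : Loop N) ^ k ∈ lamSupp (N := N) ({0} : Set ℤ) := by
    intro k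
    rcases neg_one_pow_eq_or (Loop N) k with h | h <;> rw [h]
    · exact one_mem_lamSupp
    · exact neg_mem one_mem_lamSupp
  rintro (a | a) (b | b)
  · simp only [Cmat, fromBlocks_apply₁₁, of_apply]
    split_ifs
    · exact one_mem_lamSupp
    · exact zero_mem _
  · exact zero_mem _
  · exact zero_mem _
  · simp only [Cmat, fromBlocks_apply₂₂, of_apply]
    split_ifs
    · exact h _
    · exact zero_mem _

/-- The twist condition expresses the inverse through a transpose and `λ ↦ -λ`, so `g⁻¹` has its
powers of `λ` in the same set as `g`. No geometric series is needed to invert in `G_±`. -/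
theorem inv_eq_of_isTwisted {g : GL (Idx m n) (Loop N)} (h : IsTwisted g.val) :
    (g⁻¹).val = Cmat m n N * (g.val.map lamNeg)ᵀ * Cmat m n N := by
  have h1 : g.val * (Cmat m n N * (g.val.map lamNeg)ᵀ * Cmat m n N) = 1 := by
    rw [← mul_assoc, ← mul_assoc, show g.val * Cmat m n N * _ = _ from h, Cmat_mul_self]
  calc (g⁻¹).val = (g⁻¹).val * (g.val * (Cmat m n N * (g.val.map lamNeg)ᵀ * Cmat m n N)) := by
        rw [h1, mul_one]
    _ = _ := by rw [← mul_assoc, Units.inv_mul, one_mul]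

theorem inv_mem_of_isTwisted {g : GL (Idx m n) (Loop N)} (h : IsTwisted g.val) {s : Set ℤ}
    (hg : g.val ∈ unifSupp (N := N) s) : (g⁻¹).val ∈ unifSupp (N := N) s := by
  rw [inv_eq_of_isTwisted h]
  refine mul_mem_matSupp (s := fun _ _ => s) ?_ (mul_mem_matSupp (t := fun _ _ => s) ?_ Cmat_mem
    fun a b => lamNeg_mem (hg b a)) Cmat_mem
  · rintro _ _ _ i hi j rfl; simpa using hi
  · rintro _ _ _ i rfl j hj; simpa using hj

theorem IsPlus.mem {g : GL (Idx m n) (Loop N)} (h : IsPlus g) :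
    g.val ∈ unifSupp (N := N) (Set.Ici 0) :=
  fun a b k hk => h.1 k (by simpa using hk) a b

theorem IsPlus.inv_mem {g : GL (Idx m n) (Loop N)} (h : IsPlus g) :
    (g⁻¹).val ∈ unifSupp (N := N) (Set.Ici 0) :=
  inv_mem_of_isTwisted h.2 h.mem

theorem add_le_mul {s t u : Set ℤ} (h : ∀ i ∈ s, ∀ j ∈ t, i + j ∈ u)
    {X Y : Matrix (Idx m n) (Idx m n) (Loop N)} (hX : X ∈ unifSupp (N := N) s)
    (hY : Y ∈ unifSupp (N := N) t) : X * Y ∈ unifSupp (N := N) u :=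
  mul_mem_matSupp (fun _ _ _ => h) hX hY

theorem unifSupp_mono {s t : Set ℤ} (h : s ⊆ t)
    {X : Matrix (Idx m n) (Idx m n) (Loop N)} (hX : X ∈ unifSupp (N := N) s) :
    X ∈ unifSupp (N := N) t := matSupp_mono (fun _ _ => h) hX

theorem one_mem_unifSupp : (1 : Matrix (Idx m n) (Idx m n) (Loop N)) ∈ 
    unifSupp (N := N) ({0} : Set ℤ) := by
  intro a b
  rw [Matrix.one_apply]
  split_ifs
  · exact one_mem_lamSupp
  · exact zero_mem _

theorem IsMinus.sub_one_mem {g : GL (Idx m n) (Loop N)} (h : IsMinus g) :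
    g.val - 1 ∈ unifSupp (N := N) (Set.Iio 0) := by
  intro a b k hk
  have hk : 0 ≤ k := by simpa using hk
  rw [Matrix.sub_apply, lamCoeff_sub, h.1 k hk, Matrix.one_apply, Matrix.one_apply]
  split_ifs <;> simp_all [lamCoeff_one]

theorem Iio_subset_Iic : Set.Iio (0 : ℤ) ⊆ Set.Iic 0 := Set.Iio_subset_Iic_self

theorem zero_subset_Iic : ({0} : Set ℤ) ⊆ Set.Iic 0 := by simp

theorem zero_subset_Ici : ({0} : Set ℤ) ⊆ Set.Ici 0 := by simp

theorem mem_of_sub_one_mem {X : Matrix (Idx m n) (Idx m n) (Loop N)}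
    (h : X - 1 ∈ unifSupp (N := N) (Set.Iio 0)) : X ∈ unifSupp (N := N) (Set.Iic 0) := by
  have := add_mem (unifSupp_mono Iio_subset_Iic h) (unifSupp_mono zero_subset_Iic one_mem_unifSupp)
  rwa [sub_add_cancel] at this

theorem IsMinus.mem {g : GL (Idx m n) (Loop N)} (h : IsMinus g) :
    g.val ∈ unifSupp (N := N) (Set.Iic 0) := mem_of_sub_one_mem h.sub_one_mem

theorem IsMinus.inv_mem {g : GL (Idx m n) (Loop N)} (h : IsMinus g) :
    (g⁻¹).val ∈ unifSupp (N := N) (Set.Iic 0) :=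
  inv_mem_of_isTwisted h.2.2 h.mem

theorem IsMinus.inv_sub_one_mem {g : GL (Idx m n) (Loop N)} (h : IsMinus g) :
    (g⁻¹).val - 1 ∈ unifSupp (N := N) (Set.Iio 0) := by
  have h1 : (g⁻¹).val - 1 = -((g.val - 1) * (g⁻¹).val) := by
    rw [sub_mul, Units.mul_inv, one_mul, neg_sub]
  rw [h1]
  refine neg_mem (add_le_mul ?_ h.sub_one_mem h.inv_mem)
  intro i hi j hj
  simp only [Set.mem_Iio, Set.mem_Iic] at *
  omega

/-- `M' M⁻¹ = E' E⁻¹` is `1` plus negative powers on one side and has no negative powers on the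
other, so it is `1`. This identifies the `M` of the tau function with the `M` of the solution. -/
theorem IsFactorization.unique {f : GL (Idx m n) (LaurentSeries ℂ)}
    {M E M' E' : GL (Idx m n) (Loop N)} (h : IsFactorization f M E)
    (h' : IsFactorization f M' E') : M = M' := by
  have h1 : M⁻¹ * E = M'⁻¹ * E' := Units.ext (h.2.2.symm.trans h'.2.2)
  have h2 : M' * M⁻¹ = E' * E⁻¹ := by
    rw [eq_mul_inv_iff_mul_eq, mul_assoc, h1, mul_inv_cancel_left]
  have h3 : M'.val * (M⁻¹).val - 1 ∈ unifSupp (N := N) (Set.Iio 0) := by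
    have : M'.val * (M⁻¹).val - 1 = (M'.val - 1) * (M⁻¹).val + ((M⁻¹).val - 1) := by
      rw [sub_mul, one_mul]; abel
    rw [this]
    refine add_mem (add_le_mul ?_ h'.1.sub_one_mem h.1.inv_mem) h.1.inv_sub_one_mem
    intro i hi j hj
    simp only [Set.mem_Iio, Set.mem_Iic] at *
    omega
  have h4 : M'.val * (M⁻¹).val - 1 ∈ unifSupp (N := N) (Set.Ici 0) := by
    have : M'.val * (M⁻¹).val = E'.val * (E⁻¹).val := congrArg Units.val h2
    rw [this]
    refine sub_mem (add_le_mul ?_ h'.2.1.mem h.2.1.inv_mem)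
      (unifSupp_mono zero_subset_Ici one_mem_unifSupp)
    intro i hi j hj
    simp only [Set.mem_Ici] at *
    omega
  have h5 := eq_zero_of_mem_matSupp (fun _ _ => disjoint_Ici_Iio) h4 h3
  have h6 : M' * M⁻¹ = 1 := Units.ext (sub_eq_zero.mp h5)
  exact (mul_inv_eq_one.mp h6).symm

/-! ### Series of high order in the times -/

/-- The series all of whose terms of degree at most `D` in the times vanish. -/
def tIdeal (N : ℕ) (R : Type*) [CommRing R] (D : ℕ) : Ideal (MvPowerSeries (Fin (N + 1)) R) where
  carrier := {x | ∀ d : Fin (N + 1) →₀ ℕ, d.degree ≤ D → MvPowerSeries.coeff d x = 0}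
  add_mem' hx hy d hd := by rw [map_add, hx d hd, hy d hd, add_zero]
  zero_mem' _ _ := map_zero _
  smul_mem' c x hx d hd := by
    classical
    rw [smul_eq_mul, MvPowerSeries.coeff_mul]
    refine Finset.sum_eq_zero fun p hp => ?_
    rw [Finset.HasAntidiagonal.mem_antidiagonal] at hp
    rw [hx p.2 (le_trans (by rw [← hp, map_add]; omega) hd), mul_zero]

theorem eq_zero_of_forall_mem_tIdeal {R : Type*} [CommRing R]
    {x : MvPowerSeries (Fin (N + 1)) R} (h : ∀ D, x ∈ tIdeal N R D) : x = 0 := by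
  ext d; exact h _ d le_rfl

theorem tIdeal_anti {R : Type*} [CommRing R] {D D' : ℕ} (h : D ≤ D') :
    tIdeal N R D' ≤ tIdeal N R D := fun _ hx d hd => hx d (hd.trans h)

theorem pderiv_mem_tIdeal {R : Type*} [CommRing R] {D : ℕ} (j : Fin (N + 1))
    {x : MvPowerSeries (Fin (N + 1)) R} (h : x ∈ tIdeal N R (D + 1)) :
    MvPowerSeries.pderiv R j x ∈ tIdeal N R D := by
  intro d hd
  rw [MvPowerSeries.coeff_pderiv, h _ (by rw [map_add, Finsupp.degree_single]; omega), zero_mul]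

theorem tDer_mem_tIdeal {D : ℕ} (j : Fin (N + 1)) {x : Loop N}
    (h : x ∈ tIdeal N (LaurentSeries ℂ) (D + 1)) : tDer j x ∈ tIdeal N (LaurentSeries ℂ) D :=
  pderiv_mem_tIdeal j h

theorem sDer_mem_tIdeal {D : ℕ} (j : Fin (N + 1)) {x : TSeries N}
    (h : x ∈ tIdeal N ℂ (D + 1)) : sDer j x ∈ tIdeal N ℂ D :=
  pderiv_mem_tIdeal j h

theorem lamCoeff_mem_tIdeal {D : ℕ} (k : ℤ) {x : Loop N}
    (h : x ∈ tIdeal N (LaurentSeries ℂ) D) : lamCoeff k x ∈ tIdeal N ℂ D := by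
  intro d hd
  rw [coeff_lamCoeff, h d hd, HahnSeries.coeff_zero]

theorem mem_tIdeal_of_lamCoeff {D : ℕ} {x : Loop N}
    (h : ∀ k, lamCoeff k x ∈ tIdeal N ℂ D) : x ∈ tIdeal N (LaurentSeries ℂ) D := by
  intro d hd
  ext i
  have := h (-i) d hd
  rwa [coeff_lamCoeff, neg_neg] at this

/-- Membership in `tIdeal N R D` means order at least `D + 1` in the times, and orders add: `(D + 1)
+ (D' + 1) = (D + D' + 1) + 1`. -/
theorem mul_mem_tIdeal {R : Type*} [CommRing R] {D D' : ℕ}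
    {x y : MvPowerSeries (Fin (N + 1)) R} (hx : x ∈ tIdeal N R D) (hy : y ∈ tIdeal N R D') :
    x * y ∈ tIdeal N R (D + D' + 1) := by
  classical
  intro d hd
  rw [MvPowerSeries.coeff_mul]
  refine Finset.sum_eq_zero fun p hp => ?_
  rw [Finset.HasAntidiagonal.mem_antidiagonal] at hp
  have : p.1.degree + p.2.degree = d.degree := by rw [← hp, map_add]
  by_cases h1 : p.1.degree ≤ D
  · rw [hx _ h1, zero_mul]
  · rw [hy _ (by omega), mul_zero]

/-! ### The vacuum wave -/

theorem X_mem_tIdeal {R : Type*} [CommRing R] (i : Fin (N + 1)) :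
    (MvPowerSeries.X i : MvPowerSeries (Fin (N + 1)) R) ∈ tIdeal N R 0 := by
  intro d hd
  have : d = 0 := by rwa [Nat.le_zero, Finsupp.degree_eq_zero_iff] at hd
  rw [this, MvPowerSeries.coeff_zero_eq_constantCoeff_apply, MvPowerSeries.constantCoeff_X]

theorem pow_entry_mem_tIdeal {X : Matrix (Idx m n) (Idx m n) (Loop N)}
    (hX : ∀ a b, X a b ∈ tIdeal N (LaurentSeries ℂ) 0) (k : ℕ) (a b : Idx m n) :
    (X ^ (k + 1)) a b ∈ tIdeal N (LaurentSeries ℂ) k := by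
  induction k generalizing a b with
  | zero => rw [zero_add, pow_one]; exact hX a b
  | succ k ih =>
    rw [pow_succ, Matrix.mul_apply]
    exact sum_mem fun c _ => by simpa using mul_mem_tIdeal (ih a c) (hX c b)

/-- Constants as loops. -/
def scalar (N : ℕ) : ℂ →+* Loop N := MvPowerSeries.C.comp HahnSeries.C

theorem coeff_scalar_mul (c : ℂ) (a : Loop N) (d : Fin (N + 1) →₀ ℕ) :
    MvPowerSeries.coeff d (scalar N c * a) = c • MvPowerSeries.coeff d a := by
  rw [scalar, RingHom.comp_apply, MvPowerSeries.coeff_C_mul, HahnSeries.C_mul_eq_smul]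

theorem tDer_scalar (j : Fin (N + 1)) (c : ℂ) : tDer j (scalar N c) = 0 := tDer_C j _

/-- The partial sums of the exponential series. -/
def expSum (X : Matrix (Idx m n) (Idx m n) (Loop N)) (K : ℕ) :
    Matrix (Idx m n) (Idx m n) (Loop N) :=
  ∑ k ∈ Finset.range (K + 1), scalar N ((k.factorial : ℂ)⁻¹) • X ^ k

/-- If `X` has no constant term in `t`, then `X^(k+1)` has order at least `k + 1`, so the terms
beyond `K` do not affect degrees up to `K`. Differentiation of the exponential thus reduces to
finite sums. -/
theorem expT_sub_expSum {X : Matrix (Idx m n) (Idx m n) (Loop N)}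
    (hX : ∀ a b, X a b ∈ tIdeal N (LaurentSeries ℂ) 0) (K : ℕ) (a b : Idx m n) :
    expT X a b - expSum X K a b ∈ tIdeal N (LaurentSeries ℂ) K := by
  intro d hd
  have h1 : MvPowerSeries.coeff d (expT X a b) = ∑ k ∈ Finset.range (d.degree + 1),
    ((k.factorial : ℂ)⁻¹) • MvPowerSeries.coeff d ((X ^ k) a b) := rfl
  have h2 : MvPowerSeries.coeff d (expSum X K a b) = ∑ k ∈ Finset.range (K + 1),
      ((k.factorial : ℂ)⁻¹) • MvPowerSeries.coeff d ((X ^ k) a b) := by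
    rw [expSum, Matrix.sum_apply, map_sum]
    exact Finset.sum_congr rfl fun k _ => coeff_scalar_mul _ _ _
  rw [map_sub, h1, h2, sub_eq_zero]
  refine Finset.sum_subset (fun k hk => ?_) fun k hk hk' => ?_
  · rw [Finset.mem_range] at *; omega
  · rw [Finset.mem_range] at hk hk'
    obtain ⟨k, rfl⟩ : ∃ l, k = l + 1 := ⟨k - 1, by omega⟩
    rw [pow_entry_mem_tIdeal hX k a b d (by omega), smul_zero]

theorem map_der_pow_of_commute {R ι : Type*} [CommRing R] [Fintype ι] [DecidableEq ι]
    {D : R →+ R} (hD : IsLeibniz D) {X : Matrix ι ι R} (hX : X.map D * X = X * X.map D) (k : ℕ) :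
    (X ^ (k + 1)).map D = (k + 1) • (X.map D * X ^ k) := by
  induction k with
  | zero => simp
  | succ k ih =>
    rw [pow_succ, map_der_mul hD, ih, smul_mul_assoc, mul_assoc, ← pow_succ,
      (Commute.pow_left (show Commute X (X.map D) from hX.symm) (k + 1)).eq, succ_nsmul _ (k + 1)]

theorem map_tDer_expSum (j : Fin (N + 1)) {X : Matrix (Idx m n) (Idx m n) (Loop N)}
    (hX : X.map (tDer j) * X = X * X.map (tDer j)) (K : ℕ) :
    (expSum X (K + 1)).map (tDer j) = X.map (tDer j) * expSum X K := by
  have h1 : (expSum X (K + 1)).map (tDer j) = ∑ k ∈ Finset.range (K + 1 + 1),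
      scalar N ((k.factorial : ℂ)⁻¹) • (X ^ k).map (tDer j) := by
    ext1 a b
    rw [Matrix.map_apply, expSum, Matrix.sum_apply, map_sum, Matrix.sum_apply]
    refine Finset.sum_congr rfl fun k _ => ?_
    rw [Matrix.smul_apply, smul_eq_mul, isLeibniz_tDer, tDer_scalar, zero_mul, zero_add]; rfl
  rw [h1, Finset.sum_range_succ', pow_zero, map_der_one (isLeibniz_tDer j), smul_zero, add_zero,
    expSum, Finset.mul_sum]
  refine Finset.sum_congr rfl fun k _ => ?_
  rw [map_der_pow_of_commute (isLeibniz_tDer j) hX, mul_smul_comm, ← Nat.cast_smul_eq_nsmul (Loop N),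
    smul_smul, Nat.factorial_succ, ← map_natCast (scalar N), ← map_mul]
  congr 2
  have : ((k + 1 : ℕ) : ℂ) ≠ 0 := Nat.cast_ne_zero.mpr k.succ_ne_zero
  rw [Nat.cast_mul, mul_inv, mul_comm (((k + 1 : ℕ) : ℂ)⁻¹), mul_assoc, inv_mul_cancel₀ this,
    mul_one]

theorem map_tDer_expT (j : Fin (N + 1)) {X : Matrix (Idx m n) (Idx m n) (Loop N)}
    (hX0 : ∀ a b, X a b ∈ tIdeal N (LaurentSeries ℂ) 0)
    (hX : X.map (tDer j) * X = X * X.map (tDer j)) :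
    (expT X).map (tDer j) = X.map (tDer j) * expT X := by
  ext1 a b
  rw [← sub_eq_zero]
  refine eq_zero_of_forall_mem_tIdeal fun D => ?_
  -- A derivative costs one order in `t`, hence the partial sum up to `D + 1`.
  have h1 : ((expT X).map (tDer j)) a b - ((expSum X (D + 1)).map (tDer j)) a b ∈
      tIdeal N (LaurentSeries ℂ) D := by
    rw [Matrix.map_apply, Matrix.map_apply, ← map_sub]
    exact tDer_mem_tIdeal j (expT_sub_expSum hX0 (D + 1) a b)
  have h2 : (X.map (tDer j) * expT X) a b - (X.map (tDer j) * expSum X D) a b ∈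
      tIdeal N (LaurentSeries ℂ) D := by
    rw [← Matrix.sub_apply, ← mul_sub, Matrix.mul_apply]
    exact sum_mem fun c _ => Ideal.mul_mem_left _ _ (expT_sub_expSum hX0 D c b)
  rw [map_tDer_expSum j hX] at h1
  have := sub_mem h1 h2
  rwa [sub_sub_sub_cancel_right] at this

theorem map_tDer_Jmat (j : Fin (N + 1)) : (Jmat m n N).map (tDer j) = 0 := by
  ext1 a b
  have h : ∀ p : Prop, [Decidable p] → tDer j (if p then (1 : Loop N) else 0) = 0 := by
    intro p _
    split_ifs
    · exact (isLeibniz_tDer j).map_one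
    · exact map_zero _
  rw [Matrix.map_apply, Jmat, Matrix.add_apply, map_add, Matrix.smul_apply, smul_eq_mul,
    isLeibniz_tDer, tDer_lamPow, zero_mul, zero_add, eMat, Matrix.single_apply, h, mul_zero,
    zero_add, Matrix.zero_apply]
  rcases a with a | a <;> rcases b with b | b
  · exact map_zero _
  · exact map_zero _
  · exact map_zero _
  · rw [bMat, fromBlocks_apply₂₂, of_apply, h]

theorem tDer_X (i j : Fin (N + 1)) :
    tDer j (MvPowerSeries.X i : Loop N) = if i = j then 1 else 0 := by
  split_ifs with h
  · subst h; exact MvPowerSeries.pderiv_X_self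
  · exact MvPowerSeries.pderiv_X_of_ne h

theorem map_tDer_vacuum (j : Fin (N + 1)) :
    (vacuum m n N).map (tDer j) = -(Jmat m n N ^ (2 * (j : ℕ) + 1) * vacuum m n N) := by
  set X : Matrix (Idx m n) (Idx m n) (Loop N) :=
    -∑ i : Fin (N + 1), (MvPowerSeries.X i : Loop N) • Jmat m n N ^ (2 * (i : ℕ) + 1) with hX
  have h1 : X.map (tDer j) = -Jmat m n N ^ (2 * (j : ℕ) + 1) := by
    ext1 a b
    rw [Matrix.map_apply, hX, Matrix.neg_apply, Matrix.neg_apply, map_neg, Matrix.sum_apply,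
      map_sum, Finset.sum_eq_single j]
    · rw [Matrix.smul_apply, smul_eq_mul, isLeibniz_tDer, tDer_X, if_pos rfl, one_mul,
        ← Matrix.map_apply (f := tDer j), map_der_pow (isLeibniz_tDer j) (map_tDer_Jmat j),
        Matrix.zero_apply, mul_zero, add_zero]
    · intro i _ hi
      rw [Matrix.smul_apply, smul_eq_mul, isLeibniz_tDer, tDer_X, if_neg hi, zero_mul,
        ← Matrix.map_apply (f := tDer j), map_der_pow (isLeibniz_tDer j) (map_tDer_Jmat j),
        Matrix.zero_apply, mul_zero, add_zero]
    · simp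
  have h2 : Commute X (Jmat m n N) := by
    rw [hX]
    refine Commute.neg_left (Commute.sum_left _ _ _ fun i _ => ?_)
    exact Commute.smul_left ((Commute.refl _).pow_left _) _
  have h3 := map_tDer_expT (X := X) j ?_ ?_
  · rw [vacuum, h3, h1, neg_mul]
  · intro a b
    rw [hX, Matrix.neg_apply, Matrix.sum_apply]
    exact neg_mem (sum_mem fun i _ => Ideal.mul_mem_right _ _ (X_mem_tIdeal i))
  · rw [h1]
    exact ((h2.pow_right _).neg_right).eq.symm

theorem constantCoeff_vacuum (a b : Idx m n) :
    MvPowerSeries.constantCoeff (vacuum m n N a b) =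
      (1 : Matrix (Idx m n) (Idx m n) (LaurentSeries ℂ)) a b := by
  rw [← MvPowerSeries.coeff_zero_eq_constantCoeff_apply]
  have h1 : ∀ X : Matrix (Idx m n) (Idx m n) (Loop N), MvPowerSeries.coeff 0 (expT X a b) =
    ∑ k ∈ Finset.range (Finsupp.degree (0 : Fin (N + 1) →₀ ℕ) + 1),
    ((k.factorial : ℂ)⁻¹) • MvPowerSeries.coeff 0 ((X ^ k) a b) := fun _ => rfl
  rw [vacuum, h1, map_zero, zero_add, Finset.sum_range_one, pow_zero, Matrix.one_apply,
    Matrix.one_apply]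
  split_ifs <;> simp

/-! ### Derivatives of the factors -/

theorem map_mul_inv_cancel {D : Loop N →+ Loop N} (hD : IsLeibniz D) (g : GL (Idx m n) (Loop N)) :
    (g⁻¹).val.map D = -((g⁻¹).val * g.val.map D * (g⁻¹).val) := by
  have h1 := map_der_mul hD (g⁻¹).val g.val
  rw [Units.inv_mul, map_der_one hD] at h1
  have h2 : (g⁻¹).val.map D * g.val = -((g⁻¹).val * g.val.map D) := eq_neg_of_add_eq_zero_left h1.symm
  calc (g⁻¹).val.map D = (g⁻¹).val.map D * g.val * (g⁻¹).val := by
        rw [mul_assoc, Units.mul_inv, mul_one]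
    _ = _ := by rw [h2, neg_mul]

theorem map_tDer_constTime (j : Fin (N + 1)) (f : GL (Idx m n) (LaurentSeries ℂ)) :
    (constTime f : GL (Idx m n) (Loop N)).val.map (tDer j) = 0 := by
  ext1 a b; exact tDer_C j _

variable {f : GL (Idx m n) (LaurentSeries ℂ)} {M E : GL (Idx m n) (Loop N)}

/-- The power `L^{2j+1}` of the Lax operator `L = M J M⁻¹`. -/
def laxPow (M : GL (Idx m n) (Loop N)) (j : Fin (N + 1)) : Matrix (Idx m n) (Idx m n) (Loop N) :=
  M.val * Jmat m n N ^ (2 * (j : ℕ) + 1) * (M⁻¹).val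

theorem IsFactorization.map_tDer_quotient (h : IsFactorization f M E) (j : Fin (N + 1)) :
    ((M⁻¹).val * E.val).map (tDer j) =
      -(Jmat m n N ^ (2 * (j : ℕ) + 1) * ((M⁻¹).val * E.val)) := by
  rw [← h.2.2, map_der_mul (isLeibniz_tDer j), map_tDer_constTime, mul_zero, add_zero,
    map_tDer_vacuum, neg_mul, mul_assoc]

theorem IsMinus.map_tDer_mem (h : IsMinus M) (j : Fin (N + 1)) :
    M.val.map (tDer j) ∈ unifSupp (N := N) (Set.Iio 0) := by
  have h1 : M.val.map (tDer j) = (M.val - 1).map (tDer j) := by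
    rw [map_der_sub, map_der_one (isLeibniz_tDer j), sub_zero]
  rw [h1]
  exact CKP.map_tDer_mem j h.sub_one_mem

theorem Iio_add_Iic : ∀ i ∈ Set.Iio (0 : ℤ), ∀ j ∈ Set.Iic (0 : ℤ), i + j ∈ Set.Iio (0 : ℤ) := by
  intro i hi j hj
  simp only [Set.mem_Iio, Set.mem_Iic] at *
  omega

theorem Iic_add_Iio : ∀ i ∈ Set.Iic (0 : ℤ), ∀ j ∈ Set.Iio (0 : ℤ), i + j ∈ Set.Iio (0 : ℤ) := by
  intro i hi j hj
  simp only [Set.mem_Iio, Set.mem_Iic] at *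
  omega

theorem Ici_add_Ici : ∀ i ∈ Set.Ici (0 : ℤ), ∀ j ∈ Set.Ici (0 : ℤ), i + j ∈ Set.Ici (0 : ℤ) := by
  intro i hi j hj
  simp only [Set.mem_Ici] at *
  omega

/-- The Sato–Wilson equations. Differentiating `M⁻¹ E = W f⁻¹` gives `M_t M⁻¹ - E_t E⁻¹ = L^k`; the
first term has only negative powers of `λ`, the second only nonnegative ones. -/
theorem IsFactorization.map_tDer_split (h : IsFactorization f M E) (j : Fin (N + 1)) :
    -(E.val.map (tDer j) * (E⁻¹).val) = (laxPow M j).map plusPart ∧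
      M.val.map (tDer j) * (M⁻¹).val = (laxPow M j).map minusPart := by
  refine splitting_unique (neg_mem (add_le_mul Ici_add_Ici (map_tDer_mem j h.2.1.mem)
    h.2.1.inv_mem)) (map_plusPart_mem _)
    (add_le_mul Iio_add_Iic (h.1.map_tDer_mem j) h.1.inv_mem) (map_minusPart_mem _) ?_
  rw [map_plus_add_map_minus, laxPow]
  have h1 := h.map_tDer_quotient j
  rw [map_der_mul (isLeibniz_tDer j), map_mul_inv_cancel (isLeibniz_tDer j)] at h1
  have h2 : M.val * (-((M⁻¹).val * M.val.map (tDer j) * (M⁻¹).val) * E.val +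
      (M⁻¹).val * E.val.map (tDer j)) * (E⁻¹).val =
      M.val * -(Jmat m n N ^ (2 * (j : ℕ) + 1) * ((M⁻¹).val * E.val)) * (E⁻¹).val := by rw [h1]
  have h3 : M.val * (-((M⁻¹).val * M.val.map (tDer j) * (M⁻¹).val) * E.val +
      (M⁻¹).val * E.val.map (tDer j)) * (E⁻¹).val =
      -((M.val * (M⁻¹).val) * (M.val.map (tDer j) * (M⁻¹).val) * (E.val * (E⁻¹).val)) +
      (M.val * (M⁻¹).val) * E.val.map (tDer j) * (E⁻¹).val := by noncomm_ring
  have h4 : M.val * -(Jmat m n N ^ (2 * (j : ℕ) + 1) * ((M⁻¹).val * E.val)) * (E⁻¹).val =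
      -(M.val * Jmat m n N ^ (2 * (j : ℕ) + 1) * (M⁻¹).val * (E.val * (E⁻¹).val)) := by
    noncomm_ring
  rw [h3, h4, Units.mul_inv, Units.mul_inv, one_mul, mul_one, mul_one, one_mul] at h2
  rw [← neg_inj, neg_add, neg_neg, ← h2, add_comm]

theorem IsFactorization.map_tDer_minus (h : IsFactorization f M E) (j : Fin (N + 1)) :
    M.val.map (tDer j) = (laxPow M j).map minusPart * M.val := by
  rw [← (h.map_tDer_split j).2, mul_assoc, Units.inv_mul, mul_one]

theorem IsFactorization.map_tDer_plus (h : IsFactorization f M E) (j : Fin (N + 1)) :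
    E.val.map (tDer j) = -((laxPow M j).map plusPart * E.val) := by
  rw [← (h.map_tDer_split j).1, neg_mul, neg_neg, mul_assoc, Units.inv_mul, mul_one]

end

/-! ### Powers of `J`, the principal filtration and the rigidity of `J`. -/

section

variable {m n N : ℕ}

/-! ### The powers of `J` -/

/-- `J_0 = e_{1,2n+1} λ + b`. -/
def cyclicMat (n N : ℕ) : Matrix (Fin (2 * n + 1)) (Fin (2 * n + 1)) (Loop N) :=
  of fun i j => if (i : ℕ) = j + 1 then 1 else if (i : ℕ) + (2 * n + 1) = j + 1 then lamPow 1 else 0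

theorem Jmat_eq : Jmat m n N = fromBlocks 0 0 0 (cyclicMat n N) := by
  ext1 a b
  rw [Jmat, Matrix.add_apply, Matrix.smul_apply, smul_eq_mul, eMat, Matrix.single_apply, bMat]
  rcases a with i | i <;> rcases b with j | j
  · simp
  · simp
  · simp
  · rw [fromBlocks_apply₂₂, fromBlocks_apply₂₂, cyclicMat, of_apply, of_apply]
    have hi := i.2
    have hj := j.2
    by_cases h1 : (i : ℕ) = j + 1
    · have h2 : ¬ (0 = i ∧ Fin.last (2 * n) = j) := by
        rintro ⟨rfl, rfl⟩; simp at h1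
      simp [h1, h2]
    · rw [if_neg h1, if_neg h1, add_zero]
      by_cases h3 : (i : ℕ) + (2 * n + 1) = j + 1
      · have h4 : 0 = i ∧ Fin.last (2 * n) = j := by
          constructor
          · ext; simp only [Fin.val_zero]; omega
          · ext; simp only [Fin.val_last]; omega
        rw [if_pos h3, if_pos (by rw [h4.1, h4.2]; exact ⟨rfl, rfl⟩), mul_one]
      · rw [if_neg h3, if_neg, mul_zero]
        rintro ⟨h4, h5⟩
        rw [Sum.inr.injEq] at h4 h5
        subst h4 h5
        simp at h3

theorem cyclicMat_pow (k : ℕ) (hk : k ≤ 2 * n + 1) :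
    cyclicMat n N ^ k = of fun i j : Fin (2 * n + 1) => if (i : ℕ) = j + k then 1 else
      if (i : ℕ) + (2 * n + 1) = j + k then lamPow 1 else 0 := by
  induction k with
  | zero =>
    ext1 i j
    rw [pow_zero, of_apply, Matrix.one_apply]
    have hi := i.2
    have hj := j.2
    by_cases h : i = j
    · simp [h]
    · have h' : (i : ℕ) ≠ j := fun h'' => h (Fin.ext h'')
      rw [if_neg h, if_neg (by omega), if_neg (by omega)]
  | succ k ih =>
    ext1 i j
    rw [pow_succ, ih (by omega), Matrix.mul_apply, of_apply]
    have hi := i.2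
    have hj := j.2
    by_cases h : (j : ℕ) < 2 * n
    · rw [Finset.sum_eq_single ⟨j + 1, by omega⟩]
      · simp only [cyclicMat, of_apply, if_true, mul_one]
        have e1 : (i : ℕ) = j + 1 + k ↔ (i : ℕ) = j + (k + 1) := by omega
        have e2 : (i : ℕ) + (2 * n + 1) = j + 1 + k ↔ (i : ℕ) + (2 * n + 1) = j + (k + 1) := by omega
        simp only [e1, e2]
      · intro l _ hl
        have : (l : ℕ) ≠ j + 1 := fun h' => hl (Fin.ext h')
        have hl2 := l.2
        have hz : cyclicMat n N l j = 0 := by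
          rw [cyclicMat, of_apply, if_neg this, if_neg (by omega)]
        rw [hz, mul_zero]
      · simp
    · have h0 : ((0 : Fin (2 * n + 1)) : ℕ) = 0 := rfl
      rw [Finset.sum_eq_single 0]
      · have hz : cyclicMat n N 0 j = lamPow 1 := by
          rw [cyclicMat, of_apply, if_neg (by omega), if_pos (by omega)]
        rw [hz, of_apply, if_neg (show ¬ ((i : ℕ) = j + (k + 1)) by omega)]
        by_cases h2 : (i : ℕ) = k
        · rw [if_pos (by omega), if_pos (by omega), one_mul]
        · rw [if_neg (by omega), if_neg (by omega), if_neg (by omega), zero_mul]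
      · intro l _ hl
        have : (l : ℕ) ≠ 0 := fun h' => hl (Fin.ext h')
        have hl2 := l.2
        have hz : cyclicMat n N l j = 0 := by
          rw [cyclicMat, of_apply, if_neg (by omega), if_neg (by omega)]
        rw [hz, mul_zero]
      · simp

/-- On the second block `J^{2n+1}` is `λ`, but it vanishes on the first. One more factor `J` gives a
relation valid on the whole space. -/
theorem Jmat_pow_period : Jmat m n N ^ (2 * n + 1 + 1) = (lamPow 1 : Loop N) • Jmat m n N := by
  have h1 : cyclicMat n N ^ (2 * n + 1) = (lamPow 1 : Loop N) • 1 := by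
    rw [cyclicMat_pow _ le_rfl]
    ext1 i j
    rw [of_apply, Matrix.smul_apply, Matrix.one_apply, smul_eq_mul]
    have hi := i.2
    by_cases h : i = j
    · rw [if_neg (by omega), if_pos (by omega), if_pos h, mul_one]
    · have h' : (i : ℕ) ≠ j := fun h'' => h (Fin.ext h'')
      rw [if_neg (by omega), if_neg (by omega), if_neg h, mul_zero]
  have h2 : ∀ k : ℕ, Jmat m n N ^ (k + 1) = fromBlocks 0 0 0 (cyclicMat n N ^ (k + 1)) := by
    intro k
    induction k with
    | zero => rw [zero_add, pow_one, pow_one, Jmat_eq]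
    | succ k ih =>
      rw [pow_succ, ih, Jmat_eq, fromBlocks_multiply]
      simp [pow_succ]
  rw [h2, Jmat_eq, pow_succ, h1, fromBlocks_smul, smul_mul_assoc, one_mul]
  simp

theorem Jmat_mem : Jmat m n N ∈ unifSupp (N := N) (Set.Icc 0 1) := by
  have h0 : ({0} : Set ℤ) ⊆ Set.Icc 0 1 := by simp
  have h1 : ({1} : Set ℤ) ⊆ Set.Icc 0 1 := by simp
  rw [Jmat_eq]
  rintro (i | i) (j | j)
  · exact zero_mem _
  · exact zero_mem _
  · exact zero_mem _
  · simp only [fromBlocks_apply₂₂, cyclicMat, of_apply]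
    split_ifs
    · exact lamSupp_mono h0 one_mem_lamSupp
    · exact lamSupp_mono h1 (lamPow_mem 1)
    · exact zero_mem _

theorem Jmat_pow_mem (k : ℕ) : Jmat m n N ^ k ∈ unifSupp (N := N) (Set.Icc 0 (k : ℤ)) := by
  induction k with
  | zero => rw [pow_zero]; exact unifSupp_mono (by simp) one_mem_unifSupp
  | succ k ih =>
    rw [pow_succ]
    refine add_le_mul ?_ ih Jmat_mem
    intro i hi j hj
    simp only [Set.mem_Icc] at *
    push_cast
    omega

/-! ### The principal filtration -/

/-- The principal weight of an index. -/
def weight : Idx m n → ℤ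
  | Sum.inl _ => n
  | Sum.inr i => (i : ℕ)

theorem weight_nonneg (a : Idx m n) : 0 ≤ weight a := by
  rcases a with i | i <;> simp [weight]

theorem weight_le (a : Idx m n) : weight a ≤ 2 * n := by
  rcases a with i | i
  · simp only [weight]; omega
  · have := i.2; simp only [weight]; omega

/-- Matrix loops of principal degree at most `d`, where `λ` has degree `2n+1` and `e_{a,b}` has
degree `weight a - weight b`. -/
def pDeg (m n N : ℕ) (d : ℤ) : AddSubgroup (Matrix (Idx m n) (Idx m n) (Loop N)) :=
  matSupp fun a b => {k | (2 * n + 1) * k + weight a - weight b ≤ d}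

theorem pDeg_mono {d e : ℤ} (h : d ≤ e) {X : Matrix (Idx m n) (Idx m n) (Loop N)}
    (hX : X ∈ pDeg m n N d) : X ∈ pDeg m n N e :=
  matSupp_mono (fun _ _ _ hk => le_trans hk h) hX

theorem mul_mem_pDeg {d e : ℤ} {X Y : Matrix (Idx m n) (Idx m n) (Loop N)}
    (hX : X ∈ pDeg m n N d) (hY : Y ∈ pDeg m n N e) : X * Y ∈ pDeg m n N (d + e) := by
  refine mul_mem_matSupp ?_ hX hY
  intro a b c i hi j hj
  simp only [Set.mem_ofPred_eq] at *
  linarith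

theorem one_mem_pDeg : 1 ∈ pDeg m n N 0 := by
  intro a b
  rw [Matrix.one_apply]
  split_ifs with h
  · subst h
    exact lamSupp_mono (by simp) one_mem_lamSupp
  · exact zero_mem _

theorem pow_mem_pDeg {X : Matrix (Idx m n) (Idx m n) (Loop N)}
    (hX : X ∈ pDeg m n N 1) (k : ℕ) : X ^ k ∈ pDeg m n N k := by
  induction k with
  | zero => rw [pow_zero]; exact one_mem_pDeg
  | succ k ih => rw [pow_succ]; push_cast; exact mul_mem_pDeg ih hX

theorem lamPow_smul_mem_pDeg {d : ℤ} (i : ℤ) {X : Matrix (Idx m n) (Idx m n) (Loop N)}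
    (hX : X ∈ pDeg m n N d) : (lamPow i : Loop N) • X ∈ pDeg m n N (d + (2 * n + 1) * i) := by
  refine smul_mem_matSupp ?_ (lamPow_mem i) hX
  rintro a b _ rfl j hj
  simp only [Set.mem_ofPred_eq] at *
  linarith

/-- Every entry of `J` has degree exactly `1`: `1` for `e_{i+1,i}`, and `(2n + 1) - 2n` for `λ
e_{1,2n+1}`. -/
theorem Jmat_mem_pDeg : Jmat m n N ∈ pDeg m n N 1 := by
  rw [Jmat_eq]
  rintro (i | i) (j | j)
  · exact zero_mem _
  · exact zero_mem _
  · exact zero_mem _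
  · simp only [fromBlocks_apply₂₂, cyclicMat, of_apply]
    split_ifs with h1 h2
    · refine lamSupp_mono ?_ one_mem_lamSupp
      rintro _ rfl
      simp only [weight, Set.mem_ofPred_eq]
      omega
    · refine lamSupp_mono ?_ (lamPow_mem 1)
      rintro _ rfl
      simp only [weight, Set.mem_ofPred_eq]
      omega
    · exact zero_mem _

/-- All weights lie between `0` and `2n`, so a matrix unit raises the degree by at most `2n`, less
than the degree `2n + 1` of `λ`. For this, the weight of the first block could be any number in that
range. -/
theorem mem_pDeg_of_neg {X : Matrix (Idx m n) (Idx m n) (Loop N)}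
    (hX : X ∈ unifSupp (N := N) (Set.Iio 0)) : X ∈ pDeg m n N (-1) := by
  refine matSupp_mono ?_ hX
  intro a b k hk
  simp only [Set.mem_Iio, Set.mem_ofPred_eq] at *
  have h1 := weight_le a
  have h2 := weight_nonneg b
  nlinarith

theorem nsmul_mem_pDeg_iff {d : ℤ} {k : ℕ} (hk : k ≠ 0)
    {X : Matrix (Idx m n) (Idx m n) (Loop N)} : k • X ∈ pDeg m n N d ↔ X ∈ pDeg m n N d := by
  refine ⟨fun h a b i hi => ?_, fun h => nsmul_mem h k⟩
  have h1 : k • lamCoeff i (X a b) = 0 := by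
    rw [← h a b i hi, Matrix.smul_apply]
    exact (map_nsmul (lamCoeffHom i) k _).symm
  ext e
  have h2 := congrArg (MvPowerSeries.coeff e) h1
  rw [map_nsmul, map_zero, nsmul_eq_mul, mul_eq_zero] at h2
  rw [map_zero]
  exact h2.resolve_left (Nat.cast_ne_zero.mpr hk)

/-- A fixed power of `λ` in a fixed entry has a fixed degree, so it is excluded once the bound falls
below that degree. Both descents end here. -/
theorem eq_zero_of_forall_pDeg {X : Matrix (Idx m n) (Idx m n) (Loop N)} {d : ℤ}
    (h : ∀ c : ℕ, X ∈ pDeg m n N (d - c)) : X = 0 := by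
  ext1 a b
  apply ext_lamCoeff
  intro k
  rw [Matrix.zero_apply, lamCoeff_zero]
  have := h (d - ((2 * n + 1) * k + weight a - weight b) + 1).toNat a b
  refine this k ?_
  simp only [Set.mem_ofPred_eq, not_le]
  have := Int.self_le_toNat (d - ((2 * n + 1) * k + weight a - weight b) + 1)
  linarith

/-! ### Loops that commute with `∂_x + J` -/

/-- A pseudo-inverse of `ad J` on its image. -/
theorem ad_pseudoinverse {A : Type*} [Ring A] {J K P X B C : A} {p : ℕ} (h1 : J * K = P)
    (h2 : K * J = P) (h3 : P * J = J) (h4 : J * P = J) (h6 : P * K = K)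
    (h7 : J ^ p * (J * X - X * J) * K ^ p = P * (J * X - X * J) * P)
    (h8 : J ^ p * X * K ^ p = P * X * P)
    (hB : B = J * X - X * J) (hC : C = J * B - B * J) :
    p • B = p • (K * C * (1 - P) - (1 - P) * C * K) +
      ∑ i ∈ Finset.range p, i • (J ^ i * C * K ^ (i + 1)) := by
  -- On the block of `P`, conjugation `B ↦ J B K` has order `p`, and `C` measures its difference
  -- from the identity. The weights `i` invert this difference by Abel summation.
  have hs : ∀ i : ℕ, i • (J ^ i * C * K ^ (i + 1)) =
      i • (J ^ (i + 1) * B * K ^ (i + 1) - J ^ i * B * K ^ i) := by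
    intro i
    rcases i with _ | i
    · simp
    · congr 1
      have e : J * K ^ (i + 1 + 1) = K ^ (i + 1) := by
        rw [pow_succ' K (i + 1), ← mul_assoc, h1, pow_succ' K i, ← mul_assoc, h6]
      calc J ^ (i + 1) * C * K ^ (i + 1 + 1)
          = (J ^ (i + 1) * J) * B * K ^ (i + 1 + 1) - J ^ (i + 1) * B * (J * K ^ (i + 1 + 1)) := by
            rw [hC]; noncomm_ring
        _ = _ := by rw [e, ← pow_succ]
  have htel : ∀ (s : ℕ → A) (q : ℕ), ∑ i ∈ Finset.range q, i • (s (i + 1) - s i) =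
      q • s q - ∑ i ∈ Finset.range q, s (i + 1) := by
    intro s q
    induction q with
    | zero => simp
    | succ q ih =>
      rw [Finset.sum_range_succ, Finset.sum_range_succ, ih, smul_sub, succ_nsmul]
      abel
  -- The sum of `B` over its orbit vanishes because `B` is itself a commutator with `J`: the sum
  -- telescopes and closes up by periodicity.
  have hy : ∑ i ∈ Finset.range p, J ^ (i + 1) * B * K ^ (i + 1) = 0 := by
    have e : ∀ i : ℕ, J ^ (i + 1) * B * K ^ (i + 1) =
        J ^ (i + 1 + 1) * X * (P * K ^ (i + 1)) - J ^ (i + 1) * X * (P * K ^ i) := by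
      intro i
      have e1 : P * K ^ (i + 1) = K ^ (i + 1) := by rw [pow_succ', ← mul_assoc, h6]
      have e2 : J * K ^ (i + 1) = P * K ^ i := by rw [pow_succ', ← mul_assoc, h1]
      rw [e1, ← e2, hB, pow_succ J (i + 1)]
      noncomm_ring
    simp_rw [e]
    rw [Finset.sum_range_sub (fun i => J ^ (i + 1) * X * (P * K ^ i))]
    have e3 : J ^ (p + 1) * X * (P * K ^ p) = J * X * P := by
      rcases p with _ | p
      · simp
      · have e1 : P * K ^ (p + 1) = K ^ (p + 1) := by rw [pow_succ', ← mul_assoc, h6]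
        rw [e1, pow_succ', mul_assoc, mul_assoc, ← mul_assoc (J ^ (p + 1)), h8, ← mul_assoc,
          ← mul_assoc, h4]
    rw [e3]
    simp
  simp_rw [hs]
  rw [htel (fun i => J ^ i * B * K ^ i), hy, sub_zero, ← smul_add]
  congr 1
  -- The two mixed blocks of `B` are recovered by a single multiplication with `K`, and the block
  -- `(1 - P) B (1 - P)` is zero.
  have e1 : K * C * (1 - P) = P * B - P * B * P := by
    calc K * C * (1 - P) = (K * J) * B * (1 - P) - K * B * (J - J * P) := by rw [hC]; noncomm_ring
      _ = _ := by rw [h2, h4, sub_self, mul_zero, sub_zero, mul_sub, mul_one]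
  have e2 : (1 - P) * C * K = -(B * P - P * B * P) := by
    calc (1 - P) * C * K = (J - P * J) * B * K - (1 - P) * B * (J * K) := by rw [hC]; noncomm_ring
      _ = _ := by rw [h1, h3, sub_self, zero_mul, zero_mul, zero_sub, sub_mul, sub_mul, one_mul]
  have e4 : B = P * B + B * P - P * B * P := by
    have : (1 - P) * B * (1 - P) = 0 := by
      calc (1 - P) * B * (1 - P) = (J - P * J) * X * (1 - P) - (1 - P) * X * (J - J * P) := by
            rw [hB]; noncomm_ring
        _ = 0 := by rw [h3, h4, sub_self]; simp
    have h' : (1 - P) * B * (1 - P) = B - (P * B + B * P - P * B * P) := by noncomm_ring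
    rw [h'] at this
    exact sub_eq_zero.mp this
  have e5 : J ^ p * B * K ^ p = P * B * P := by rw [hB, h7]
  rw [e1, e2, e5]
  calc B = P * B + B * P - P * B * P := e4
    _ = _ := by abel

/-- The projection `λ⁻¹ J^{2n+1}` onto the second block. -/
def projMat (m n N : ℕ) : Matrix (Idx m n) (Idx m n) (Loop N) :=
  (lamPow (-1) : Loop N) • Jmat m n N ^ (2 * n + 1)

/-- The pseudo-inverse `λ⁻² J^{4n+1}` of `J`. -/
def pinvMat (m n N : ℕ) : Matrix (Idx m n) (Idx m n) (Loop N) :=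
  (lamPow (-2) : Loop N) • Jmat m n N ^ (2 * (2 * n + 1) - 1)

theorem Jmat_pow_add (k : ℕ) : Jmat m n N ^ (k + 1 + (2 * n + 1)) =
    (lamPow 1 : Loop N) • Jmat m n N ^ (k + 1) := by
  rw [show k + 1 + (2 * n + 1) = k + (2 * n + 1 + 1) by ring, pow_add, Jmat_pow_period,
    mul_smul_comm, ← pow_succ]

theorem lamPow_smul_smul (i j : ℤ) (X : Matrix (Idx m n) (Idx m n) (Loop N)) :
    (lamPow i : Loop N) • (lamPow j : Loop N) • X = (lamPow (i + j) : Loop N) • X := by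
  rw [smul_smul, ← lamPow_add]

theorem Jmat_mul_pinvMat : Jmat m n N * pinvMat m n N = projMat m n N := by
  rw [pinvMat, mul_smul_comm, ← pow_succ',
    show 2 * (2 * n + 1) - 1 + 1 = 2 * n + 1 + (2 * n + 1) by omega, Jmat_pow_add,
    lamPow_smul_smul, projMat]
  rfl

theorem pinvMat_mul_Jmat : pinvMat m n N * Jmat m n N = projMat m n N := by
  rw [← Jmat_mul_pinvMat, pinvMat, smul_mul_assoc, mul_smul_comm, ← pow_succ, ← pow_succ']

theorem projMat_mul_Jmat : projMat m n N * Jmat m n N = Jmat m n N := by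
  rw [projMat, smul_mul_assoc, ← pow_succ, Jmat_pow_period, lamPow_smul_smul]
  simp

theorem Jmat_mul_projMat : Jmat m n N * projMat m n N = Jmat m n N := by
  rw [projMat, mul_smul_comm, ← pow_succ', Jmat_pow_period, lamPow_smul_smul]
  simp

theorem projMat_mul_Jmat_pow (k : ℕ) :
    projMat m n N * Jmat m n N ^ (k + 1) = Jmat m n N ^ (k + 1) := by
  rw [pow_succ', ← mul_assoc, projMat_mul_Jmat]

theorem projMat_mul_self : projMat m n N * projMat m n N = projMat m n N := by
  conv_lhs => rw [projMat, mul_smul_comm, ← projMat, projMat_mul_Jmat_pow]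
  rfl

/-- This is why the exponent in `pinvMat` is `4n + 1` and not `2n`: for `n = 0` and `m > 0` the
candidate `λ⁻¹ J^{2n}` would not vanish on the first block. -/
theorem projMat_mul_pinvMat : projMat m n N * pinvMat m n N = pinvMat m n N := by
  rw [pinvMat, mul_smul_comm, show 2 * (2 * n + 1) - 1 = 4 * n + 1 by omega, projMat_mul_Jmat_pow]

theorem Jmat_pow_eq : Jmat m n N ^ (2 * n + 1) = (lamPow 1 : Loop N) • projMat m n N := by
  rw [projMat, lamPow_smul_smul]
  simp

/-- `J^{2n+1} = λ P`, and the same power of the pseudo-inverse is `λ⁻¹ P`; the central factors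
cancel. This is the periodicity used in `ad_pseudoinverse`. -/
theorem Jmat_pow_mul_pinvMat_pow (X : Matrix (Idx m n) (Idx m n) (Loop N)) :
    Jmat m n N ^ (2 * n + 1) * X * pinvMat m n N ^ (2 * n + 1) =
      projMat m n N * X * projMat m n N := by
  have h1 : ∀ k : ℕ, Jmat m n N ^ (k + 1) * pinvMat m n N ^ (k + 1) = projMat m n N := by
    intro k
    induction k with
    | zero => rw [zero_add, pow_one, pow_one, Jmat_mul_pinvMat]
    | succ k ih =>
      rw [pow_succ, pow_succ' (pinvMat m n N), mul_assoc, ← mul_assoc (Jmat m n N),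
        Jmat_mul_pinvMat, pow_succ' (pinvMat m n N) k, ← mul_assoc (projMat m n N),
        projMat_mul_pinvMat, ← pow_succ', ih]
  have h2 : projMat m n N * pinvMat m n N ^ (2 * n + 1) = (lamPow (-1) : Loop N) • projMat m n N := by
    conv_lhs => rw [projMat, smul_mul_assoc, h1]
  have h3 : pinvMat m n N ^ (2 * n + 1) = projMat m n N * pinvMat m n N ^ (2 * n + 1) := by
    rw [pow_succ', ← mul_assoc, projMat_mul_pinvMat]
  rw [h3, h2, Jmat_pow_eq, smul_mul_assoc, smul_mul_assoc, mul_smul_comm, lamPow_smul_smul]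
  simp

theorem pinvMat_mem_pDeg : pinvMat m n N ∈ pDeg m n N (-1) := by
  refine pDeg_mono ?_ (lamPow_smul_mem_pDeg (-2) (pow_mem_pDeg Jmat_mem_pDeg _))
  push_cast [Nat.cast_sub (show 1 ≤ 2 * (2 * n + 1) by omega)]
  linarith

theorem projMat_mem_pDeg : projMat m n N ∈ pDeg m n N 0 := by
  refine pDeg_mono ?_ (lamPow_smul_mem_pDeg (-1) (pow_mem_pDeg Jmat_mem_pDeg _))
  push_cast
  linarith

/-- On the image of `ad J` the inverse of `ad J` has degree `-1`: in `ad_pseudoinverse` every term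
contains one more factor `K` than factors `J`. -/
theorem ad_mem_pDeg {X : Matrix (Idx m n) (Idx m n) (Loop N)} {d : ℤ}
    (h : Jmat m n N * (Jmat m n N * X - X * Jmat m n N) -
      (Jmat m n N * X - X * Jmat m n N) * Jmat m n N ∈ pDeg m n N d) :
    Jmat m n N * X - X * Jmat m n N ∈ pDeg m n N (d - 1) := by
  rw [← nsmul_mem_pDeg_iff (Nat.succ_ne_zero (2 * n)), Nat.succ_eq_add_one,
    ad_pseudoinverse (P := projMat m n N) (K := pinvMat m n N) (X := X) Jmat_mul_pinvMat
      pinvMat_mul_Jmat projMat_mul_Jmat Jmat_mul_projMat projMat_mul_pinvMat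
      (Jmat_pow_mul_pinvMat_pow _) (Jmat_pow_mul_pinvMat_pow _) rfl rfl]
  set C := Jmat m n N * (Jmat m n N * X - X * Jmat m n N) -
      (Jmat m n N * X - X * Jmat m n N) * Jmat m n N
  have hQ : 1 - projMat m n N ∈ pDeg m n N 0 := sub_mem one_mem_pDeg projMat_mem_pDeg
  have hK : ∀ i : ℕ, pinvMat m n N ^ i ∈ pDeg m n N (-i) := by
    intro i
    induction i with
    | zero => rw [pow_zero]; exact one_mem_pDeg
    | succ i ih =>
      rw [pow_succ]
      exact pDeg_mono (by push_cast; linarith) (mul_mem_pDeg ih pinvMat_mem_pDeg)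
  refine add_mem (nsmul_mem (sub_mem ?_ ?_) _) (sum_mem fun i _ => nsmul_mem ?_ _)
  · exact pDeg_mono (by linarith) (mul_mem_pDeg (mul_mem_pDeg pinvMat_mem_pDeg h) hQ)
  · exact pDeg_mono (by linarith) (mul_mem_pDeg (mul_mem_pDeg hQ h) pinvMat_mem_pDeg)
  · exact pDeg_mono (by push_cast; linarith)
      (mul_mem_pDeg (mul_mem_pDeg (pow_mem_pDeg Jmat_mem_pDeg i) h) (hK (i + 1)))

/-- If `X_x = [X, J]`, then `[J, X] = -X_x` has the degree bound of `X` and satisfies the same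
equation. So a bound on `[J, [J, X]]` is available by induction, and `ad_mem_pDeg` lowers it by one
for `[J, X]`. -/
theorem commute_of_lax {X : Matrix (Idx m n) (Idx m n) (Loop N)} (hX : X ∈ pDeg m n N 1)
    (h : X.map (tDer 0) = X * Jmat m n N - Jmat m n N * X) :
    Jmat m n N * X - X * Jmat m n N = 0 := by
  have key : ∀ (c : ℕ) (X : Matrix (Idx m n) (Idx m n) (Loop N)), X ∈ pDeg m n N 1 →
      X.map (tDer 0) = X * Jmat m n N - Jmat m n N * X →
      Jmat m n N * X - X * Jmat m n N ∈ pDeg m n N (1 - c) := by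
    intro c
    induction c with
    | zero =>
      intro X hX h
      rw [← neg_sub (X * Jmat m n N), ← h, Nat.cast_zero, sub_zero]
      exact neg_mem (map_tDer_mem 0 hX)
    | succ c ih =>
      intro X hX h
      have h1 : Jmat m n N * X - X * Jmat m n N ∈ pDeg m n N 1 := by
        rw [← neg_sub (X * Jmat m n N), ← h]
        exact neg_mem (map_tDer_mem 0 hX)
      have h2 := ih _ h1 (by
        rw [map_der_sub, map_der_mul (isLeibniz_tDer 0), map_der_mul (isLeibniz_tDer 0),
          map_tDer_Jmat, h]
        noncomm_ring)
      refine pDeg_mono ?_ (ad_mem_pDeg h2)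
      push_cast; linarith
  exact eq_zero_of_forall_pDeg fun c => key c X hX h

/-- With `p = 2n + 1`, `λ (T - J) = T^{p+1} - J^{p+1} = (T - J) ∑ T^i J^{p-i}`. The leading part of
the sum is `(p + 1) λ P`, and `1 - (p + 1) P` is invertible, so `T - J` equals a multiple of itself
by something of negative degree. -/
theorem eq_Jmat_of_commute {T : Matrix (Idx m n) (Idx m n) (Loop N)}
    (hT : T - Jmat m n N ∈ pDeg m n N 0) (hc : Commute T (Jmat m n N))
    (hp : T ^ (2 * n + 1 + 1) = (lamPow 1 : Loop N) • T) : T = Jmat m n N := by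
  set J := Jmat m n N
  set P := projMat m n N
  have hT1 : T ∈ pDeg m n N 1 := by
    have := add_mem (pDeg_mono zero_le_one hT) Jmat_mem_pDeg
    rwa [sub_add_cancel] at this
  have hpow : ∀ i : ℕ, T ^ i - J ^ i ∈ pDeg m n N (i - 1) := by
    intro i
    induction i with
    | zero => rw [pow_zero, pow_zero, sub_self]; exact zero_mem _
    | succ i ih =>
      have : T ^ (i + 1) - J ^ (i + 1) = (T ^ i - J ^ i) * T + J ^ i * (T - J) := by
        rw [pow_succ, pow_succ]; noncomm_ring
      rw [this]
      refine add_mem (pDeg_mono ?_ (mul_mem_pDeg ih hT1))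
        (pDeg_mono ?_ (mul_mem_pDeg (pow_mem_pDeg Jmat_mem_pDeg i) hT)) <;> push_cast <;> linarith
  set R := ∑ i ∈ Finset.range (2 * n + 1 + 1), (T ^ i - J ^ i) * J ^ (2 * n + 1 - i) with hR
  -- The degree `2n` is one less than that of `λ`, so `λ⁻¹ R` has degree at most `-1`.
  have hRmem : R ∈ pDeg m n N (2 * n) := by
    refine sum_mem fun i hi => ?_
    have hi' := Finset.mem_range.mp hi
    refine pDeg_mono ?_ (mul_mem_pDeg (hpow i) (pow_mem_pDeg Jmat_mem_pDeg (2 * n + 1 - i)))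
    push_cast [Nat.cast_sub (show i ≤ 2 * n + 1 by omega)]
    linarith
  have h1 := hc.mul_geom_sum₂ (2 * n + 1 + 1)
  have h2 : ∑ i ∈ Finset.range (2 * n + 1 + 1), T ^ i * J ^ (2 * n + 1 + 1 - 1 - i) =
      R + (2 * n + 1 + 1) • J ^ (2 * n + 1) := by
    have : (2 * n + 1 + 1) • J ^ (2 * n + 1) =
        ∑ i ∈ Finset.range (2 * n + 1 + 1), J ^ i * J ^ (2 * n + 1 - i) := by
      rw [Finset.sum_congr rfl (g := fun _ => J ^ (2 * n + 1))]
      · simp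
      · intro i hi
        have hi' := Finset.mem_range.mp hi
        rw [← pow_add]; congr 1; omega
    rw [this, hR, ← Finset.sum_add_distrib]
    refine Finset.sum_congr rfl fun i _ => ?_
    rw [← add_mul, sub_add_cancel, add_tsub_cancel_right]
  have h3 : (lamPow 1 : Loop N) • (T - J) = (T - J) * R +
      (lamPow 1 : Loop N) • ((T - J) * ((2 * n + 1 + 1) • P)) := by
    rw [smul_sub, ← hp, ← Jmat_pow_period, ← h1, h2, mul_add, Jmat_pow_eq, smul_comm, mul_smul_comm]
  have h4 : T - J = (T - J) * ((lamPow (-1) : Loop N) • R) + (T - J) * ((2 * n + 1 + 1) • P) := by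
    have := congrArg (fun X => (lamPow (-1) : Loop N) • X) h3
    simp only [smul_add, lamPow_smul_smul] at this
    rw [mul_smul_comm]
    simpa using this
  have h5 : (2 * n + 1) • (T - J) = (T - J) * ((lamPow (-1) : Loop N) • R) *
      ((2 * n + 1) • 1 - (2 * n + 1 + 1) • P) := by
    have hPP : P * P = P := projMat_mul_self
    have h6 : (T - J) * ((lamPow (-1) : Loop N) • R) = (T - J) * (1 - (2 * n + 1 + 1) • P) := by
      rw [mul_sub, mul_one]; exact eq_sub_of_add_eq h4.symm
    -- `1 - (q + 1) P` is `1` on the kernel of `P` and `-q` on its image; the second factor is `q`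
    -- and `-1` there. Multiplying by it avoids division.
    have h7 : ∀ q : ℕ, (1 - (q + 1) • P) * (q • 1 - (q + 1) • P) = q • 1 := by
      intro q
      have haa : (q + 1) • P * ((q + 1) • P) = (q + 1) • ((q + 1) • P) := by
        rw [smul_mul_smul_comm, hPP, smul_smul]
      rw [sub_mul, one_mul, mul_sub, mul_smul_comm, mul_one, haa, succ_nsmul ((q + 1) • P)]
      abel
    rw [h6, mul_assoc, h7, mul_smul_comm, mul_one]
  have key : ∀ c : ℕ, T - J ∈ pDeg m n N (0 - c) := by
    intro c
    induction c with
    | zero => simpa using hT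
    | succ c ih =>
      rw [← nsmul_mem_pDeg_iff (Nat.succ_ne_zero (2 * n)), Nat.succ_eq_add_one, h5]
      refine pDeg_mono ?_ (mul_mem_pDeg (mul_mem_pDeg ih (lamPow_smul_mem_pDeg (-1) hRmem))
        (sub_mem (nsmul_mem one_mem_pDeg _) (nsmul_mem projMat_mem_pDeg _)))
      push_cast; linarith
  exact sub_eq_zero.mp (eq_zero_of_forall_pDeg key)

end

/-! ### Gauge group, dressing, uniqueness of `S` and the hierarchy. -/

section

variable {m n N : ℕ}

/-! ### The group `N^+` -/

theorem InNplus.exists_unit {Δ : Matrix (Idx m n) (Idx m n) (TSeries N)} (h : InNplus Δ) :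
    ∃ g : GL (Idx m n) (TSeries N), g.val = Δ ∧ InNplus (g⁻¹).val := by
  obtain ⟨D, hD1, hD2, rfl⟩ := h
  have htri : D.BlockTriangular id := fun i j hij => hD2 i j hij
  have hdet : D.det = 1 := by
    rw [Matrix.det_of_isUpperTriangular htri]
    exact Finset.prod_eq_one fun i _ => hD1 i
  have hu : IsUnit D.det := by rw [hdet]; exact isUnit_one
  let _ : Invertible D := Matrix.invertibleOfIsUnitDet D hu
  have htri' : (D⁻¹).BlockTriangular id := Matrix.blockTriangular_inv_of_blockTriangular htri
  have h1 : D * D⁻¹ = 1 := Matrix.mul_nonsing_inv D hu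
  have h2 : D⁻¹ * D = 1 := Matrix.nonsing_inv_mul D hu
  refine ⟨⟨fromBlocks 1 0 0 D, fromBlocks 1 0 0 D⁻¹, ?_, ?_⟩, rfl, D⁻¹, fun i => ?_,
    fun i j hij => htri' hij, rfl⟩
  · rw [fromBlocks_multiply, h1]; simp
  · rw [fromBlocks_multiply, h2]; simp
  · have h3 := congrFun (congrFun h1 i) i
    rw [Matrix.mul_apply, Matrix.one_apply_eq, Finset.sum_eq_single i, hD1, one_mul] at h3
    · exact h3
    · intro k _ hk
      rcases lt_or_gt_of_ne hk with hk | hk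
      · rw [hD2 _ _ hk, zero_mul]
      · rw [show D⁻¹ k i = 0 from htri' hk, mul_zero]
    · simp

/-- Matrices over the series in the times, regarded as loops. -/
def constGL : GL (Idx m n) (TSeries N) →* GL (Idx m n) (Loop N) :=
  Units.map (constLoop (N := N)).mapMatrix.toMonoidHom

theorem constGL_val (g : GL (Idx m n) (TSeries N)) : (constGL g).val = g.val.map constLoop := rfl

theorem map_constLoop_mul {ι κ ρ : Type*} [Fintype κ] (X : Matrix ι κ (TSeries N))
    (Y : Matrix κ ρ (TSeries N)) :
    (X * Y).map constLoop = X.map constLoop * Y.map constLoop := Matrix.map_mul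

theorem map_constLoop_add {ι κ : Type*} (X Y : Matrix ι κ (TSeries N)) :
    (X + Y).map constLoop = X.map constLoop + Y.map constLoop := by
  ext1 a b; exact map_add constLoop _ _

theorem map_tDer_constLoop {ι κ : Type*} (j : Fin (N + 1)) (X : Matrix ι κ (TSeries N)) :
    (X.map constLoop).map (tDer j) = (X.map (sDer j)).map constLoop := by
  ext1 a b; exact tDer_constLoop j _

theorem map_lamDer_constLoop {ι κ : Type*} (X : Matrix ι κ (TSeries N)) :
    (X.map constLoop).map lamDer = 0 := by
  ext1 a b; exact lamDer_constLoop _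

theorem map_constLoop_bMat : (bMat m n (TSeries N)).map constLoop = bMat m n (Loop N) := by
  ext1 a b
  rcases a with a | a <;> rcases b with b | b
  · exact map_zero constLoop
  · exact map_zero constLoop
  · exact map_zero constLoop
  · rw [Matrix.map_apply, bMat, bMat, fromBlocks_apply₂₂, fromBlocks_apply₂₂, of_apply, of_apply]
    split_ifs
    · exact map_one _
    · exact map_zero _

/-- The first column of a unipotent upper triangular block is the first unit vector. Together with
the statement for the last row, this shows that the gauge group fixes the `λ`-part of `J`. -/
theorem InNplus.mul_eMat {Δ : Matrix (Idx m n) (Idx m n) (TSeries N)} (h : InNplus Δ) :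
    Δ.map constLoop * eMat m n (Loop N) = eMat m n (Loop N) := by
  obtain ⟨D, h1, h2, rfl⟩ := h
  ext1 a b
  rw [eMat]
  by_cases hb : b = Sum.inr (Fin.last (2 * n))
  · subst hb
    rw [Matrix.mul_single_apply_same, mul_one, Matrix.map_apply]
    rcases a with a | a
    · rw [fromBlocks_apply₁₂, Matrix.zero_apply, map_zero, Matrix.single_apply, if_neg (by simp)]
    · rw [fromBlocks_apply₂₂]
      by_cases ha : a = 0
      · subst ha
        rw [h1, map_one, Matrix.single_apply_same]
      · rw [h2 _ _ (Fin.pos_of_ne_zero ha), map_zero, Matrix.single_apply, if_neg]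
        rintro ⟨h, _⟩
        exact ha (Sum.inr_injective h).symm
  · rw [Matrix.mul_single_apply_of_ne _ _ _ _ _ hb, Matrix.single_apply, if_neg]
    rintro ⟨_, h⟩
    exact hb h.symm

theorem InNplus.eMat_mul {Δ : Matrix (Idx m n) (Idx m n) (TSeries N)} (h : InNplus Δ) :
    eMat m n (Loop N) * Δ.map constLoop = eMat m n (Loop N) := by
  obtain ⟨D, h1, h2, rfl⟩ := h
  ext1 a b
  rw [eMat]
  by_cases ha : a = Sum.inr 0
  · subst ha
    rw [Matrix.single_mul_apply_same, one_mul, Matrix.map_apply]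
    rcases b with b | b
    · rw [fromBlocks_apply₂₁, Matrix.zero_apply, map_zero, Matrix.single_apply, if_neg (by simp)]
    · rw [fromBlocks_apply₂₂]
      by_cases hb : b = Fin.last (2 * n)
      · subst hb
        rw [h1, map_one, Matrix.single_apply_same]
      · rw [h2 _ _ (lt_of_le_of_ne (Fin.le_last b) hb), map_zero, Matrix.single_apply, if_neg]
        rintro ⟨_, h⟩
        exact hb (Sum.inr_injective h).symm
  · rw [Matrix.single_mul_apply_of_ne _ _ _ _ _ ha, Matrix.single_apply, if_neg]
    rintro ⟨h, _⟩
    exact ha h.symm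

theorem InNplus.sub_one_mem_pDeg {Δ : Matrix (Idx m n) (Idx m n) (TSeries N)} (h : InNplus Δ) :
    Δ.map constLoop - 1 ∈ pDeg m n N (-1) := by
  obtain ⟨D, h1, h2, rfl⟩ := h
  rintro (a | a) (b | b)
  · rw [Matrix.sub_apply, Matrix.map_apply, fromBlocks_apply₁₁, Matrix.one_apply, Matrix.one_apply]
    simp only [Sum.inl.injEq]
    split_ifs <;> simp [zero_mem]
  · rw [Matrix.sub_apply, Matrix.map_apply, fromBlocks_apply₁₂, Matrix.one_apply]
    simp [zero_mem]
  · rw [Matrix.sub_apply, Matrix.map_apply, fromBlocks_apply₂₁, Matrix.one_apply]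
    simp [zero_mem]
  · rw [Matrix.sub_apply, Matrix.map_apply, fromBlocks_apply₂₂, Matrix.one_apply]
    rcases lt_trichotomy a b with hab | hab | hab
    · rw [if_neg (by simp [hab.ne]), sub_zero]
      refine lamSupp_mono ?_ (constLoop_mem _)
      rintro _ rfl
      simp only [weight, Set.mem_ofPred_eq]
      have : (a : ℕ) < b := hab
      omega
    · subst hab
      rw [if_pos rfl, h1, map_one, sub_self]
      exact zero_mem _
    · rw [if_neg (by simp [hab.ne']), h2 _ _ hab, map_zero, sub_zero]
      exact zero_mem _

theorem mul_sub_one_mem_pDeg {X Y : Matrix (Idx m n) (Idx m n) (Loop N)}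
    (hX : X - 1 ∈ pDeg m n N (-1)) (hY : Y - 1 ∈ pDeg m n N (-1)) :
    X * Y - 1 ∈ pDeg m n N (-1) := by
  have h1 : X * Y - 1 = (X - 1) * (Y - 1) + (X - 1) + (Y - 1) := by noncomm_ring
  rw [h1]
  exact add_mem (add_mem (pDeg_mono (by norm_num) (mul_mem_pDeg hX hY)) hX) hY

/-! ### The dressed operator -/

/-- `∂_x + J + u = Q (∂_x + J) Q⁻¹` for the unit `Q`. -/
def IsDressing (Q : GL (Idx m n) (Loop N)) (V : Matrix (Idx m n) (Idx m n) (Loop N)) : Prop :=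
  Q.val.map (tDer 0) = Q.val * Jmat m n N - V * Q.val

theorem IsDressing.lax {Q : GL (Idx m n) (Loop N)} {V : Matrix (Idx m n) (Idx m n) (Loop N)}
    (h : IsDressing Q V) :
    (Q.val * Jmat m n N * (Q⁻¹).val).map (tDer 0) +
      (V * (Q.val * Jmat m n N * (Q⁻¹).val) - Q.val * Jmat m n N * (Q⁻¹).val * V) = 0 := by
  have hL := isLeibniz_tDer (N := N) 0
  have e1 : Q.val * (Q⁻¹).val = 1 := Units.mul_inv Q
  have e2 : (Q⁻¹).val * Q.val = 1 := Units.inv_mul Q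
  rw [map_der_mul hL, map_der_mul hL, map_tDer_Jmat, map_mul_inv_cancel hL, show Q.val.map _ = _ from h]
  generalize Q.val = q at *
  generalize (Q⁻¹).val = p at *
  have e3 : (q * Jmat m n N - V * q) * Jmat m n N * p + q * 0 * p = 
    q * Jmat m n N * Jmat m n N * p - V * (q * Jmat m n N * p) := by noncomm_ring
  have e4 : q * Jmat m n N * -(p * (q * Jmat m n N - V * q) * p) =
      -(q * Jmat m n N * (p * q) * Jmat m n N * p) + q * Jmat m n N * p * V * (q * p) := by
    noncomm_ring
  rw [add_mul, e3, e4, e1, e2]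
  noncomm_ring

/-- Undressing turns `[∂_x + V, S] = 0` into `[∂_x + J, Q⁻¹ S Q] = 0`. -/
theorem lax_conj {Q : GL (Idx m n) (Loop N)} {V S : Matrix (Idx m n) (Idx m n) (Loop N)}
    (h : IsDressing Q V) (hS : S.map (tDer 0) + (V * S - S * V) = 0) :
    ((Q⁻¹).val * S * Q.val).map (tDer 0) =
      (Q⁻¹).val * S * Q.val * Jmat m n N - Jmat m n N * ((Q⁻¹).val * S * Q.val) := by
  have hL := isLeibniz_tDer (N := N) 0
  have e2 : (Q⁻¹).val * Q.val = 1 := Units.inv_mul Q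
  have e1 : Q.val * (Q⁻¹).val = 1 := Units.mul_inv Q
  have hS' : S.map (tDer 0) = S * V - V * S := by
    rw [← sub_eq_zero, ← hS]; abel
  rw [map_der_mul hL, map_der_mul hL, map_mul_inv_cancel hL, hS', show Q.val.map _ = _ from h]
  generalize Q.val = q at *
  generalize (Q⁻¹).val = p at *
  have e3 : -(p * (q * Jmat m n N - V * q) * p) * S =
      -(p * q * Jmat m n N * p * S) + p * V * (q * p) * S := by noncomm_ring
  rw [e3, e1, e2]
  noncomm_ring

theorem IsDressing.unique {u : Matrix (Idx m n) (Idx m n) (TSeries N)} {Q : GL (Idx m n) (Loop N)}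
    (h : IsDressing Q (Jmat m n N + u.map constLoop)) (hQ : Q.val - 1 ∈ pDeg m n N (-1))
    (hQ' : (Q⁻¹).val - 1 ∈ pDeg m n N (-1))
    {S' : Matrix (Idx m n) (Idx m n) (Loop N)} (hS : IsS u S') :
    S' = Q.val * Jmat m n N * (Q⁻¹).val := by
  obtain ⟨hlax, Δ, M, hΔ, hM, hconj⟩ := hS
  obtain ⟨g, rfl, hg⟩ := hΔ.exists_unit
  set R : GL (Idx m n) (Loop N) := constGL g * M with hR
  have hRv : R.val = g.val.map constLoop * M.val := rfl
  have hRi : (R⁻¹).val = (M⁻¹).val * (g⁻¹).val.map constLoop := by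
    rw [hR, _root_.mul_inv_rev, ← map_inv]; rfl
  have hR1 : R.val - 1 ∈ pDeg m n N (-1) :=
    mul_sub_one_mem_pDeg hΔ.sub_one_mem_pDeg (mem_pDeg_of_neg hM.sub_one_mem)
  have hR2 : (R⁻¹).val - 1 ∈ pDeg m n N (-1) := by
    rw [hRi]
    exact mul_sub_one_mem_pDeg (mem_pDeg_of_neg hM.inv_sub_one_mem) hg.sub_one_mem_pDeg
  -- Both dressings are `1` plus terms of negative principal degree, hence so is their quotient, and
  -- conjugation by it changes `J` only in degree at most `0`.
  set K : GL (Idx m n) (Loop N) := Q⁻¹ * R with hK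
  have hK1 : K.val - 1 ∈ pDeg m n N (-1) := mul_sub_one_mem_pDeg hQ' hR1
  have hK2 : (K⁻¹).val - 1 ∈ pDeg m n N (-1) := by
    rw [hK, _root_.mul_inv_rev, inv_inv]; exact mul_sub_one_mem_pDeg hR2 hQ
  have hS' : S' = R.val * Jmat m n N * (R⁻¹).val := by
    rw [hRv, ← hconj, ← hRv, mul_assoc, Units.mul_inv, mul_one]
  set T := (Q⁻¹).val * S' * Q.val with hT
  have hTK : T = K.val * Jmat m n N * (K⁻¹).val := by
    have e1 : K.val = (Q⁻¹).val * R.val := rfl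
    have e2 : (K⁻¹).val = (R⁻¹).val * Q.val := by rw [hK, _root_.mul_inv_rev, inv_inv]; rfl
    rw [hT, hS', e1, e2]; noncomm_ring
  have hTJ : T - Jmat m n N ∈ pDeg m n N 0 := by
    have : T - Jmat m n N = (K.val - 1) * Jmat m n N * ((K⁻¹).val - 1) +
        (K.val - 1) * Jmat m n N + Jmat m n N * ((K⁻¹).val - 1) := by
      rw [hTK]; noncomm_ring
    rw [this]
    exact add_mem (add_mem
      (pDeg_mono (by norm_num) (mul_mem_pDeg (mul_mem_pDeg hK1 Jmat_mem_pDeg) hK2))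
      (pDeg_mono (by norm_num) (mul_mem_pDeg hK1 Jmat_mem_pDeg)))
      (pDeg_mono (by norm_num) (mul_mem_pDeg Jmat_mem_pDeg hK2))
  have hT1 : T ∈ pDeg m n N 1 := by
    have := add_mem (pDeg_mono zero_le_one hTJ) Jmat_mem_pDeg
    rwa [sub_add_cancel] at this
  have hcomm := commute_of_lax hT1 (lax_conj h hlax)
  have hpow : T ^ (2 * n + 1 + 1) = (lamPow 1 : Loop N) • T := by
    have : ∀ k : ℕ, T ^ k = K.val * Jmat m n N ^ k * (K⁻¹).val := by
      intro k
      rw [hTK]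
      exact Units.conj_pow K _ k
    rw [this, Jmat_pow_period, mul_smul_comm, smul_mul_assoc, ← hTK]
  have hfin := eq_Jmat_of_commute hTJ (sub_eq_zero.mp hcomm).symm hpow
  rw [← hfin, hT]
  calc S' = (Q.val * (Q⁻¹).val) * S' * (Q.val * (Q⁻¹).val) := by rw [Units.mul_inv, one_mul, mul_one]
    _ = _ := by noncomm_ring

/-- The gauge relation involves only `b`; adding `λ e_{2m+1,2m+2n+1}` to both sides is harmless
because `Δ` fixes this matrix from the left and from the right. -/
theorem gauge_loop {Δ q u : Matrix (Idx m n) (Idx m n) (TSeries N)} (hΔ : InNplus Δ)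
    (h : IsGauge Δ q u) :
    Δ.map constLoop * (Jmat m n N + q.map constLoop) =
      (Δ.map constLoop).map (tDer 0) + (Jmat m n N + u.map constLoop) * Δ.map constLoop := by
  have h1 := congrArg (fun X : Matrix (Idx m n) (Idx m n) (TSeries N) => X.map constLoop) h
  simp only [map_constLoop_mul, map_constLoop_add, map_constLoop_bMat] at h1
  have h2 : (Δ.map (MvPowerSeries.pderiv ℂ 0)).map constLoop =
      (Δ.map constLoop).map (tDer 0) := (map_tDer_constLoop 0 Δ).symm
  rw [h2] at h1
  have h3 : (lamPow 1 : Loop N) • eMat m n (Loop N) * Δ.map constLoop =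
      (lamPow 1 : Loop N) • eMat m n (Loop N) := by rw [smul_mul_assoc, hΔ.eMat_mul]
  rw [Jmat, add_assoc, add_assoc, mul_add, h1, add_mul (_ • _), mul_smul_comm, h3,
    hΔ.mul_eMat]
  abel

/-! ### The solution determined by `f` -/

/-- The data that determine the solution `u` of the hierarchy. -/
structure SolutionData (f : GL (Idx m n) (LaurentSeries ℂ)) (M E : GL (Idx m n) (Loop N))
    (q : Matrix (Idx m n) (Idx m n) (TSeries N)) (g : GL (Idx m n) (TSeries N))
    (u : Matrix (Idx m n) (Idx m n) (TSeries N)) : Prop where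
  fact : IsFactorization f M E
  plus : Jmat m n N + q.map constLoop = (M.val * Jmat m n N * (M⁻¹).val).map plusPart
  mem : InNplus g.val
  inv_mem : InNplus (g⁻¹).val
  gauge : IsGauge g.val q u

variable {f : GL (Idx m n) (LaurentSeries ℂ)} {M E : GL (Idx m n) (Loop N)}
    {q : Matrix (Idx m n) (Idx m n) (TSeries N)} {g : GL (Idx m n) (TSeries N)}
    {u : Matrix (Idx m n) (Idx m n) (TSeries N)}

theorem laxPow_zero : laxPow M 0 = M.val * Jmat m n N * (M⁻¹).val := by
  rw [laxPow, Fin.val_zero, mul_zero, zero_add, pow_one]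

/-- `M` dresses `∂_x + J` to `∂_x + J + q` by the Sato–Wilson equation for `x`, and `Δ` carries this
to `∂_x + J + u`. -/
theorem SolutionData.isDressing (h : SolutionData f M E q g u) :
    IsDressing (constGL g * M) (Jmat m n N + u.map constLoop) := by
  have h1 := h.fact.map_tDer_minus 0
  have h2 : (laxPow M 0).map minusPart =
      M.val * Jmat m n N * (M⁻¹).val - (Jmat m n N + q.map constLoop) := by
    rw [h.plus, ← laxPow_zero, eq_sub_iff_add_eq, add_comm, map_plus_add_map_minus]
  have h3 := gauge_loop h.mem h.gauge
  have h4 : (g.val.map constLoop).map (tDer 0) = g.val.map constLoop *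
      (Jmat m n N + q.map constLoop) - (Jmat m n N + u.map constLoop) * g.val.map constLoop := by
    rw [h3, add_sub_cancel_right]
  have e : (M⁻¹).val * M.val = 1 := Units.inv_mul M
  rw [h2] at h1
  rw [IsDressing, Units.val_mul, constGL_val, map_der_mul (isLeibniz_tDer 0), h1, h4]
  generalize Jmat m n N + q.map constLoop = A
  generalize Jmat m n N + u.map constLoop = B
  generalize g.val.map constLoop = D
  calc _ = D * A * M.val - B * D * M.val +
      (D * M.val * Jmat m n N * ((M⁻¹).val * M.val) - D * A * M.val) := by noncomm_ring
    _ = _ := by rw [e]; noncomm_ring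

/-- The operator `S(u, λ)`. -/
def dressed (g : GL (Idx m n) (TSeries N)) (M : GL (Idx m n) (Loop N)) :
    Matrix (Idx m n) (Idx m n) (Loop N) :=
  (constGL g * M).val * Jmat m n N * ((constGL g * M)⁻¹).val

theorem SolutionData.isS (h : SolutionData f M E q g u) : IsS u (dressed g M) := by
  refine ⟨h.isDressing.lax, g.val, M, h.mem, h.fact.1, ?_⟩
  change dressed g M * (constGL g * M).val = (constGL g * M).val * Jmat m n N
  rw [dressed, mul_assoc, Units.inv_mul, mul_one]

theorem SolutionData.unique (h : SolutionData f M E q g u)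
    {S' : Matrix (Idx m n) (Idx m n) (Loop N)} (hS : IsS u S') : S' = dressed g M := by
  refine h.isDressing.unique (mul_sub_one_mem_pDeg h.mem.sub_one_mem_pDeg
    (mem_pDeg_of_neg h.fact.1.sub_one_mem)) ?_ hS
  rw [_root_.mul_inv_rev, ← map_inv]
  exact mul_sub_one_mem_pDeg (mem_pDeg_of_neg h.fact.1.inv_sub_one_mem) h.inv_mem.sub_one_mem_pDeg

theorem dressed_pow (j : Fin (N + 1)) : dressed g M ^ (2 * (j : ℕ) + 1) =
    g.val.map constLoop * laxPow M j * (g⁻¹).val.map constLoop := by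
  have : dressed g M ^ (2 * (j : ℕ) + 1) = (constGL g * M).val * Jmat m n N ^ (2 * (j : ℕ) + 1) *
      ((constGL g * M)⁻¹).val := Units.conj_pow _ _ _
  rw [this, _root_.mul_inv_rev, ← map_inv, Units.val_mul, Units.val_mul, constGL_val, constGL_val, laxPow]
  noncomm_ring

theorem const_conj_mem {s : Set ℤ} {X : Matrix (Idx m n) (Idx m n) (Loop N)}
    (hX : X ∈ unifSupp (N := N) s) (Y Z : Matrix (Idx m n) (Idx m n) (TSeries N)) :
    Y.map constLoop * X * Z.map constLoop ∈ unifSupp (N := N) s := by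
  refine add_le_mul (s := s) ?_ (add_le_mul (t := s) ?_ (map_constLoop_mem Y) hX)
    (map_constLoop_mem Z)
  · rintro i hi _ rfl; simpa using hi
  · rintro _ rfl j hj; simpa using hj

/-- Factors free of `λ` respect both halves of the splitting. -/
theorem map_plusPart_conj (X : Matrix (Idx m n) (Idx m n) (Loop N))
    (Y Z : Matrix (Idx m n) (Idx m n) (TSeries N)) :
    (Y.map constLoop * X * Z.map constLoop).map plusPart =
      Y.map constLoop * X.map plusPart * Z.map constLoop := by
  refine (splitting_unique (map_plusPart_mem _) (const_conj_mem (map_plusPart_mem X) Y Z)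
    (map_minusPart_mem (Y.map constLoop * X * Z.map constLoop))
    (const_conj_mem (map_minusPart_mem X) Y Z) ?_).1
  rw [map_plus_add_map_minus]
  conv_lhs => rw [← map_plus_add_map_minus X]
  rw [mul_add, add_mul]

theorem map_plusPart_dressed_pow (j : Fin (N + 1)) :
    (dressed g M ^ (2 * (j : ℕ) + 1)).map plusPart =
      g.val.map constLoop * (laxPow M j).map plusPart * (g⁻¹).val.map constLoop := by
  rw [dressed_pow, map_plusPart_conj]

theorem tDer_comm (i j : Fin (N + 1)) (a : Loop N) : tDer i (tDer j a) = tDer j (tDer i a) := by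
  have h : ∀ (k : Fin (N + 1)) (b : Loop N) (d : Fin (N + 1) →₀ ℕ), MvPowerSeries.coeff d (tDer k b) =
      MvPowerSeries.coeff (d + Finsupp.single k 1) b * (d k + 1) :=
    fun k b d => MvPowerSeries.coeff_pderiv b d
  by_cases hij : i = j
  · rw [hij]
  ext1 d
  rw [h, h, h, h, add_right_comm, Finsupp.add_apply, Finsupp.add_apply,
    Finsupp.single_eq_of_ne hij, Finsupp.single_eq_of_ne (Ne.symm hij), add_zero, add_zero]
  ring

/-- `Δ E` serves as the wave because its logarithmic derivatives have only nonnegative powers of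
`λ`. -/
theorem SolutionData.map_tDer_wave (h : SolutionData f M E q g u) :
    (constGL g * E).val.map (tDer 0) = -((Jmat m n N + u.map constLoop) * (constGL g * E).val) := by
  have h1 := h.fact.map_tDer_plus 0
  rw [laxPow_zero, ← h.plus] at h1
  have h3 := gauge_loop h.mem h.gauge
  have h4 : (g.val.map constLoop).map (tDer 0) = g.val.map constLoop *
      (Jmat m n N + q.map constLoop) - (Jmat m n N + u.map constLoop) * g.val.map constLoop := by
    rw [h3, add_sub_cancel_right]
  rw [Units.val_mul, constGL_val, map_der_mul (isLeibniz_tDer 0), h1, h4]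
  noncomm_ring

/-- `(S^{2j+1})_+ - Δ_t Δ⁻¹`. -/
def flowMat (g : GL (Idx m n) (TSeries N)) (M : GL (Idx m n) (Loop N)) (j : Fin (N + 1)) :
    Matrix (Idx m n) (Idx m n) (Loop N) :=
  (dressed g M ^ (2 * (j : ℕ) + 1)).map plusPart +
    (-(g.val.map (sDer j) * (g⁻¹).val)).map constLoop

theorem SolutionData.map_tDer_wave' (h : SolutionData f M E q g u) (j : Fin (N + 1)) :
    (constGL g * E).val.map (tDer j) = -(flowMat g M j * (constGL g * E).val) := by
  have h1 := h.fact.map_tDer_plus j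
  have e : (g⁻¹).val.map constLoop * g.val.map (constLoop (N := N)) = 1 :=
    Units.inv_mul (constGL g)
  have e2 : (-(g.val.map (sDer j) * (g⁻¹).val)).map constLoop =
      -((g.val.map constLoop).map (tDer j) * (g⁻¹).val.map constLoop) := by
    rw [map_tDer_constLoop, ← map_constLoop_mul]
    ext1 a b
    exact map_neg constLoop _
  rw [flowMat, e2, map_plusPart_dressed_pow, Units.val_mul, constGL_val,
    map_der_mul (isLeibniz_tDer j), h1]
  generalize (g.val.map constLoop).map (tDer j) = D' at *
  generalize g.val.map (constLoop (N := N)) = D at *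
  generalize (g⁻¹).val.map (constLoop (N := N)) = D1 at *
  generalize (laxPow M j).map plusPart = L at *
  calc D' * E.val + D * -(L * E.val) = D' * 1 * E.val - D * L * 1 * E.val := by noncomm_ring
    _ = D' * (D1 * D) * E.val - D * L * (D1 * D) * E.val := by rw [e]
    _ = _ := by noncomm_ring

/-- Compare the two mixed derivatives of `Δ E` and cancel this invertible matrix. -/
theorem SolutionData.zero_curvature (h : SolutionData f M E q g u) (j : Fin (N + 1)) :
    (u.map constLoop).map (tDer j) = (flowMat g M j).map (tDer 0) +
      ((Jmat m n N + u.map constLoop) * flowMat g M j -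
        flowMat g M j * (Jmat m n N + u.map constLoop)) := by
  have hc : ((constGL g * E).val.map (tDer 0)).map (tDer j) =
      ((constGL g * E).val.map (tDer j)).map (tDer 0) := by
    ext1 a b; exact tDer_comm _ _ _
  have hn : ∀ (i : Fin (N + 1)) (X : Matrix (Idx m n) (Idx m n) (Loop N)),
      (-X).map (tDer i) = -(X.map (tDer i)) := by
    intro i X; ext1 a b; exact map_neg (tDer i) _
  rw [h.map_tDer_wave, h.map_tDer_wave' j, hn, hn, map_der_mul (isLeibniz_tDer j),
    map_der_mul (isLeibniz_tDer 0), h.map_tDer_wave, h.map_tDer_wave' j, map_der_add, map_tDer_Jmat,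
    zero_add] at hc
  generalize (u.map constLoop).map (tDer j) = U at *
  generalize Jmat m n N + u.map constLoop = V at *
  generalize (flowMat g M j).map (tDer 0) = B' at *
  generalize flowMat g M j = B at *
  have h2 : (U - (B' + (V * B - B * V))) * (constGL g * E).val = 0 := by
    calc _ = (U * (constGL g * E).val + V * -(B * (constGL g * E).val)) -
        (B' * (constGL g * E).val + B * -(V * (constGL g * E).val)) := by noncomm_ring
      _ = 0 := by rw [neg_inj.mp hc, sub_self]
  rw [Units.mul_left_eq_zero] at h2
  exact sub_eq_zero.mp h2

theorem map_lamCoeff_const_mul (k : ℤ) (X : Matrix (Idx m n) (Idx m n) (TSeries N))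
    (Y : Matrix (Idx m n) (Idx m n) (Loop N)) :
    (X.map constLoop * Y).map (lamCoeff k) = X * Y.map (lamCoeff k) := by
  ext1 a b
  rw [Matrix.map_apply, Matrix.mul_apply, Matrix.mul_apply, lamCoeff_sum]
  exact Finset.sum_congr rfl fun c _ => lamCoeff_constLoop_mul _ _ _

theorem map_lamCoeff_mul_const (k : ℤ) (X : Matrix (Idx m n) (Idx m n) (TSeries N))
    (Y : Matrix (Idx m n) (Idx m n) (Loop N)) :
    (Y * X.map constLoop).map (lamCoeff k) = Y.map (lamCoeff k) * X := by
  ext1 a b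
  rw [Matrix.map_apply, Matrix.mul_apply, Matrix.mul_apply, lamCoeff_sum]
  refine Finset.sum_congr rfl fun c _ => ?_
  rw [mul_comm, Matrix.map_apply, lamCoeff_constLoop_mul, mul_comm, Matrix.map_apply]

theorem flowMat_mem (j : Fin (N + 1)) : flowMat g M j ∈ unifSupp (N := N) (Set.Ici 0) :=
  add_mem (map_plusPart_mem _) (unifSupp_mono zero_subset_Ici (map_constLoop_mem _))

theorem map_lamCoeff_add (k : ℤ) (X Y : Matrix (Idx m n) (Idx m n) (Loop N)) :
    (X + Y).map (lamCoeff k) = X.map (lamCoeff k) + Y.map (lamCoeff k) := by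
  ext1 a b; exact lamCoeff_add _ _ _

theorem map_lamCoeff_sub (k : ℤ) (X Y : Matrix (Idx m n) (Idx m n) (Loop N)) :
    (X - Y).map (lamCoeff k) = X.map (lamCoeff k) - Y.map (lamCoeff k) := by
  ext1 a b; exact lamCoeff_sub _ _ _

theorem map_lamCoeff_constLoop (X : Matrix (Idx m n) (Idx m n) (TSeries N)) :
    (X.map constLoop).map (lamCoeff 0) = X := by
  ext1 a b; exact (lamCoeff_constLoop 0 _).trans (if_pos rfl)

theorem lamPow_eMat_mem : (lamPow 1 : Loop N) • eMat m n (Loop N) ∈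
    unifSupp (N := N) ({1} : Set ℤ) := by
  refine smul_mem_matSupp (t := fun _ _ => {0}) ?_ (lamPow_mem 1) ?_
  · rintro _ _ _ rfl _ rfl; simp
  · intro a b
    rw [eMat, Matrix.single_apply]
    split_ifs
    · exact one_mem_lamSupp
    · exact zero_mem _

theorem map_lamCoeff_eq_zero {s : Set ℤ} {X : Matrix (Idx m n) (Idx m n) (Loop N)}
    (hX : X ∈ unifSupp (N := N) s) {k : ℤ} (hk : k ∉ s) : X.map (lamCoeff k) = 0 := by
  ext1 a b; exact hX a b k hk

theorem SolutionData.solves (h : SolutionData f M E q g u) (hu : InV u) :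
    SolvesHierarchy u (dressed g M) := by
  refine ⟨hu, fun j => ⟨-(g.val.map (sDer j) * (g⁻¹).val), ?_,
    (flowMat g M j).map (lamCoeff 0), ?_, ?_⟩⟩
  · obtain ⟨D, hD1, hD2, hD⟩ := h.mem
    obtain ⟨D', _, hD2', hD'⟩ := h.inv_mem
    refine ⟨-(D.map (sDer j) * D'), fun i k hki => ?_, ?_⟩
    -- The diagonal entries of `Δ` are constant, so `Δ_t` is strictly upper triangular, and so is
    -- its product with the upper triangular `Δ⁻¹`.
    · rw [Matrix.neg_apply, Matrix.mul_apply, neg_eq_zero]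
      refine Finset.sum_eq_zero fun l _ => ?_
      rw [Matrix.map_apply]
      rcases lt_trichotomy l i with hl | hl | hl
      · rw [hD2 _ _ hl, map_zero, zero_mul]
      · rw [hl, hD1, (isLeibniz_sDer j).map_one, zero_mul]
      · rw [hD2' _ _ (lt_of_le_of_lt hki hl), mul_zero]
    · have h1 : (fromBlocks 1 0 0 D).map (sDer j) =
          fromBlocks (0 : Matrix (Fin (2 * m)) (Fin (2 * m)) (TSeries N)) 0 0 (D.map (sDer j)) := by
        rw [fromBlocks_map, map_der_one (isLeibniz_sDer j)]
        congr 1 <;> ext1 a b <;> exact map_zero (sDer j)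
      rw [hD, hD', h1, fromBlocks_multiply, fromBlocks_neg]
      simp
  · rw [flowMat, map_lamCoeff_add, map_lamCoeff_constLoop]
    congr 1
  · have h1 := congrArg (fun X : Matrix (Idx m n) (Idx m n) (Loop N) => X.map (lamCoeff 0))
      (h.zero_curvature j)
    have e1 : ((u.map constLoop).map (tDer j)).map (lamCoeff 0) =
        u.map (MvPowerSeries.pderiv ℂ j) := by
      rw [map_tDer_constLoop, map_lamCoeff_constLoop]; rfl
    have e2 : ((flowMat g M j).map (tDer 0)).map (lamCoeff 0) =
        ((flowMat g M j).map (lamCoeff 0)).map (MvPowerSeries.pderiv ℂ 0) := by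
      ext1 a b; exact lamCoeff_tDer _ _ _
    have e3 : Jmat m n N + u.map constLoop = (lamPow 1 : Loop N) • eMat m n (Loop N) +
        (bMat m n (TSeries N) + u).map constLoop := by
      rw [Jmat, map_constLoop_add, map_constLoop_bMat, add_assoc]
    -- `flowMat` has no negative powers, so its products with the `λ`-part of `J` start at `λ^1` and
    -- do not reach `λ^0`.
    have e4 : ((lamPow 1 : Loop N) • eMat m n (Loop N) * flowMat g M j).map (lamCoeff 0) = 0 := by
      refine map_lamCoeff_eq_zero (s := Set.Ici 1) (add_le_mul ?_ lamPow_eMat_mem (flowMat_mem j))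
        (by simp)
      rintro _ rfl i hi
      simp only [Set.mem_Ici] at *
      omega
    have e5 : (flowMat g M j * (lamPow 1 : Loop N) • eMat m n (Loop N)).map (lamCoeff 0) = 0 := by
      refine map_lamCoeff_eq_zero (s := Set.Ici 1) (add_le_mul ?_ (flowMat_mem j) lamPow_eMat_mem)
        (by simp)
      rintro i hi _ rfl
      simp only [Set.mem_Ici] at *
      omega
    rw [e3, add_mul, mul_add] at h1
    simp only [map_lamCoeff_add, map_lamCoeff_sub, map_lamCoeff_const_mul, map_lamCoeff_mul_const,
      e1, e2, e4, e5, zero_add] at h1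
    exact h1

end

/-! ### Compressions to `H₋`, finite sections and the derivative of the determinant. -/

section

variable {m n N : ℕ}

/-! ### Operators on `H_-` -/

/-- Vector loops with only powers `λ^k`, `k ∈ s`. -/
def vecSupp (m n N : ℕ) (s : Set ℤ) : AddSubgroup (Idx m n → Loop N) where
  carrier := {v | ∀ a, v a ∈ lamSupp s}
  add_mem' hv hw a := add_mem (hv a) (hw a)
  zero_mem' _ := zero_mem _
  neg_mem' hv a := neg_mem (hv a)

theorem mulVec_mem_vecSupp {s t u : Set ℤ} (h : ∀ i ∈ s, ∀ j ∈ t, i + j ∈ u)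
    {X : Matrix (Idx m n) (Idx m n) (Loop N)} {v : Idx m n → Loop N}
    (hX : X ∈ unifSupp (N := N) s) (hv : v ∈ vecSupp m n N t) : X *ᵥ v ∈ vecSupp m n N u := by
  intro a
  rw [Matrix.mulVec, dotProduct]
  exact sum_mem fun b _ => mul_mem_lamSupp h (hX a b) (hv b)

theorem isNeg_iff {v : Idx m n → Loop N} : IsNeg v ↔ v ∈ vecSupp m n N (Set.Iio 0) := by
  refine ⟨fun h a => ?_, fun h a => plusPart_eq_zero (h a)⟩
  rw [← plusPart_add_minusPart (v a), h a, zero_add]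
  exact minusPart_mem _

theorem compress_mem (g : Matrix (Idx m n) (Idx m n) (Loop N)) (v : Idx m n → Loop N) :
    compress g v ∈ vecSupp m n N (Set.Iio 0) := fun _ => minusPart_mem _

theorem compress_eq_mulVec {g : Matrix (Idx m n) (Idx m n) (Loop N)} {v : Idx m n → Loop N}
    (h : g *ᵥ v ∈ vecSupp m n N (Set.Iio 0)) : compress g v = g *ᵥ v := by
  ext1 a; exact minusPart_eq_self (h a)

theorem compress_of_minus {g : Matrix (Idx m n) (Idx m n) (Loop N)} {v : Idx m n → Loop N}
    (hg : g ∈ unifSupp (N := N) (Set.Iic 0)) (hv : v ∈ vecSupp m n N (Set.Iio 0)) :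
    compress g v = g *ᵥ v :=
  compress_eq_mulVec (mulVec_mem_vecSupp Iic_add_Iio hg hv)

theorem compress_add_vec (g : Matrix (Idx m n) (Idx m n) (Loop N)) (v w : Idx m n → Loop N) :
    compress g (v + w) = compress g v + compress g w := by
  ext1 a
  rw [compress, Matrix.mulVec_add]
  exact map_add minusHom _ _

theorem compress_sub_vec (g : Matrix (Idx m n) (Idx m n) (Loop N)) (v w : Idx m n → Loop N) :
    compress g (v - w) = compress g v - compress g w := by
  ext1 a
  rw [compress, Matrix.mulVec_sub]
  exact map_sub minusHom _ _

theorem compress_neg_mat (g : Matrix (Idx m n) (Idx m n) (Loop N)) (v : Idx m n → Loop N) :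
    compress (-g) v = -compress g v := by
  ext1 a
  rw [compress, Matrix.neg_mulVec]
  exact map_neg minusHom _

theorem compress_of_plus_vec {g : Matrix (Idx m n) (Idx m n) (Loop N)} {v : Idx m n → Loop N}
    (hg : g ∈ unifSupp (N := N) (Set.Ici 0)) (hv : v ∈ vecSupp m n N (Set.Ici 0)) :
    compress g v = 0 := by
  ext1 a
  exact minusPart_eq_zero (mulVec_mem_vecSupp Ici_add_Ici hg hv a)

/-- On the left, `d(g h) = d(g) d(h)` for `g` without negative powers. -/
theorem compress_compress {g : Matrix (Idx m n) (Idx m n) (Loop N)}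
    (hg : g ∈ unifSupp (N := N) (Set.Ici 0)) (h : Matrix (Idx m n) (Idx m n) (Loop N))
    (v : Idx m n → Loop N) : compress g (compress h v) = compress (g * h) v := by
  have h1 : h *ᵥ v - compress h v ∈ vecSupp m n N (Set.Ici 0) := by
    intro a
    have : (h *ᵥ v - compress h v) a = plusPart ((h *ᵥ v) a) := by
      rw [Pi.sub_apply, sub_eq_iff_eq_add]
      exact (plusPart_add_minusPart _).symm
    rw [this]
    exact plusPart_mem _
  have h2 := compress_of_plus_vec hg h1
  rw [compress_sub_vec, sub_eq_zero] at h2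
  rw [← h2]
  ext1 a
  rw [compress, compress, Matrix.mulVec_mulVec]

theorem minusPart_constLoop_mul (c : TSeries N) (x : Loop N) :
    minusPart (constLoop c * x) = constLoop c * minusPart x := by
  apply ext_lamCoeff; intro k
  rw [lamCoeff_minusPart, lamCoeff_constLoop_mul, lamCoeff_constLoop_mul, lamCoeff_minusPart]
  split_ifs <;> simp

theorem compress_smul (g : Matrix (Idx m n) (Idx m n) (Loop N)) (c : TSeries N)
    (v : Idx m n → Loop N) : compress g (constLoop c • v) = constLoop c • compress g v := by
  ext1 a
  rw [compress, Matrix.mulVec_smul]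
  exact minusPart_constLoop_mul c _

/-- `compress g` as an additive map. -/
def compressHom (g : Matrix (Idx m n) (Idx m n) (Loop N)) :
    (Idx m n → Loop N) →+ (Idx m n → Loop N) where
  toFun := compress g
  map_zero' := by
    have := compress_sub_vec g 0 0
    rwa [sub_self, sub_self] at this
  map_add' := compress_add_vec g

/-- Vector loops with entries of order greater than `D` in the times. -/
def vecIdeal (m n N D : ℕ) : AddSubgroup (Idx m n → Loop N) where
  carrier := {v | ∀ a, v a ∈ tIdeal N (LaurentSeries ℂ) D}
  add_mem' hv hw a := add_mem (hv a) (hw a)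
  zero_mem' _ := zero_mem _
  neg_mem' hv a := neg_mem (hv a)

theorem minusPart_mem_tIdeal {D : ℕ} {x : Loop N} (h : x ∈ tIdeal N (LaurentSeries ℂ) D) :
    minusPart x ∈ tIdeal N (LaurentSeries ℂ) D := by
  refine mem_tIdeal_of_lamCoeff fun k => ?_
  rw [lamCoeff_minusPart]
  split_ifs
  · exact lamCoeff_mem_tIdeal k h
  · exact zero_mem _

theorem mulVec_mem_vecIdeal {D : ℕ} (X : Matrix (Idx m n) (Idx m n) (Loop N))
    {v : Idx m n → Loop N} (hv : v ∈ vecIdeal m n N D) : X *ᵥ v ∈ vecIdeal m n N D := by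
  intro a
  rw [Matrix.mulVec, dotProduct]
  exact sum_mem fun b _ => Ideal.mul_mem_left _ _ (hv b)

theorem compress_mem_vecIdeal {D : ℕ} (X : Matrix (Idx m n) (Idx m n) (Loop N))
    {v : Idx m n → Loop N} (hv : v ∈ vecIdeal m n N D) : compress X v ∈ vecIdeal m n N D :=
  fun a => minusPart_mem_tIdeal (mulVec_mem_vecIdeal X hv a)

/-- The powers of `λ` in `X` are bounded by `P`, up to terms of order greater than `D` in `t`. -/
def BoundedMod (D : ℕ) (P : ℤ) (X : Matrix (Idx m n) (Idx m n) (Loop N)) : Prop :=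
  ∀ a b, ∀ k, P < k → lamCoeff k (X a b) ∈ tIdeal N ℂ D

/-- Each coefficient in `t` is a Laurent series bounded above in `λ`, and there are finitely many
coefficients of degree at most `D`. No bound holds for all orders in `t` at once. -/
theorem exists_boundedMod (D : ℕ) (X : Matrix (Idx m n) (Idx m n) (Loop N)) :
    ∃ P : ℕ, BoundedMod D P X := by
  have hfin : Finite {d : Fin (N + 1) →₀ ℕ | d.degree ≤ D} := Finsupp.finite_of_degree_le D
  choose B hB using fun p : Idx m n × Idx m n × {d : Fin (N + 1) →₀ ℕ | d.degree ≤ D} =>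
    exists_coeff_eq_zero (MvPowerSeries.coeff p.2.2.1 (X p.1 p.2.1))
  obtain ⟨P, hP⟩ := Set.finite_range (fun p => (-B p).toNat) |>.bddAbove
  refine ⟨P, fun a b k hk d hd => ?_⟩
  rw [coeff_lamCoeff]
  refine hB (a, b, ⟨d, hd⟩) _ ?_
  have h1 : (-B (a, b, ⟨d, hd⟩)).toNat ≤ P := hP ⟨(a, b, ⟨d, hd⟩), rfl⟩
  omega

theorem BoundedMod.exists_split {D : ℕ} {P : ℤ} {X : Matrix (Idx m n) (Idx m n) (Loop N)}
    (h : BoundedMod D P X) : ∃ X₁ X₂ : Matrix (Idx m n) (Idx m n) (Loop N), X = X₁ + X₂ ∧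
      X₁ ∈ unifSupp (N := N) (Set.Iic P) ∧ ∀ a b, X₂ a b ∈ tIdeal N (LaurentSeries ℂ) D := by
  -- Shifting by `λ^{P+1}` moves the cut of the splitting from `0` to `P + 1`.
  refine ⟨of fun a b => lamPow (P + 1) * minusPart (lamPow (-(P + 1)) * X a b),
    of fun a b => lamPow (P + 1) * plusPart (lamPow (-(P + 1)) * X a b), ?_, fun a b => ?_,
    fun a b => ?_⟩
  · ext1 a b
    rw [Matrix.add_apply, of_apply, of_apply, ← mul_add, add_comm (minusPart _) (plusPart _),
      plusPart_add_minusPart, ← mul_assoc, ← lamPow_add, add_neg_cancel, lamPow_zero, one_mul]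
  · refine mul_mem_lamSupp ?_ (lamPow_mem _) (minusPart_mem _)
    rintro _ rfl i hi
    simp only [Set.mem_Iio, Set.mem_Iic] at *
    omega
  · refine Ideal.mul_mem_left _ _ (mem_tIdeal_of_lamCoeff fun k => ?_)
    rw [lamCoeff_plusPart]
    split_ifs with hk
    · rw [lamCoeff_lamPow_mul]
      exact h a b _ (by omega)
    · exact zero_mem _

theorem BoundedMod.compress_sub {D : ℕ} {P : ℤ} {X : Matrix (Idx m n) (Idx m n) (Loop N)}
    (h : BoundedMod D P X) {w : Idx m n → Loop N} (hw : w ∈ vecSupp m n N (Set.Iio (-P))) :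
    compress X w - X *ᵥ w ∈ vecIdeal m n N D := by
  obtain ⟨X₁, X₂, rfl, h1, h2⟩ := h.exists_split
  have e1 : X₁ *ᵥ w ∈ vecSupp m n N (Set.Iio 0) := by
    refine mulVec_mem_vecSupp ?_ h1 hw
    intro i hi j hj
    simp only [Set.mem_Iio, Set.mem_Iic] at *
    omega
  have e2 : X₂ *ᵥ w ∈ vecIdeal m n N D := by
    intro a
    rw [Matrix.mulVec, dotProduct]
    exact sum_mem fun b _ => Ideal.mul_mem_right _ _ (h2 a b)
  intro a
  have e3 : (compress (X₁ + X₂) w - (X₁ + X₂) *ᵥ w) a =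
      minusPart ((X₂ *ᵥ w) a) - (X₂ *ᵥ w) a := by
    have : compress (X₁ + X₂) w a = minusPart ((X₁ *ᵥ w) a) + minusPart ((X₂ *ᵥ w) a) := by
      rw [compress, Matrix.add_mulVec]
      exact map_add minusHom _ _
    rw [Pi.sub_apply, this, Matrix.add_mulVec, Pi.add_apply, minusPart_eq_self (e1 a)]
    ring
  rw [e3]
  exact sub_mem (minusPart_mem_tIdeal (e2 a)) (e2 a)

/-- The operator `d(a) d(a⁻¹)` on `H_-`. -/
def tauOp (a : GL (Idx m n) (Loop N)) : (Idx m n → Loop N) →+ (Idx m n → Loop N) :=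
  (compressHom a.val).comp (compressHom (a⁻¹).val)

theorem tauOp_apply (a : GL (Idx m n) (Loop N)) (v : Idx m n → Loop N) :
    tauOp a v = compress a.val (compress (a⁻¹).val v) := rfl

theorem tauOp_smul (a : GL (Idx m n) (Loop N)) (c : TSeries N) (v : Idx m n → Loop N) :
    tauOp a (constLoop c • v) = constLoop c • tauOp a v := by
  rw [tauOp_apply, tauOp_apply, compress_smul, compress_smul]

/-- If all powers in `w` are below `-P`, then `a⁻¹ w` already lies in `H₋` modulo high order in `t`.
The inner projection does nothing and `a a⁻¹ w = w` remains. -/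
theorem tauOp_sub_mem {a : GL (Idx m n) (Loop N)} {D P : ℕ} (h : BoundedMod D P (a⁻¹).val)
    {w : Idx m n → Loop N} (hw : w ∈ vecSupp m n N (Set.Iio (-(P : ℤ)))) :
    tauOp a w - w ∈ vecIdeal m n N D := by
  have h1 := compress_mem_vecIdeal a.val (h.compress_sub hw)
  have hneg : w ∈ vecSupp m n N (Set.Iio 0) := fun b => lamSupp_mono
    (fun k hk => by simp only [Set.mem_Iio] at *; omega) (hw b)
  have e : a.val *ᵥ ((a⁻¹).val *ᵥ w) = w := by
    rw [Matrix.mulVec_mulVec, Units.mul_inv, Matrix.one_mulVec]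
  have h2 : compress a.val ((a⁻¹).val *ᵥ w) = w := by
    rw [compress_eq_mulVec (by rw [e]; exact hneg), e]
  rwa [compress_sub_vec, h2] at h1

/-! ### Coordinates on `H_-` -/

/-- The coordinate of `λ^{-(k+1)} e_b`. -/
def coord (p : ℕ × Idx m n) : (Idx m n → Loop N) →+ TSeries N :=
  (lamCoeffHom (-((p.1 : ℤ) + 1))).comp (Pi.evalAddMonoidHom _ p.2)

theorem coord_apply (p : ℕ × Idx m n) (v : Idx m n → Loop N) :
    coord p v = lamCoeff (-((p.1 : ℤ) + 1)) (v p.2) := rfl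

theorem coord_smul (p : ℕ × Idx m n) (c : TSeries N) (v : Idx m n → Loop N) :
    coord p (constLoop c • v) = c * coord p v := lamCoeff_constLoop_mul _ _ _

theorem lamCoeff_negBasis (k : ℤ) (q : ℕ × Idx m n) (a : Idx m n) :
    lamCoeff k (negBasis (N := N) q a) = if k = -((q.1 : ℤ) + 1) ∧ a = q.2 then 1 else 0 := by
  rw [negBasis]
  by_cases ha : a = q.2
  · subst ha
    rw [Pi.single_eq_same, lamCoeff_lamPow]
    simp
  · rw [Pi.single_eq_of_ne ha, lamCoeff_zero, if_neg (fun h => ha h.2)]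

theorem coord_negBasis (p q : ℕ × Idx m n) :
    coord p (negBasis (N := N) q) = if p = q then 1 else 0 := by
  rw [coord_apply, lamCoeff_negBasis]
  congr 1
  rw [Prod.ext_iff]
  simp

theorem negBasis_mem (q : ℕ × Idx m n) :
    negBasis q ∈ vecSupp m n N {-((q.1 : ℤ) + 1)} := by
  intro a k hk
  rw [lamCoeff_negBasis, if_neg]
  exact fun h => hk h.1

theorem coord_compress (p : ℕ × Idx m n) (g : Matrix (Idx m n) (Idx m n) (Loop N))
    (v : Idx m n → Loop N) : coord p (compress g v) = coord p (g *ᵥ v) := by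
  rw [coord_apply, coord_apply, compress, lamCoeff_minusPart, if_pos (by omega)]

theorem coord_mem_tIdeal {D : ℕ} (p : ℕ × Idx m n) {v : Idx m n → Loop N}
    (hv : v ∈ vecIdeal m n N D) : coord p v ∈ tIdeal N ℂ D := lamCoeff_mem_tIdeal _ (hv _)

theorem coord_eq_zero {s : Set ℤ} {p : ℕ × Idx m n} (hp : -((p.1 : ℤ) + 1) ∉ s)
    {v : Idx m n → Loop N} (hv : v ∈ vecSupp m n N s) : coord p v = 0 := hv _ _ hp

/-- The index of a basis vector in the finite section of size `K`. -/
def secIdx {K : ℕ} (p : Fin K × Idx m n) : ℕ × Idx m n := ((p.1 : ℕ), p.2)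

theorem secIdx_injective {K : ℕ} : Function.Injective (secIdx (m := m) (n := n) (K := K)) := by
  rintro ⟨i, a⟩ ⟨j, b⟩ h
  rw [secIdx, secIdx, Prod.mk.injEq] at h
  exact Prod.ext (Fin.ext h.1) h.2

/-- The projection of `v` to the span of the first basis vectors. -/
def head (K : ℕ) (v : Idx m n → Loop N) : Idx m n → Loop N :=
  ∑ p : Fin K × Idx m n, constLoop (coord (secIdx p) v) • negBasis (secIdx p)

/-- The remainder of `v`. -/
def tail (K : ℕ) (v : Idx m n → Loop N) : Idx m n → Loop N := v - head K v

theorem head_add_tail (K : ℕ) (v : Idx m n → Loop N) : head K v + tail K v = v :=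
  add_sub_cancel _ _

theorem coord_head {K : ℕ} (p : Fin K × Idx m n) (v : Idx m n → Loop N) :
    coord (secIdx p) (head K v) = coord (secIdx p) v := by
  rw [head, map_sum, Finset.sum_eq_single p]
  · rw [coord_smul, coord_negBasis, if_pos rfl, mul_one]
  · intro q _ hq
    rw [coord_smul, coord_negBasis, if_neg (fun h => hq (secIdx_injective h).symm), mul_zero]
  · simp

/-- The first `K` levels of the basis are `λ⁻¹, …, λ^{-K}`, so what remains starts at `λ^{-K-1}`. -/
theorem tail_mem (K : ℕ) {v : Idx m n → Loop N} (hv : v ∈ vecSupp m n N (Set.Iio 0)) :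
    tail K v ∈ vecSupp m n N (Set.Iio (-(K : ℤ))) := by
  intro a k hk
  have hk : -(K : ℤ) ≤ k := by simpa using hk
  by_cases h0 : 0 ≤ k
  · have hh : head K v ∈ vecSupp m n N (Set.Iio 0) := by
      refine sum_mem fun p _ b => ?_
      refine mul_mem_lamSupp ?_ (constLoop_mem _) (negBasis_mem (secIdx p) b)
      rintro _ rfl _ rfl
      simp only [Set.mem_Iio]
      omega
    exact sub_mem hv hh a k (by simpa using h0)
  · have hk' : (-k - 1).toNat < K := by omega
    have h1 := coord_head (K := K) (⟨(-k - 1).toNat, hk'⟩, a) v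
    rw [coord_apply, coord_apply] at h1
    have h2 : -(((secIdx ((⟨(-k - 1).toNat, hk'⟩ : Fin K), a)).1 : ℤ) + 1) = k := by
      rw [secIdx]; simp only; omega
    rw [h2] at h1
    rw [tail, Pi.sub_apply, lamCoeff_sub, sub_eq_zero]
    exact h1.symm

theorem coord_tail {K : ℕ} (p : Fin K × Idx m n) (v : Idx m n → Loop N) :
    coord (secIdx p) (tail K v) = 0 := by
  rw [tail, map_sub, coord_head, sub_self]

/-- The finite section of the matrix of `tauOp`. -/
def sec (K : ℕ) (T : (Idx m n → Loop N) → (Idx m n → Loop N)) :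
    Matrix (Fin K × Idx m n) (Fin K × Idx m n) (TSeries N) :=
  of fun p q => coord (secIdx p) (T (negBasis (secIdx q)))

theorem coord_mulVec_head {K : ℕ} (p : ℕ × Idx m n) (X : Matrix (Idx m n) (Idx m n) (Loop N))
    (v : Idx m n → Loop N) : coord p (X *ᵥ head K v) =
      ∑ s : Fin K × Idx m n, coord p (X *ᵥ negBasis (secIdx s)) * coord (secIdx s) v := by
  have : X *ᵥ head K v = ∑ s : Fin K × Idx m n,
      constLoop (coord (secIdx s) v) • (X *ᵥ negBasis (secIdx s)) := by
    rw [head, Matrix.mulVec_sum]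
    exact Finset.sum_congr rfl fun s _ => Matrix.mulVec_smul _ _ _
  rw [this, map_sum]
  exact Finset.sum_congr rfl fun s _ => by rw [coord_smul, mul_comm]

theorem coord_tauOp_head {K : ℕ} (p : ℕ × Idx m n) (a : GL (Idx m n) (Loop N))
    (v : Idx m n → Loop N) : coord p (tauOp a (head K v)) =
      ∑ s : Fin K × Idx m n, coord p (tauOp a (negBasis (secIdx s))) * coord (secIdx s) v := by
  rw [head, map_sum, map_sum]
  exact Finset.sum_congr rfl fun s _ => by rw [tauOp_smul, coord_smul, mul_comm]

/-! ### The time derivatives of `tauOp` -/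

theorem minusPart_tDer (j : Fin (N + 1)) (x : Loop N) :
    minusPart (tDer j x) = tDer j (minusPart x) := by
  apply ext_lamCoeff; intro k
  rw [lamCoeff_minusPart, lamCoeff_tDer, lamCoeff_tDer, lamCoeff_minusPart]
  split_ifs <;> simp

theorem tDer_mulVec (j : Fin (N + 1)) (X : Matrix (Idx m n) (Idx m n) (Loop N))
    (v : Idx m n → Loop N) :
    (fun a => tDer j ((X *ᵥ v) a)) = X.map (tDer j) *ᵥ v + X *ᵥ fun a => tDer j (v a) := by
  ext1 a
  simp only [Matrix.mulVec, dotProduct, map_sum, Pi.add_apply, isLeibniz_tDer j _ _,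
    Finset.sum_add_distrib, Matrix.map_apply]

theorem tDer_compress (j : Fin (N + 1)) (X : Matrix (Idx m n) (Idx m n) (Loop N))
    (v : Idx m n → Loop N) : (fun a => tDer j (compress X v a)) =
      compress (X.map (tDer j)) v + compress X fun a => tDer j (v a) := by
  ext1 a
  have h := congrFun (tDer_mulVec j X v) a
  simp only [compress, Pi.add_apply] at *
  rw [← minusPart_tDer, h]
  exact map_add minusHom _ _

theorem tDer_negBasis (j : Fin (N + 1)) (q : ℕ × Idx m n) :
    (fun a => tDer j (negBasis q a)) = (0 : Idx m n → Loop N) := by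
  ext1 a
  rw [negBasis]
  by_cases ha : a = q.2
  · subst ha
    rw [Pi.single_eq_same, tDer_lamPow]; rfl
  · rw [Pi.single_eq_of_ne ha, map_zero]; rfl

theorem Jmat_pow_mem_Ici (k : ℕ) : Jmat m n N ^ k ∈ unifSupp (N := N) (Set.Ici 0) :=
  unifSupp_mono Set.Icc_subset_Ici_self (Jmat_pow_mem k)

theorem Jmat_pow_mem_Iic (k : ℕ) : Jmat m n N ^ k ∈ unifSupp (N := N) (Set.Iic (k : ℤ)) :=
  unifSupp_mono Set.Icc_subset_Iic_self (Jmat_pow_mem k)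

/-- `d(M⁻¹) d(M J^k)` applied to `v`. -/
def shifted (M : GL (Idx m n) (Loop N)) (k : ℕ) (v : Idx m n → Loop N) : Idx m n → Loop N :=
  (M⁻¹).val *ᵥ compress (M.val * Jmat m n N ^ k) v

variable {f : GL (Idx m n) (LaurentSeries ℂ)} {M E : GL (Idx m n) (Loop N)}

theorem IsMinus.shifted_mem (h : IsMinus M) (k : ℕ) (v : Idx m n → Loop N) :
    shifted M k v ∈ vecSupp m n N (Set.Iio 0) :=
  mulVec_mem_vecSupp Iic_add_Iio h.inv_mem (compress_mem _ _)

/-- From `a_t = -J^k a` and `(a⁻¹)_t = a⁻¹ J^k`. On the left, `d(J^k a) = d(J^k) d(a)`. On the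
right, `a⁻¹ = E⁻¹ M` and `d(E⁻¹ M J^k) = d(E⁻¹) d(M J^k) = d(a⁻¹) M⁻¹ d(M J^k)`, since `M⁻¹`
preserves `H₋`. -/
theorem IsFactorization.tDer_tauOp (h : IsFactorization f M E) (j : Fin (N + 1))
    (q : ℕ × Idx m n) : (fun a => tDer j (tauOp (M⁻¹ * E) (negBasis q) a)) =
      -compress (Jmat m n N ^ (2 * (j : ℕ) + 1)) (tauOp (M⁻¹ * E) (negBasis q)) +
        tauOp (M⁻¹ * E) (shifted M (2 * (j : ℕ) + 1) (negBasis q)) := by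
  set k := 2 * (j : ℕ) + 1
  have ha : (M⁻¹ * E).val.map (tDer j) = -(Jmat m n N ^ k * (M⁻¹ * E).val) := h.map_tDer_quotient j
  have hb : ((M⁻¹ * E)⁻¹).val.map (tDer j) = ((M⁻¹ * E)⁻¹).val * Jmat m n N ^ k := by
    rw [map_mul_inv_cancel (isLeibniz_tDer j), ha, mul_neg, neg_mul, neg_neg, mul_assoc, mul_assoc,
      Units.mul_inv, mul_one]
  have hb' : ((M⁻¹ * E)⁻¹).val = (E⁻¹).val * M.val := by
    rw [_root_.mul_inv_rev, inv_inv]; rfl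
  have hs : compress (((M⁻¹ * E)⁻¹).val * Jmat m n N ^ k) (negBasis q) =
      compress ((M⁻¹ * E)⁻¹).val (shifted M k (negBasis q)) := by
    have e : compress M.val (shifted M k (negBasis q)) =
        compress (M.val * Jmat m n N ^ k) (negBasis q) := by
      rw [compress_of_minus h.1.mem (h.1.shifted_mem k _), shifted, Matrix.mulVec_mulVec,
        Units.mul_inv, Matrix.one_mulVec]
    rw [hb', mul_assoc, ← compress_compress h.2.1.inv_mem, ← compress_compress h.2.1.inv_mem, e]
  simp only [tauOp_apply]
  rw [tDer_compress, tDer_compress, tDer_negBasis, ha, hb, hs, compress_neg_mat,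
    ← compress_compress (Jmat_pow_mem_Ici k)]
  congr 2
  rw [show compress _ 0 = 0 from map_zero (compressHom _), add_zero]

/-! ### The determinant -/

/-- Here `Y` is the truncation error, supported in rows with `s` and columns without `s`. Where `s`
holds, the columns of `X` are unit vectors, so those of the adjugate are `det X` times unit vectors;
they pair with the support of `Y` to zero. -/
theorem trace_adjugate_mul {R ι : Type*} [CommRing R] [Fintype ι] [DecidableEq ι]
    {X X' A Y C : Matrix ι ι R} (s : ι → Prop) (hX' : X' = -(A * X) - Y + X * C)
    (hX : ∀ p q, s q → X p q = (1 : Matrix ι ι R) p q) (hY : ∀ p q, ¬ s p ∨ s q → Y p q = 0) :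
    (X.adjugate * X').trace = X.det * (C.trace - A.trace) := by
  have hadj : ∀ p q, s q → X.adjugate p q = X.det * (1 : Matrix ι ι R) p q := by
    intro p q hq
    have h1 := congrFun (congrFun (Matrix.adjugate_mul X) p) q
    rw [Matrix.mul_apply, Finset.sum_eq_single q, hX _ _ hq, Matrix.one_apply_eq, mul_one] at h1
    · exact h1
    · intro l _ hl
      rw [hX _ _ hq, Matrix.one_apply_ne hl, mul_zero]
    · simp
  have hz : (X.adjugate * Y).trace = 0 := by
    rw [Matrix.trace]
    refine Finset.sum_eq_zero fun p _ => ?_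
    rw [Matrix.diag_apply, Matrix.mul_apply]
    refine Finset.sum_eq_zero fun q _ => ?_
    by_cases h : ¬ s q ∨ s p
    · rw [hY _ _ h, mul_zero]
    · rw [not_or, not_not] at h
      have : p ≠ q := fun he => h.2 (he ▸ h.1)
      rw [hadj _ _ h.1, Matrix.one_apply_ne this, mul_zero, zero_mul]
  have h1 : X.adjugate * X' = -(X.adjugate * (A * X)) - X.adjugate * Y + X.adjugate * X * C := by
    rw [hX']; noncomm_ring
  rw [h1, Matrix.trace_add, Matrix.trace_sub, Matrix.trace_neg, hz, Matrix.adjugate_mul,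
    smul_mul_assoc, one_mul, Matrix.trace_smul, Matrix.trace_mul_comm X.adjugate, mul_assoc,
    Matrix.mul_adjugate, mul_smul_comm, mul_one, Matrix.trace_smul, smul_eq_mul, smul_eq_mul]
  ring

theorem secIdx_fst {K : ℕ} (p : Fin K × Idx m n) : (secIdx p).1 = p.1 := rfl

theorem sDer_coord (j : Fin (N + 1)) (p : ℕ × Idx m n) (v : Idx m n → Loop N) :
    sDer j (coord p v) = coord p fun a => tDer j (v a) := (lamCoeff_tDer _ _ _).symm

theorem tauOp_negBasis_sub_mem {a : GL (Idx m n) (Loop N)} {D P K : ℕ}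
    (hP : BoundedMod D P (a⁻¹).val) (q : Fin K × Idx m n) (hq : P ≤ q.1) :
    tauOp a (negBasis (secIdx q)) - negBasis (secIdx q) ∈ vecIdeal m n N D := by
  refine tauOp_sub_mem hP fun b => lamSupp_mono ?_ (negBasis_mem (secIdx q) b)
  rintro _ rfl
  simp only [Set.mem_Iio, secIdx_fst]
  omega

theorem sec_tauOp_sub_one_mem {a : GL (Idx m n) (Loop N)} {D P K : ℕ}
    (hP : BoundedMod D P (a⁻¹).val) (p q : Fin K × Idx m n) (hq : P ≤ q.1) :
    sec K (tauOp a) p q - (1 : Matrix (Fin K × Idx m n) (Fin K × Idx m n) (TSeries N)) p q ∈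
      tIdeal N ℂ D := by
  have h1 := coord_mem_tIdeal (secIdx p) (tauOp_negBasis_sub_mem hP q hq)
  rw [map_sub, coord_negBasis] at h1
  rw [Matrix.one_apply]
  simp only [secIdx_injective.eq_iff] at h1
  exact h1

theorem IsFactorization.sDer_det_sec (h : IsFactorization f M E) (j : Fin (N + 1)) {D P K : ℕ}
    (hP : BoundedMod D P ((M⁻¹ * E)⁻¹).val) (hK : P + (2 * (j : ℕ) + 1) ≤ K) :
    sDer j (sec K (tauOp (M⁻¹ * E))).det - (sec K (tauOp (M⁻¹ * E))).det *
      ((sec K (shifted M (2 * (j : ℕ) + 1))).trace -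
        (sec K (fun v => Jmat m n N ^ (2 * (j : ℕ) + 1) *ᵥ v)).trace) ∈ tIdeal N ℂ D := by
  set k := 2 * (j : ℕ) + 1
  set a := M⁻¹ * E
  set R := sec K (tauOp a) with hR
  set A := sec K (fun v => Jmat m n N ^ k *ᵥ v) with hA
  set C := sec K (shifted M k) with hC
  set Y : Matrix (Fin K × Idx m n) (Fin K × Idx m n) (TSeries N) := of fun p q =>
    coord (secIdx p) (Jmat m n N ^ k *ᵥ tail K (tauOp a (negBasis (secIdx q)))) with hY
  -- `J^k` raises powers of `λ` by at most `k`, so the discarded tail returns only to the last `k`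
  -- levels; `P + k ≤ K` places these at level `P` or beyond.
  have hY1 : ∀ p q : Fin K × Idx m n, ¬ P ≤ p.1 → Y p q = 0 := by
    intro p q hp
    refine coord_eq_zero (s := Set.Iio ((k : ℤ) - K)) ?_ (mulVec_mem_vecSupp ?_ (Jmat_pow_mem_Iic k)
      (tail_mem K (compress_mem _ _)))
    · simp only [Set.mem_Iio, secIdx_fst]; omega
    · intro i hi l hl
      simp only [Set.mem_Iio, Set.mem_Iic] at *
      omega
  -- For a column at level `P` or beyond, `T` fixes the basis vector modulo order `D`, so the tail
  -- is negligible.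
  have hY2 : ∀ p q : Fin K × Idx m n, P ≤ q.1 → Y p q ∈ tIdeal N ℂ D := by
    intro p q hq
    refine coord_mem_tIdeal _ (mulVec_mem_vecIdeal _ ?_)
    set v := tauOp a (negBasis (secIdx q))
    have e : tail K v = (v - negBasis (secIdx q)) - (head K v - negBasis (secIdx q)) := by
      rw [tail]; abel
    have e2 : head K (negBasis (N := N) (secIdx q)) = negBasis (secIdx q) := by
      rw [head, Finset.sum_eq_single q]
      · rw [coord_negBasis, if_pos rfl, map_one, one_smul]
      · intro s _ hs
        rw [coord_negBasis, if_neg (fun h => hs (secIdx_injective h)), map_zero, zero_smul]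
      · simp
    have e3 : head K v - negBasis (secIdx q) ∈ vecIdeal m n N D := by
      have e4 : head K v - head K (negBasis (secIdx q)) ∈ vecIdeal m n N D := ?_
      · rwa [e2] at e4
      rw [head, head, ← Finset.sum_sub_distrib]
      refine sum_mem fun s _ b => ?_
      rw [← sub_smul, ← map_sub, ← map_sub]
      refine Ideal.mul_mem_right _ _ (mem_tIdeal_of_lamCoeff fun l => ?_)
      rw [lamCoeff_constLoop]
      split_ifs
      · exact coord_mem_tIdeal _ (tauOp_negBasis_sub_mem hP q hq)
      · exact zero_mem _
    rw [e]
    exact sub_mem (tauOp_negBasis_sub_mem hP q hq) e3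
  have hder : ∀ p q, sDer j (R p q) - (-(A * R) - Y + R * C) p q ∈ tIdeal N ℂ D := by
    intro p q
    have e0 : sDer j (R p q) = -coord (secIdx p) (Jmat m n N ^ k *ᵥ tauOp a (negBasis (secIdx q))) +
        coord (secIdx p) (tauOp a (shifted M k (negBasis (secIdx q)))) := by
      rw [hR, sec, of_apply, sDer_coord, h.tDer_tauOp j, map_add, map_neg, coord_compress]
    have e1 : coord (secIdx p) (Jmat m n N ^ k *ᵥ tauOp a (negBasis (secIdx q))) =
        (A * R) p q + Y p q := by
      conv_lhs => rw [← head_add_tail K (tauOp a (negBasis (secIdx q)))]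
      rw [Matrix.mulVec_add, map_add, coord_mulVec_head, Matrix.mul_apply]
      rfl
    have e2 : coord (secIdx p) (tauOp a (shifted M k (negBasis (secIdx q)))) =
        (R * C) p q + coord (secIdx p) (tauOp a (tail K (shifted M k (negBasis (secIdx q))))) := by
      conv_lhs => rw [← head_add_tail K (shifted M k (negBasis (secIdx q)))]
      rw [map_add, map_add, coord_tauOp_head, Matrix.mul_apply]
      rfl
    -- The tail of `shifted` lies so deep that `T` acts on it as the identity, and a tail has no
    -- coordinates in the section.
    have e3 : coord (secIdx p) (tauOp a (tail K (shifted M k (negBasis (secIdx q))))) ∈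
        tIdeal N ℂ D := by
      have h1 : tail K (shifted M k (negBasis (secIdx q))) ∈ vecSupp m n N (Set.Iio (-(P : ℤ))) := by
        intro b
        refine lamSupp_mono ?_ (tail_mem K (h.1.shifted_mem k _) b)
        intro i hi
        simp only [Set.mem_Iio] at *
        omega
      have h2 := coord_mem_tIdeal (secIdx p) (tauOp_sub_mem hP h1)
      rwa [map_sub, coord_tail, sub_zero] at h2
    have e4 : sDer j (R p q) - (-(A * R) - Y + R * C) p q =
        coord (secIdx p) (tauOp a (tail K (shifted M k (negBasis (secIdx q))))) := by
      rw [e0, e1, e2, Matrix.add_apply, Matrix.sub_apply, Matrix.neg_apply]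
      ring
    rw [e4]
    exact e3
  -- The hypotheses hold only modulo order `D`, so the exact matrix identity is applied over the
  -- quotient ring.
  have hfin := trace_adjugate_mul (X := R.map (Ideal.Quotient.mk (tIdeal N ℂ D)))
    (X' := (R.map (sDer j)).map (Ideal.Quotient.mk (tIdeal N ℂ D)))
    (A := A.map (Ideal.Quotient.mk (tIdeal N ℂ D)))
    (Y := Y.map (Ideal.Quotient.mk (tIdeal N ℂ D)))
    (C := C.map (Ideal.Quotient.mk (tIdeal N ℂ D))) (fun p => P ≤ p.1) ?_ ?_ ?_
  · rw [← Ideal.Quotient.eq, der_det (isLeibniz_sDer j), map_mul, map_sub, RingHom.map_det]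
    have t : ∀ X : Matrix (Fin K × Idx m n) (Fin K × Idx m n) (TSeries N),
        Ideal.Quotient.mk (tIdeal N ℂ D) X.trace =
          (X.map (Ideal.Quotient.mk (tIdeal N ℂ D))).trace := by
      intro X; rw [Matrix.trace, Matrix.trace, map_sum]; rfl
    rw [t, t, t, Matrix.map_mul]
    have t2 : R.adjugate.map (Ideal.Quotient.mk (tIdeal N ℂ D)) =
        (R.map (Ideal.Quotient.mk (tIdeal N ℂ D))).adjugate := RingHom.map_adjugate _ _
    rw [t2]
    exact hfin
  · rw [← Matrix.map_mul, ← Matrix.map_mul]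
    ext1 p q
    simp only [Matrix.map_apply, Matrix.add_apply, Matrix.sub_apply, Matrix.neg_apply,
      ← map_neg, ← map_sub, ← map_add]
    exact Ideal.Quotient.eq.mpr (hder p q)
  · intro p q hq
    have := Ideal.Quotient.eq.mpr (sec_tauOp_sub_one_mem hP p q hq)
    rw [Matrix.map_apply, this, Matrix.one_apply, Matrix.one_apply]
    split_ifs <;> simp
  · intro p q hpq
    rw [Matrix.map_apply, Ideal.Quotient.eq_zero_iff_mem]
    rcases hpq with hp | hq
    · rw [hY1 p q hp]; exact zero_mem _
    · exact hY2 p q hq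

end

/-! ### First and second logarithmic derivatives of `τ`, and their expression through `S`. -/

section

variable {m n N : ℕ}

/-! ### The logarithmic derivatives of the tau function -/

theorem lamDer_mem_Ici {a : Loop N} (h : a ∈ lamSupp (Set.Ici 0)) :
    lamDer a ∈ lamSupp (Set.Ici 0) := by
  intro k hk
  have hk : k < 0 := by simpa using hk
  rw [lamCoeff_lamDer]
  by_cases h1 : k = -1
  · rw [h1, neg_add_cancel, Int.cast_zero, zero_mul]
  · rw [h (k + 1) (by simp only [Set.mem_Ici]; omega), mul_zero]

/-- A power `λ^i` with `i ≥ 0` survives in the summands with `l + 1 ≤ i`, that is `i` times if `i ≤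
K`. This count is the source of `∂_λ`, and hence of the cocycle. -/
theorem sum_lamPow_mul_plusPart {K : ℕ} {g : Loop N} (hg : g ∈ lamSupp (Set.Iic (K : ℤ))) :
    ∑ l : Fin K, lamPow ((l : ℤ) + 1) * plusPart (lamPow (-((l : ℤ) + 1)) * g) =
      plusPart (lamPow 1 * lamDer g) := by
  apply ext_lamCoeff; intro i
  have h1 : ∀ l : Fin K,
      lamCoeff i (lamPow ((l : ℤ) + 1) * plusPart (lamPow (-((l : ℤ) + 1)) * g)) =
        if ((l : ℕ) : ℤ) + 1 ≤ i then lamCoeff i g else 0 := by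
    intro l
    rw [lamCoeff_lamPow_mul, lamCoeff_plusPart, lamCoeff_lamPow_mul, sub_neg_eq_add, sub_add_cancel]
    exact if_congr (by omega) rfl rfl
  rw [lamCoeff_sum, Finset.sum_congr rfl fun l _ => h1 l, lamCoeff_plusPart, lamCoeff_lamPow_mul,
    lamCoeff_lamDer, sub_add_cancel]
  by_cases h0 : 0 ≤ i
  · obtain ⟨i, rfl⟩ := Int.eq_ofNat_of_zero_le h0
    rw [if_pos h0]
    by_cases hi : i ≤ K
    · rw [Fin.sum_univ_eq_sum_range (fun l => if (l : ℤ) + 1 ≤ (i : ℤ) then lamCoeff i g else 0) K,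
        ← Finset.sum_filter]
      have : Finset.filter (fun l : ℕ => (l : ℤ) + 1 ≤ (i : ℤ)) (Finset.range K) =
          Finset.range i := by
        ext l
        simp only [Finset.mem_filter, Finset.mem_range]
        omega
      rw [this, Finset.sum_const, Finset.card_range, nsmul_eq_mul, Int.cast_natCast]
    · rw [hg (i : ℤ) (by simp only [Set.mem_Iic]; omega), mul_zero]
      exact Finset.sum_eq_zero fun _ _ => ite_self _
  · rw [if_neg h0]
    exact Finset.sum_eq_zero fun l _ => if_neg (by omega)

theorem lamCoeff_zero_mul_plusPart {y : Loop N} (hy : y ∈ lamSupp (Set.Iic 0)) (h : Loop N) :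
    lamCoeff 0 (y * plusPart h) = lamCoeff 0 (y * h) := by
  conv_rhs => rw [← plusPart_add_minusPart h, mul_add, lamCoeff_add]
  rw [mul_mem_lamSupp Iic_add_Iio hy (minusPart_mem h) 0 (by simp), add_zero]

theorem mulVec_negBasis (X : Matrix (Idx m n) (Idx m n) (Loop N)) (q : ℕ × Idx m n)
    (c : Idx m n) : (X *ᵥ negBasis q) c = lamPow (-((q.1 : ℤ) + 1)) * X c q.2 := by
  rw [negBasis, Matrix.mulVec_single, mul_comm]
  rfl

/-- `-⟨M⁻¹, ∂_λ (M J^k)⟩_{-1}`. -/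
def tauLog (M : GL (Idx m n) (Loop N)) (k : ℕ) : TSeries N :=
  -lamCoeff (-1) ((M⁻¹).val * (M.val * Jmat m n N ^ k).map lamDer).trace

variable {f : GL (Idx m n) (LaurentSeries ℂ)} {M E : GL (Idx m n) (Loop N)}

/-- On `H₋` the difference of the two operators is `-M⁻¹ P₊ M J^k`. It kills `λ^{-l-1}` for `l ≥ k`,
so the finite trace is independent of `K ≥ k`. -/
theorem IsMinus.trace_sec_shifted (h : IsMinus M) {k K : ℕ} (hK : k ≤ K) :
    (sec K (shifted M k)).trace - (sec K (fun v => Jmat m n N ^ k *ᵥ v)).trace = tauLog M k := by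
  set X := M.val * Jmat m n N ^ k
  have hX : X ∈ unifSupp (N := N) (Set.Iic (K : ℤ)) := by
    refine add_le_mul ?_ h.mem (Jmat_pow_mem_Iic k)
    intro i hi j hj
    simp only [Set.mem_Iic] at *
    omega
  have e : ∀ p : Fin K × Idx m n, sec K (shifted M k) p p - sec K (fun v => Jmat m n N ^ k *ᵥ v) p p =
      -∑ c, lamCoeff 0 ((M⁻¹).val p.2 c *
        (lamPow ((p.1 : ℤ) + 1) * plusPart (lamPow (-((p.1 : ℤ) + 1)) * X c p.2))) := by
    intro p
    have e1 : Jmat m n N ^ k *ᵥ negBasis (secIdx p) - shifted M k (negBasis (secIdx p)) =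
        (M⁻¹).val *ᵥ (X *ᵥ negBasis (secIdx p) - compress X (negBasis (secIdx p))) := by
      have e2 : (M⁻¹).val *ᵥ (X *ᵥ negBasis (secIdx p)) = Jmat m n N ^ k *ᵥ negBasis (secIdx p) := by
        rw [Matrix.mulVec_mulVec, ← mul_assoc, Units.inv_mul, one_mul]
      rw [Matrix.mulVec_sub, e2]
      rfl
    have e3 : X *ᵥ negBasis (secIdx p) - compress X (negBasis (secIdx p)) =
        fun c => plusPart (lamPow (-((p.1 : ℤ) + 1)) * X c p.2) := by
      ext1 c
      rw [← secIdx_fst p, Pi.sub_apply, compress, sub_eq_iff_eq_add, mulVec_negBasis]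
      exact (plusPart_add_minusPart _).symm
    rw [sec, sec, of_apply, of_apply, ← map_sub, ← neg_inj, ← map_neg, neg_sub, e1, e3, neg_neg,
      coord_apply, Matrix.mulVec, dotProduct, lamCoeff_sum]
    refine Finset.sum_congr rfl fun c _ => ?_
    rw [mul_left_comm, lamCoeff_lamPow_mul, zero_sub]
    rfl
  rw [Matrix.trace, Matrix.trace, ← Finset.sum_sub_distrib]
  simp only [Matrix.diag_apply]
  rw [Finset.sum_congr rfl fun p _ => e p, Fintype.sum_prod_type_right, tauLog, Matrix.trace,
    lamCoeff_sum]
  simp only [Finset.sum_neg_distrib]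
  congr 1
  refine Finset.sum_congr rfl fun b _ => ?_
  rw [Finset.sum_comm, Matrix.diag_apply, Matrix.mul_apply, lamCoeff_sum]
  refine Finset.sum_congr rfl fun c _ => ?_
  rw [← lamCoeff_sum, ← Finset.mul_sum, sum_lamPow_mul_plusPart (hX c b),
    lamCoeff_zero_mul_plusPart (h.inv_mem b c), mul_left_comm, lamCoeff_lamPow_mul, zero_sub]
  rfl

/-- Every `w` in `H₋` is `d(M⁻¹) d(E)` of `d(E⁻¹) d(M) w`, so `r` is determined on all of `H₋`;
moreover `d(W) d(f⁻¹) = d(a)` there. -/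
theorem IsFactorization.exists_hasDet (h : IsFactorization f M E)
    (hf : IsMinus (constTime f : GL (Idx m n) (Loop N))) {τ : TSeries N}
    (hτ : EqScalar τ (lift (vacuum m n N) * lift (constTime f⁻¹ : GL (Idx m n) (Loop N)).val)
      (lift (M⁻¹).val * lift E.val)) :
    ∃ r : (Idx m n → Loop N) → (Idx m n → Loop N), HasDet r τ ∧
      ∀ w ∈ vecSupp m n N (Set.Iio 0), r w = tauOp (M⁻¹ * E) w := by
  obtain ⟨-, r, hr, hv⟩ := hτ
  refine ⟨r, hr, fun w hw => ?_⟩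
  have hone : ∀ w ∈ vecSupp m n N (Set.Iio 0), compress (1 : Matrix _ _ (Loop N)) w = w :=
    fun w hw => by rw [compress_eq_mulVec (by rwa [Matrix.one_mulVec]), Matrix.one_mulVec]
  have h1 := hv (compress (E⁻¹).val (compress M.val w)) (isNeg_iff.mpr (compress_mem _ _))
  have e1 : (lift (M⁻¹).val * lift E.val).op (compress (E⁻¹).val (compress M.val w)) = w := by
    change compress (M⁻¹).val (compress E.val (compress (E⁻¹).val (compress M.val w))) = w
    rw [compress_compress h.2.1.mem, Units.mul_inv, hone _ (compress_mem _ _),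
      compress_of_minus h.1.mem hw]
    have e : (M⁻¹).val *ᵥ (M.val *ᵥ w) = w := by
      rw [Matrix.mulVec_mulVec, Units.inv_mul, Matrix.one_mulVec]
    rw [compress_eq_mulVec (by rwa [e]), e]
  have e2 : (lift (vacuum m n N) * lift (constTime f⁻¹ : GL (Idx m n) (Loop N)).val).op
      (compress (E⁻¹).val (compress M.val w)) = tauOp (M⁻¹ * E) w := by
    change compress (vacuum m n N) (compress (constTime f⁻¹ : GL (Idx m n) (Loop N)).val
      (compress (E⁻¹).val (compress M.val w))) = _
    have hfi : (constTime f⁻¹ : GL (Idx m n) (Loop N)).val ∈ unifSupp (N := N) (Set.Iic 0) := by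
      rw [map_inv]; exact hf.inv_mem
    have e3 : ∀ v, compress (vacuum m n N) ((constTime f⁻¹ : GL (Idx m n) (Loop N)).val *ᵥ v) =
        compress (M⁻¹ * E).val v := by
      intro v
      ext1 a
      rw [compress, compress, Matrix.mulVec_mulVec, h.2.2]
      rfl
    rw [compress_of_minus hfi (compress_mem _ _), e3, compress_compress h.2.1.inv_mem, tauOp_apply,
      _root_.mul_inv_rev, inv_inv]
    rfl
  rw [e1, e2] at h1
  exact h1.symm

/-- `τ` is the determinant of `d(a) d(a⁻¹)`. -/
def IsTauDet (a : GL (Idx m n) (Loop N)) (τ : TSeries N) : Prop :=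
  ∀ D : ℕ, ∀ᶠ K : ℕ in atTop, τ - (sec K (tauOp a)).det ∈ tIdeal N ℂ D

theorem HasDet.isTauDet {a : GL (Idx m n) (Loop N)} {τ : TSeries N}
    {r : (Idx m n → Loop N) → (Idx m n → Loop N)} (h : HasDet r τ)
    (hr : ∀ w ∈ vecSupp m n N (Set.Iio 0), r w = tauOp a w) : IsTauDet a τ := by
  intro D
  -- There are finitely many monomials of degree at most `D`, so one bound on `K` serves them all.
  have h1 := (eventually_all_finite (l := atTop) (Finsupp.finite_of_degree_le D)).mpr
    fun d (_ : d ∈ {d : Fin (N + 1) →₀ ℕ | d.degree ≤ D}) => h.2 d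
  filter_upwards [h1] with K hK d hd
  rw [map_sub, sub_eq_zero, ← hK d hd]
  congr 2
  ext1 p q
  rw [of_apply, opEntry, hr, sec, of_apply, coord_apply]
  · rfl
  · intro b
    refine lamSupp_mono ?_ (negBasis_mem _ b)
    rintro _ rfl
    simp only [Set.mem_Iio]
    omega

theorem IsFactorization.sDer_tau (h : IsFactorization f M E) {τ : TSeries N}
    (hτ : IsTauDet (M⁻¹ * E) τ) (j : Fin (N + 1)) :
    sDer j τ = τ * tauLog M (2 * (j : ℕ) + 1) := by
  rw [← sub_eq_zero]
  refine eq_zero_of_forall_mem_tIdeal fun D => ?_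
  -- The section approximates `τ` to order `D + 1`, since differentiating loses one order.
  obtain ⟨P, hP⟩ := exists_boundedMod D ((M⁻¹ * E)⁻¹).val
  obtain ⟨K, hK1, hK2⟩ := ((hτ (D + 1)).and (eventually_ge_atTop (P + (2 * (j : ℕ) + 1)))).exists
  have h1 := h.sDer_det_sec j hP hK2
  rw [h.1.trace_sec_shifted (by omega)] at h1
  have h2 := sDer_mem_tIdeal j hK1
  have h3 := Ideal.mul_mem_right (tauLog M (2 * (j : ℕ) + 1)) _ (tIdeal_anti D.le_succ hK1)
  have h4 := sub_mem (add_mem h2 h1) h3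
  rw [map_sub] at h4
  convert h4 using 1
  ring

theorem IsFactorization.constantCoeff_tau (h : IsFactorization f M E)
    (hf : IsMinus (constTime f : GL (Idx m n) (Loop N))) {τ : TSeries N}
    (hτ : IsTauDet (M⁻¹ * E) τ) : MvPowerSeries.constantCoeff τ = 1 := by
  have hW : ∀ b c, (1 - vacuum m n N) b c ∈ tIdeal N (LaurentSeries ℂ) 0 := by
    intro b c d hd
    have : d = 0 := by rwa [Nat.le_zero, Finsupp.degree_eq_zero_iff] at hd
    rw [this, MvPowerSeries.coeff_zero_eq_constantCoeff_apply, Matrix.sub_apply, map_sub,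
      constantCoeff_vacuum, Matrix.one_apply, Matrix.one_apply]
    split_ifs <;> simp
  have e : ((M⁻¹ * E)⁻¹).val = (constTime f : GL (Idx m n) (Loop N)).val +
      ((M⁻¹ * E)⁻¹).val * (1 - vacuum m n N) := by
    have e1 : vacuum m n N = (M⁻¹ * E).val * (constTime f : GL (Idx m n) (Loop N)).val := by
      rw [Units.val_mul, ← h.2.2, map_inv, mul_assoc, Units.inv_mul, mul_one]
    rw [e1, mul_sub, ← mul_assoc, Units.inv_mul, mul_one, one_mul, add_sub_cancel]
  -- At `t = 0` the vacuum is `1` and `a⁻¹ = f` has no positive powers. So the bound `P = 0` applies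
  -- and every column of the section is a unit vector.
  have hP : BoundedMod 0 0 ((M⁻¹ * E)⁻¹).val := by
    intro b c k hk
    rw [e, Matrix.add_apply, lamCoeff_add, hf.mem b c k (by simpa using hk), zero_add]
    refine lamCoeff_mem_tIdeal k ?_
    rw [Matrix.mul_apply]
    exact sum_mem fun i _ => Ideal.mul_mem_left _ _ (hW i c)
  obtain ⟨K, hK⟩ := (hτ 0).exists
  have h0 : ∀ x ∈ tIdeal N ℂ 0, MvPowerSeries.constantCoeff x = 0 := fun x hx => by
    rw [← MvPowerSeries.coeff_zero_eq_constantCoeff_apply]; exact hx 0 (by simp)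
  have h1 := h0 _ hK
  have h2 : (sec K (tauOp (M⁻¹ * E))).map MvPowerSeries.constantCoeff = 1 := by
    ext1 p q
    have h3 := h0 _ (sec_tauOp_sub_one_mem (P := 0) hP p q (Nat.zero_le _))
    rw [map_sub, sub_eq_zero] at h3
    rw [Matrix.map_apply, h3, Matrix.one_apply, Matrix.one_apply]
    split_ifs <;> simp
  rw [map_sub, sub_eq_zero] at h1
  rw [h1, RingHom.map_det]
  exact (congrArg Matrix.det h2).trans Matrix.det_one

theorem sDer_comm (i j : Fin (N + 1)) (a : TSeries N) : sDer i (sDer j a) = sDer j (sDer i a) := by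
  have h := congrArg (lamCoeff 0) (tDer_comm i j (constLoop a))
  simpa only [lamCoeff_tDer, lamCoeff_constLoop, if_true] using h

theorem trace_map_der {R ι : Type*} [CommRing R] [Fintype ι] (D : R →+ R) (X : Matrix ι ι R) :
    D X.trace = (X.map D).trace := by
  rw [Matrix.trace, Matrix.trace, map_sum]; rfl

theorem lamCoeff_trace_eq_zero {s : Set ℤ} {X : Matrix (Idx m n) (Idx m n) (Loop N)}
    (hX : X ∈ unifSupp (N := N) s) {k : ℤ} (hk : k ∉ s) : lamCoeff k X.trace = 0 := by
  rw [Matrix.trace, lamCoeff_sum]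
  exact Finset.sum_eq_zero fun a _ => hX a a k hk

/-- The terms with `∂_λ M` cancel under the trace because `A` and `B` commute. What is left is the
trace of `∂_λ A · B`, which has no negative powers of `λ`. -/
theorem pairing_lamDer_conj (M : GL (Idx m n) (Loop N))
    {A B : Matrix (Idx m n) (Idx m n) (Loop N)} (hAB : Commute A B)
    (hA : A ∈ unifSupp (N := N) (Set.Ici 0)) (hB : B ∈ unifSupp (N := N) (Set.Ici 0)) :
    lamCoeff (-1) ((M.val * A * (M⁻¹).val).map lamDer * (M.val * B * (M⁻¹).val)).trace = 0 := by
  have e : (M⁻¹).val * M.val = 1 := Units.inv_mul M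
  have h0 : lamCoeff (-1) (A.map lamDer * B).trace = 0 := by
    refine lamCoeff_trace_eq_zero (s := Set.Ici 0) (add_le_mul Ici_add_Ici ?_ hB) (by simp)
    exact fun a b => lamDer_mem_Ici (hA a b)
  have h1 : ((M.val * A * (M⁻¹).val).map lamDer * (M.val * B * (M⁻¹).val)).trace =
      (A.map lamDer * B).trace := by
    rw [map_der_mul isLeibniz_lamDer, map_der_mul isLeibniz_lamDer,
      map_mul_inv_cancel isLeibniz_lamDer]
    generalize M.val.map lamDer = M' at *
    generalize A.map lamDer = A' at *
    generalize M.val = V at *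
    generalize (M⁻¹).val = V' at *
    have h2 : ((M' * A + V * A') * V' + V * A * -(V' * M' * V')) * (V * B * V') =
        M' * (A * B) * V' + V * (A' * B) * V' - V * A * V' * M' * B * V' := by
      calc _ = M' * A * (V' * V) * B * V' + V * A' * (V' * V) * B * V' -
          V * A * V' * M' * (V' * V) * B * V' := by noncomm_ring
        _ = _ := by rw [e]; noncomm_ring
    rw [h2, Matrix.trace_sub, Matrix.trace_add]
    have t1 : (V * (A' * B) * V').trace = (A' * B).trace := by
      rw [Matrix.trace_mul_comm, ← mul_assoc, e, one_mul]
    have t2 : (V * A * V' * M' * B * V').trace = (M' * (A * B) * V').trace := by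
      rw [show V * A * V' * M' * B * V' = (V * A) * (V' * M' * B * V') by noncomm_ring,
        Matrix.trace_mul_comm,
        show V' * M' * B * V' * (V * A) = V' * (M' * B * (V' * V) * A) by noncomm_ring, e, mul_one,
        Matrix.trace_mul_comm, mul_assoc M' B A, hAB.eq]
    rw [t1, t2]
    ring
  rw [h1, h0]

theorem map_plusPart_eq_sub (X : Matrix (Idx m n) (Idx m n) (Loop N)) :
    X.map minusPart = X - X.map plusPart := by
  rw [eq_sub_iff_add_eq', map_plus_add_map_minus]

/-- The terms in which `∂_λ` misses `B = (L^i)_-` cancel, leaving `-⟨∂_λ (L^i)_-, L^k⟩_{-1}`; by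
`pairing_lamDer_conj` the negative part may be traded for the positive one with opposite sign. -/
theorem IsFactorization.sDer_tauLog (h : IsFactorization f M E) (i j : Fin (N + 1)) :
    sDer i (tauLog M (2 * (j : ℕ) + 1)) =
      pairing (-1) (laxPow M j) (((laxPow M i).map plusPart).map lamDer) := by
  set k := 2 * (j : ℕ) + 1 with hk
  set B := (laxPow M i).map minusPart with hB
  have hM : M.val.map (tDer i) = B * M.val := h.map_tDer_minus i
  have hMi : (M⁻¹).val.map (tDer i) = -((M⁻¹).val * B) := by
    rw [map_mul_inv_cancel (isLeibniz_tDer i), hM, mul_assoc, mul_assoc, Units.mul_inv, mul_one]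
  have hJ : (Jmat m n N ^ k).map (tDer i) = 0 :=
    map_der_pow (isLeibniz_tDer i) (map_tDer_Jmat i) k
  have hMJ : (M.val * Jmat m n N ^ k).map (tDer i) = B * (M.val * Jmat m n N ^ k) := by
    rw [map_der_mul (isLeibniz_tDer i), hJ, hM, mul_zero, add_zero, mul_assoc]
  have hc : ((M.val * Jmat m n N ^ k).map lamDer).map (tDer i) =
      ((M.val * Jmat m n N ^ k).map (tDer i)).map lamDer := by
    ext1 a b; exact tDer_lamDer _ _
  have h1 : ((M⁻¹).val * (M.val * Jmat m n N ^ k).map lamDer).map (tDer i) =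
      (M⁻¹).val * (B.map lamDer * (M.val * Jmat m n N ^ k)) := by
    rw [map_der_mul (isLeibniz_tDer i), hMi, hc, hMJ, map_der_mul isLeibniz_lamDer B]
    noncomm_ring
  have h2 : B.map lamDer = (laxPow M i).map lamDer - ((laxPow M i).map plusPart).map lamDer := by
    rw [hB, map_plusPart_eq_sub, map_der_sub]
  have h3 : lamCoeff (-1) ((laxPow M i).map lamDer * laxPow M j).trace = 0 :=
    pairing_lamDer_conj M ((Commute.refl _).pow_pow _ _) (Jmat_pow_mem_Ici _) (Jmat_pow_mem_Ici _)
  have h4 : ((M⁻¹).val * (B.map lamDer * (M.val * Jmat m n N ^ k))).trace =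
      (B.map lamDer * laxPow M j).trace := by
    rw [Matrix.trace_mul_comm, mul_assoc]
    rfl
  rw [tauLog, map_neg, ← lamCoeff_tDer, trace_map_der, h1, h4, h2, sub_mul, Matrix.trace_sub,
    lamCoeff_sub, h3, zero_sub, neg_neg, pairing, Matrix.trace_mul_comm]

theorem IsFactorization.logDeriv₂_eq (h : IsFactorization f M E)
    (hf : IsMinus (constTime f : GL (Idx m n) (Loop N))) {τ : TSeries N}
    (hτ : IsTauDet (M⁻¹ * E) τ) (i j : Fin (N + 1)) :
    logDeriv₂ i j τ = sDer i (tauLog M (2 * (j : ℕ) + 1)) := by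
  have hinv : τ⁻¹ * τ = 1 := MvPowerSeries.inv_mul_cancel τ (by
    rw [h.constantCoeff_tau hf hτ]; exact one_ne_zero)
  change sDer i (τ⁻¹ * sDer j τ) = _
  rw [h.sDer_tau hτ, ← mul_assoc, hinv, one_mul]

theorem IsFactorization.logDeriv₂_comm (h : IsFactorization f M E)
    (hf : IsMinus (constTime f : GL (Idx m n) (Loop N))) {τ : TSeries N}
    (hτ : IsTauDet (M⁻¹ * E) τ) (i j : Fin (N + 1)) : logDeriv₂ i j τ = logDeriv₂ j i τ := by
  have hinv : τ⁻¹ * τ = 1 := MvPowerSeries.inv_mul_cancel τ (by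
    rw [h.constantCoeff_tau hf hτ]; exact one_ne_zero)
  have h2 := sDer_comm i j τ
  rw [h.sDer_tau hτ, h.sDer_tau hτ, isLeibniz_sDer i, isLeibniz_sDer j, h.sDer_tau hτ,
    h.sDer_tau hτ] at h2
  have h3 : τ * sDer i (tauLog M (2 * (j : ℕ) + 1)) = τ * sDer j (tauLog M (2 * (i : ℕ) + 1)) := by
    linear_combination h2
  have h4 := congrArg (τ⁻¹ * ·) h3
  simp only [← mul_assoc, hinv, one_mul] at h4
  rw [h.logDeriv₂_eq hf hτ, h.logDeriv₂_eq hf hτ, h4]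

theorem IsFactorization.logDeriv₂_tau (h : IsFactorization f M E)
    (hf : IsMinus (constTime f : GL (Idx m n) (Loop N))) {τ : TSeries N}
    (hτ : IsTauDet (M⁻¹ * E) τ) (i j : Fin (N + 1)) :
    logDeriv₂ i j τ = pairing (-1) (laxPow M i) (((laxPow M j).map plusPart).map lamDer) := by
  rw [h.logDeriv₂_comm hf hτ, h.logDeriv₂_eq hf hτ, h.sDer_tauLog]

/-! ### The tau structure in terms of `S` -/

variable {q u : Matrix (Idx m n) (Idx m n) (TSeries N)} {g : GL (Idx m n) (TSeries N)}

theorem trace_conj_mul_conj {R ι : Type*} [CommRing R] [Fintype ι] [DecidableEq ι] (g : GL ι R)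
    (X Y : Matrix ι ι R) :
    (g.val * X * (g⁻¹).val * (g.val * Y * (g⁻¹).val)).trace = (X * Y).trace := by
  have e : (g⁻¹).val * g.val = 1 := Units.inv_mul g
  rw [show g.val * X * (g⁻¹).val * (g.val * Y * (g⁻¹).val) =
      g.val * (X * ((g⁻¹).val * g.val) * Y * (g⁻¹).val) by noncomm_ring, e, mul_one,
    Matrix.trace_mul_comm, mul_assoc, e, mul_one]

theorem map_lamDer_const_conj (g : GL (Idx m n) (TSeries N))
    (X : Matrix (Idx m n) (Idx m n) (Loop N)) :
    (g.val.map constLoop * X * (g⁻¹).val.map constLoop).map lamDer =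
      g.val.map constLoop * X.map lamDer * (g⁻¹).val.map constLoop := by
  rw [map_der_mul isLeibniz_lamDer, map_der_mul isLeibniz_lamDer, map_lamDer_constLoop,
    map_lamDer_constLoop, zero_mul, zero_add, mul_zero, add_zero]

theorem pairing_dressed (g : GL (Idx m n) (TSeries N)) (M : GL (Idx m n) (Loop N))
    (i j : Fin (N + 1)) :
    pairing (-1) (dressed g M ^ (2 * (i : ℕ) + 1))
      (((dressed g M ^ (2 * (j : ℕ) + 1)).map plusPart).map lamDer) =
    pairing (-1) (laxPow M i) (((laxPow M j).map plusPart).map lamDer) := by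
  rw [map_plusPart_dressed_pow, map_lamDer_const_conj, dressed_pow, pairing, pairing]
  exact congrArg _ (trace_conj_mul_conj (constGL g) _ _)

theorem lamDer_lamPow_one : lamDer (lamPow 1 : Loop N) = 1 := by
  apply ext_lamCoeff; intro k
  rw [lamCoeff_lamDer, lamCoeff_lamPow, lamCoeff_one]
  by_cases hk : k = 0
  · simp [hk]
  · rw [if_neg (by omega), if_neg hk, mul_zero]

theorem map_lamDer_Jmat : (Jmat m n N).map lamDer = eMat m n (Loop N) := by
  have h1 : (bMat m n (Loop N)).map lamDer = 0 := by
    rw [← map_constLoop_bMat, map_lamDer_constLoop]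
  rw [Jmat, map_der_add, h1, add_zero]
  ext1 a b
  rw [Matrix.map_apply, Matrix.smul_apply, smul_eq_mul, eMat, Matrix.single_apply]
  split_ifs
  · rw [mul_one, lamDer_lamPow_one]
  · rw [mul_zero, map_zero]

/-- `S_+ = Δ (J + q) Δ⁻¹ = Δ_x Δ⁻¹ + J + u`, in which only `J` depends on `λ`. -/
theorem SolutionData.map_lamDer_plusPart (h : SolutionData f M E q g u) :
    ((dressed g M).map plusPart).map lamDer = eMat m n (Loop N) := by
  have h1 := map_plusPart_dressed_pow (g := g) (M := M) 0
  rw [Fin.val_zero, mul_zero, zero_add, pow_one, laxPow_zero, ← h.plus] at h1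
  have h3 := gauge_loop h.mem h.gauge
  have e : g.val.map constLoop * (g⁻¹).val.map (constLoop (N := N)) = 1 :=
    Units.mul_inv (constGL g)
  rw [h1, h3, add_mul, mul_assoc _ _ ((g⁻¹).val.map constLoop), e, mul_one, map_tDer_constLoop,
    ← map_constLoop_mul, map_der_add, map_der_add, map_lamDer_constLoop, map_lamDer_constLoop,
    map_lamDer_Jmat, zero_add, add_zero]

end

end CKP

theorem mainTheorem9 (m n N : ℕ)
    (f : GL (CKP.Idx m n) (LaurentSeries ℂ))
    (hf : CKP.IsMinus (CKP.constTime f : GL (CKP.Idx m n) (CKP.Loop N)))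
    (τ : CKP.TSeries N) (hτ : CKP.IsTau f τ)
    (u : Matrix (CKP.Idx m n) (CKP.Idx m n) (CKP.TSeries N)) (hu : CKP.IsSolutionOf f u) :
    MvPowerSeries.constantCoeff τ = 1 ∧
    ∃ S : Matrix (CKP.Idx m n) (CKP.Idx m n) (CKP.Loop N),
      CKP.IsS u S ∧ (∀ S', CKP.IsS u S' → S' = S) ∧
      CKP.SolvesHierarchy u S ∧
      (∀ j : Fin (N + 1), CKP.logDeriv₂ 0 j τ =
        CKP.pairing (-1) (S ^ (2 * (j : ℕ) + 1)) (CKP.eMat m n (CKP.Loop N))) ∧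
      (∀ j k : Fin (N + 1), CKP.logDeriv₂ j k τ =
        CKP.pairing (-1) (S ^ (2 * (j : ℕ) + 1))
          (((S ^ (2 * (k : ℕ) + 1)).map CKP.plusPart).map CKP.lamDeriv)) := by
  obtain ⟨M, E, hfac, hs⟩ := hτ
  obtain ⟨M', E', q, Δ, hfac', hplus, hΔ, hV, hgauge⟩ := hu
  obtain rfl := hfac.unique hfac'
  obtain ⟨g, rfl, hg⟩ := hΔ.exists_unit
  have hd : CKP.SolutionData f M E q g u := ⟨hfac, hplus, hΔ, hg, hgauge⟩
  obtain ⟨r, hr, hw⟩ := hfac.exists_hasDet hf hs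
  have hdet : CKP.IsTauDet (M⁻¹ * E) τ := hr.isTauDet hw
  have h2 : ∀ j k : Fin (N + 1), CKP.logDeriv₂ j k τ =
      CKP.pairing (-1) (CKP.dressed g M ^ (2 * (j : ℕ) + 1))
        (((CKP.dressed g M ^ (2 * (k : ℕ) + 1)).map CKP.plusPart).map CKP.lamDer) := by
    intro j k
    rw [hfac.logDeriv₂_tau hf hdet, CKP.pairing_dressed]
  -- The index `0` has to be in the slot carrying `∂_λ S_+`, which is the constant matrix
  -- `e_{2m+1,2m+2n+1}`.
  have hsymm : ∀ j : Fin (N + 1), CKP.logDeriv₂ 0 j τ = CKP.logDeriv₂ j 0 τ := fun j => by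
    rw [hfac.logDeriv₂_comm hf hdet]
  refine ⟨hfac.constantCoeff_tau hf hdet, CKP.dressed g M, hd.isS, fun S' hS => hd.unique hS,
    hd.solves hV, fun j => ?_, h2⟩
  rw [hsymm, h2, Fin.val_zero, mul_zero, zero_add, pow_one, hd.map_lamDer_plusPart]

end
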